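/- **Setting.** Let $I=[-1,0]$, let $L:C(I,\mathbb R)\to\mathbb R$ be bounded and linear, and let $G:C(I,\mathbb R)\to\mathbb R$ be real analytic with $G(0)=0$, $G'(0)=0$. Write $L$ also for its complex linear extension to $C(I,\mathbb C)$ and $G$ also for a holomorphic extension to an open set $\Omega\subseteq C(I,\mathbb C)$ with $C(I,\mathbb R)\subseteq\Omega$. Fix $n\ge 1$ and let $\theta_j=\tfrac12(\cos(j\pi/n)-1)$, $0\le j\le n$, with Lagrange polynomials $\ell_0,\dots,\ell_n$; put $D=(\ell_j'(\theta_i))_{1\le i,j\le n}$, $\mathbf 1=(1,\dots,1)^T$ and $P(y_0,y)=y_0\ell_0+\sum_{j=1}^n y_j\ell_j$. The pseudospectral approximation of $\dot x(t)=Lx_t+G(x_t)$ is the ODE $$\frac{d}{dt}\begin{pmatrix}y_0\\y\end{pmatrix}=\mathcal A_n\begin{pmatrix}y_0\\y\end{pmatrix}+\begin{pmatrix}G(P(y_0,y))\\0\end{pmatrix},\qquad \mathcal A_n\begin{pmatrix}y_0\\y\end{pmatrix}=\begin{pmatrix}LP(y_0,y)\\-y_0D\mathbf 1+Dy\end{pmatrix},$$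 on $\mathbb R\times\mathbb R^n$, or, complexified, on $\{(y_0,y)\in\mathbb C\times\mathbb C^n: P(y_0,y)\in\Omega\}$. **Unstable manifolds.** Let $Q$ be analytic on an open neighbourhood $V$ of $0$ in a finite-dimensional space, with $Q(0)=0$, both an immersion and a topological embedding. We say that $Q$ parametrizes the local unstable manifold $Q(V)$ of the equilibrium $0$ of $\dot y=f(y)$ if every point of $Q(V)$ has a backward orbit $(-\infty,0]\to Q(V)$ that tends to $0$ exponentially as $t\to-\infty$, and there is a neighbourhood $U$ of $0$ such that $Q(V)$ contains $y(0)$ for every solution $y:(-\infty,0]\to U$ that tends to $0$ exponentially as $t\to-\infty$. **Theorem.** Suppose that $\mathcal A_n$ has, counted with algebraic multiplicity, exactly $d$ eigenvalues in the open right half plane, that these are pairwise distinct, and write $\lambda_n=(\lambda_{1},\dots,\lambda_{d})$ for them. For $\beta\in\mathbb N^d$ put $|\beta|=\sum_j\beta_j$ and $\langle\lambda_n,\beta\rangle=\sum_j\lambda_{j}\beta_j$. Assume that $\langle\lambda_n,\beta\rangle\notin\sigma(\mathcal A_n)$ for all $|\beta|\ge2$ and $\langle\lambda_n,\beta\rangle\notin\sigma(D)$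 for all $|\beta|\ge1$. Put $$v_\beta=\begin{pmatrix}1\\(D-\langle\lambda_n,\beta\rangle I)^{-1}D\mathbf 1\end{pmatrix},\qquad \Delta_n(z)=z-LP\bigl(1,(D-zI)^{-1}D\mathbf 1\bigr),$$ and let $\mathcal S_d$ be the set of all families $x=(x_\beta)_{\beta\in\mathbb N^d}$ in $\mathbb C$. For every $x\in\mathcal S_d$ with $x_0P(v_0)\in\Omega$ there is exactly one $H_n(x)\in\mathcal S_d$ such that for all $k\in\mathbb N$ $$G\Bigl(\sum_{|\beta|\le k}x_\beta P(v_\beta)\sigma^\beta\Bigr)=\sum_{|\beta|\le k}H_n(x)_\beta\sigma^\beta+\mathcal O(|\sigma|^{k+1})\qquad(\sigma\to0\text{ in }\mathbb C^d),$$ and it is given by the corresponding Taylor coefficients at $\sigma=0$. For $|\beta|=1$ let $\xi_\beta\in\mathbb C\setminus\{0\}$, and let $$F_n(x)_\beta=\begin{cases}x_\beta,&\beta=0,\\ x_\beta-\xi_\beta,&|\beta|=1,\\ \Delta_n(\langle\lambda_n,\beta\rangle)x_\beta-H_n(x)_\beta,&|\beta|\ge2.\end{cases}$$ Let $p\in\mathcal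 S_d$ satisfy $F_n(p)=0$ and $\sum_\beta|p_\beta|<\infty$. Then $P_n(\sigma)=\sum_{\beta}p_\beta v_\beta\sigma^\beta$ converges absolutely on the closed unit polydisk of $\mathbb C^d$, and with $B(0,r)=\{\sigma\in\mathbb C^d:|\sigma_j|<r \text{ for all } j\}$ the following hold. 1. For every $0<r\le1$ such that $P(P_n(\sigma))\in\Omega$ for all $\sigma\in B(0,r)$, the map $P_n:B(0,r)\to\mathbb C^{n+1}$ parametrizes a local unstable manifold of the complexified ODE. Such $r$ exist, and $r=1$ is allowed whenever $\Omega=C(I,\mathbb C)$. 2. Let $R\subseteq\mathbb C^d$ be the real linear space of all $\sigma$ with $\xi_{e_i}\sigma_i=\overline{\xi_{e_j}\sigma_j}$ whenever $\lambda_{i}=\overline{\lambda_{j}}$, where $e_j$ is the $j$-th unit multi-index. Then $\dim_{\mathbb R}R=d$, $P_n$ is real on $R\cap B(0,1)$, and $P_n:R\cap B(0,1)\to\mathbb R\times\mathbb R^n$ parametrizes a local unstable manifold of the ODE on $\mathbb R\times\mathbb R^n$. -/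

import Mathlib

open Filter Topology

noncomputable section

namespace PseudospectralDDE

/-! ### Pseudospectral approximation of a scalar DDE `x'(t) = L x_t + G(x_t)` on `[-1, 0]` -/

/-- The interval `[-1, 0]` on which history segments live. -/
abbrev HistoryInterval : Type := Set.Icc (-1 : ℝ) 0

/-- The rescaled Chebyshev extremal nodes `θ_j = (cos (j π / n) - 1) / 2`, `0 ≤ j ≤ n`. -/
def chebyshevNode (n : ℕ) (j : Fin (n + 1)) : ℝ :=
  (Real.cos ((j : ℕ) * Real.pi / n) - 1) / 2

/-- The Lagrange polynomial `ℓ_j` of the Chebyshev nodes. -/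
def lagrangePoly (n : ℕ) (j : Fin (n + 1)) : Polynomial ℝ :=
  Lagrange.basis Finset.univ (chebyshevNode n) j

/-- The differentiation matrix `D = (ℓ_j'(θ_i))`, `1 ≤ i, j ≤ n`. -/
def diffMatrix (n : ℕ) : Matrix (Fin n) (Fin n) ℝ :=
  Matrix.of fun i j =>
    (Polynomial.derivative (lagrangePoly n j.succ)).eval (chebyshevNode n i.succ)

/-- The state space `𝕜 × 𝕜ⁿ` of the pseudospectral ODE (`𝕜 = ℝ`, or `𝕜 = ℂ` after
complexification). -/
abbrev State (𝕜 : Type) (n : ℕ) : Type := 𝕜 × (Fin n → 𝕜)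

section Field

variable (𝕜 : Type) [RCLike 𝕜] (n : ℕ)

/-- `D` as a matrix over `𝕜`. -/
def diffMatrixOver : Matrix (Fin n) (Fin n) 𝕜 :=
  (diffMatrix n).map fun a => (a : 𝕜)

/-- The Lagrange polynomial `ℓ_j` as a `𝕜`-valued continuous function on `[-1, 0]`. -/
def lagrangeFun (j : Fin (n + 1)) : C(HistoryInterval, 𝕜) where
  toFun θ := (((lagrangePoly n j).eval (θ : ℝ) : ℝ) : 𝕜)
  continuous_toFun := RCLike.continuous_ofReal.comp
    ((lagrangePoly n j).continuous.comp continuous_subtype_val)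

/-- The interpolation operator `P(y₀, y) = y₀ ℓ_0 + ∑_{j=1}^n y_j ℓ_j`. -/
def interp : State 𝕜 n →ₗ[𝕜] C(HistoryInterval, 𝕜) where
  toFun y := y.1 • lagrangeFun 𝕜 n 0 + ∑ j : Fin n, y.2 j • lagrangeFun 𝕜 n j.succ
  map_add' y z := by
    simp only [Prod.fst_add, Prod.snd_add, Pi.add_apply, add_smul, Finset.sum_add_distrib]
    abel
  map_smul' c y := by
    simp only [Prod.smul_fst, Prod.smul_snd, Pi.smul_apply, smul_eq_mul, mul_smul,
      RingHom.id_apply, smul_add, Finset.smul_sum]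

variable {𝕜}

/-- The linear part `𝒜_n (y₀, y) = (L P(y₀, y), - y₀ D 𝟏 + D y)`. -/
def psLinear (L : C(HistoryInterval, 𝕜) →ₗ[𝕜] 𝕜) : State 𝕜 n →ₗ[𝕜] State 𝕜 n where
  toFun y := (L (interp 𝕜 n y),
    -(y.1 • (diffMatrixOver 𝕜 n).mulVec 1) + (diffMatrixOver 𝕜 n).mulVec y.2)
  map_add' y z := by
    ext <;> simp [add_smul, Matrix.mulVec_add]
    ring
  map_smul' c y := by
    ext <;> simp [Matrix.mulVec_smul]
    ring

/-- The nonlinear part `𝒢_n (y₀, y) = (G(P(y₀, y)), 0)`. -/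
def psNonlinear (G : C(HistoryInterval, 𝕜) → 𝕜) (y : State 𝕜 n) : State 𝕜 n :=
  (G (interp 𝕜 n y), 0)

/-- The vector field `𝒜_n + 𝒢_n` of the pseudospectral ODE. -/
def psField (L : C(HistoryInterval, 𝕜) →ₗ[𝕜] 𝕜) (G : C(HistoryInterval, 𝕜) → 𝕜)
    (y : State 𝕜 n) : State 𝕜 n :=
  psLinear n L y + psNonlinear n G y

end Field

/-! ### Complexification -/

/-- A real continuous function, regarded as a complex one. -/
def toComplexFun (φ : C(HistoryInterval, ℝ)) : C(HistoryInterval, ℂ) :=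
  ⟨fun θ => (φ θ : ℂ), Complex.continuous_ofReal.comp φ.continuous⟩

/-- The real part of a complex continuous function. -/
def reFun (φ : C(HistoryInterval, ℂ)) : C(HistoryInterval, ℝ) :=
  ⟨fun θ => (φ θ).re, Complex.continuous_re.comp φ.continuous⟩

/-- The imaginary part of a complex continuous function. -/
def imFun (φ : C(HistoryInterval, ℂ)) : C(HistoryInterval, ℝ) :=
  ⟨fun θ => (φ θ).im, Complex.continuous_im.comp φ.continuous⟩

/-- The complex-linear extension `φ ↦ L (Re φ) + i L (Im φ)` of a real functional. -/
def complexify (L : C(HistoryInterval, ℝ) →ₗ[ℝ] ℝ) : C(HistoryInterval, ℂ) →ₗ[ℂ] ℂ where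
  toFun φ := (L (reFun φ) : ℂ) + Complex.I * (L (imFun φ) : ℂ)
  map_add' φ ψ := by
    have h1 : reFun (φ + ψ) = reFun φ + reFun ψ := by ext; simp [reFun]
    have h2 : imFun (φ + ψ) = imFun φ + imFun ψ := by ext; simp [imFun]
    rw [h1, h2]
    simp only [map_add, Complex.ofReal_add]
    ring
  map_smul' c φ := by
    have h1 : reFun (c • φ) = c.re • reFun φ - c.im • imFun φ := by
      ext; simp [reFun, imFun]
    have h2 : imFun (c • φ) = c.re • imFun φ + c.im • reFun φ := by
      ext; simp [reFun, imFun]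
    rw [h1, h2]
    simp only [map_add, map_sub, map_smul, smul_eq_mul, Complex.ofReal_add, Complex.ofReal_sub,
      Complex.ofReal_mul, RingHom.id_apply]
    apply Complex.ext <;> simp

/-- A real state, regarded as a complex one. -/
def toComplexState {n : ℕ} (y : State ℝ n) : State ℂ n := ((y.1 : ℂ), fun j => (y.2 j : ℂ))

/-- The real part of a complex state. -/
def reState {n : ℕ} (y : State ℂ n) : State ℝ n := (y.1.re, fun j => (y.2 j).re)

/-! ### Multi-indices and Taylor coefficients -/

/-- Multi-indices `β ∈ ℕ^d`. -/
abbrev MultiIndex (d : ℕ) : Type := Fin d → ℕ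

/-- `|β| = β_1 + ⋯ + β_d`. -/
def MultiIndex.order {d : ℕ} (β : MultiIndex d) : ℕ := ∑ j, β j

/-- The monomial `σ^β`. -/
def monom {d : ℕ} (σ : Fin d → ℂ) (β : MultiIndex d) : ℂ := ∏ j, σ j ^ β j

/-- `⟨λ, β⟩ = λ_1 β_1 + ⋯ + λ_d β_d`. -/
def pairing {d : ℕ} (lam : Fin d → ℂ) (β : MultiIndex d) : ℂ := ∑ j, lam j * (β j : ℂ)

/-- The finite set of multi-indices with `|β| ≤ k`. -/
def indicesUpTo (d k : ℕ) : Finset (MultiIndex d) :=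
  (Fintype.piFinset fun _ : Fin d => Finset.range (k + 1)).filter
    fun β => MultiIndex.order β ≤ k

/-- `f(σ) = ∑_{|β| ≤ k} a_β σ^β + O(|σ|^{k+1})` as `σ → 0` in `ℂ^d`. -/
def HasTaylorUpTo {d : ℕ} (f : (Fin d → ℂ) → ℂ) (a : MultiIndex d → ℂ) (k : ℕ) : Prop :=
  (fun σ => f σ - ∑ β ∈ indicesUpTo d k, a β * monom σ β) =O[𝓝 0] fun σ => ‖σ‖ ^ (k + 1)

/-- The partial derivative `∂f/∂σ_j`. -/
def partialDeriv {d : ℕ} (j : Fin d) (f : (Fin d → ℂ) → ℂ) : (Fin d → ℂ) → ℂ :=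
  fun σ => fderiv ℂ f σ (Pi.single j 1)

/-- The Taylor coefficient `∂^β f(0) / β!`. -/
def taylorCoeff {d : ℕ} (f : (Fin d → ℂ) → ℂ) (β : MultiIndex d) : ℂ :=
  ((List.finRange d).foldr (fun j g => (partialDeriv j)^[β j] g) f) 0 /
    ((∏ j, (β j).factorial : ℕ) : ℂ)

/-! ### The scalar zero-finding problem -/

/-- The vector `(1, (D - z I)⁻¹ D 𝟏)`. -/
def blowupVec (n : ℕ) (z : ℂ) : State ℂ n :=
  (1, (diffMatrixOver ℂ n - z • (1 : Matrix (Fin n) (Fin n) ℂ))⁻¹.mulVec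
    ((diffMatrixOver ℂ n).mulVec 1))

/-- `Δ_n(z) = z - L P(1, (D - z I)⁻¹ D 𝟏)`. -/
def charFun (n : ℕ) (L : C(HistoryInterval, ℝ) →L[ℝ] ℝ) (z : ℂ) : ℂ :=
  z - complexify (L : C(HistoryInterval, ℝ) →ₗ[ℝ] ℝ) (interp ℂ n (blowupVec n z))

/-- The function `σ ↦ G (∑_{|β| ≤ k} x_β P(1, (D - ⟨λ, β⟩ I)⁻¹ D 𝟏) σ^β)`. -/
def truncatedComp {d : ℕ} (n : ℕ) (G : C(HistoryInterval, ℂ) → ℂ) (lam : Fin d → ℂ)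
    (x : MultiIndex d → ℂ) (k : ℕ) (σ : Fin d → ℂ) : ℂ :=
  G (∑ β ∈ indicesUpTo d k,
    (x β * monom σ β) • interp ℂ n (blowupVec n (pairing lam β)))

/-- The map `H_n : 𝒮_d → 𝒮_d` of Taylor coefficients: `H_n(x)_β` is the coefficient of `σ^β` in
`G (∑ x_β P(1, (D - ⟨λ, β⟩ I)⁻¹ D 𝟏) σ^β)`, where terms of order above `|β|` play no role. -/
def Hn {d : ℕ} (n : ℕ) (G : C(HistoryInterval, ℂ) → ℂ) (lam : Fin d → ℂ)
    (x : MultiIndex d → ℂ) : MultiIndex d → ℂ :=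
  fun β => taylorCoeff (truncatedComp n G lam x (MultiIndex.order β)) β

/-- The map `F_n : 𝒮_d → 𝒮_d`. -/
def Fn {d : ℕ} (n : ℕ) (L : C(HistoryInterval, ℝ) →L[ℝ] ℝ) (G : C(HistoryInterval, ℂ) → ℂ)
    (lam : Fin d → ℂ) (ξ : MultiIndex d → ℂ) (x : MultiIndex d → ℂ) : MultiIndex d → ℂ :=
  fun β =>
    if MultiIndex.order β = 0 then x β
    else if MultiIndex.order β = 1 then x β - ξ β
    else charFun n L (pairing lam β) * x β - Hn n G lam x β

/-- `P_n(σ) = ∑_β p_β (1, (D - ⟨λ, β⟩ I)⁻¹ D 𝟏) σ^β`. -/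
def Pn {d : ℕ} (n : ℕ) (lam : Fin d → ℂ) (p : MultiIndex d → ℂ) (σ : Fin d → ℂ) : State ℂ n :=
  ∑' β, (p β * monom σ β) • blowupVec n (pairing lam β)

/-- The real-linear space of parameters that correspond to real states: the coordinates
`ξ_i σ_i` and `ξ_j σ_j` that belong to complex conjugate eigenvalues are complex conjugate (and
`ξ_j σ_j` is real if `λ_j` is real). -/
def realParameters {d : ℕ} (lam : Fin d → ℂ) (ξ : MultiIndex d → ℂ) :
    Submodule ℝ (Fin d → ℂ) where
  carrier := {σ | ∀ i j, lam i = (starRingEnd ℂ) (lam j) →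
    ξ (Pi.single i 1) * σ i = (starRingEnd ℂ) (ξ (Pi.single j 1) * σ j)}
  add_mem' := by
    intro a b ha hb i j h
    simp only [Pi.add_apply, mul_add, map_add]
    rw [ha i j h, hb i j h]
  zero_mem' := by
    intro i j _
    simp
  smul_mem' := by
    intro c a ha i j h
    have h' := ha i j h
    simp only [Pi.smul_apply, Complex.real_smul, map_mul, Complex.conj_ofReal] at h' ⊢
    linear_combination (c : ℂ) * h'

/-! ### Local unstable manifolds -/

section Unstable

variable {E : Type*} [NormedAddCommGroup E] [NormedSpace ℝ E]

/-- `y` solves `y' = f(y)` on `(-∞, 0]`. -/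
def IsBackwardSolution (f : E → E) (y : ℝ → E) : Prop :=
  ∀ t ≤ 0, HasDerivWithinAt y (f (y t)) (Set.Iic 0) t

/-- `y(t) → 0` exponentially as `t → -∞`. -/
def DecaysExponentially (y : ℝ → E) : Prop :=
  ∃ C γ : ℝ, 0 < γ ∧ ∀ t ≤ 0, ‖y t‖ ≤ C * Real.exp (γ * t)

/-- The set `Q(V)` is a local unstable manifold of the equilibrium `0` of `y' = f(y)`, with
`Q` an (analytic) parametrization of it: `Q` is an embedding and an immersion; every point of
`Q(V)` has a backward orbit inside `Q(V)` that tends to `0` exponentially; and `Q(V)` contains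
all points whose backward orbit exists, stays in a suitable neighbourhood of `0` and tends to `0`
exponentially. -/
structure ParametrizesLocalUnstableManifold (𝕜 : Type*) [RCLike 𝕜]
    {X : Type*} [NormedAddCommGroup X] [NormedSpace 𝕜 X] [NormedSpace 𝕜 E]
    (f : E → E) (V : Set X) (Q : X → E) : Prop where
  isOpen : IsOpen V
  zero_mem : (0 : X) ∈ V
  map_zero : Q 0 = 0
  analytic : AnalyticOnNhd 𝕜 Q V
  immersion : ∀ σ ∈ V, Function.Injective (fderiv 𝕜 Q σ)
  embedding : IsEmbedding (V.domRestrict Q)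
  backward_orbit : ∀ y₀ ∈ Q '' V, ∃ y : ℝ → E, y 0 = y₀ ∧ IsBackwardSolution f y ∧
    (∀ t ≤ 0, y t ∈ Q '' V) ∧ DecaysExponentially y
  contains_local_unstable_set : ∃ U ∈ 𝓝 (0 : E), ∀ y : ℝ → E, IsBackwardSolution f y →
    (∀ t ≤ 0, y t ∈ U) → DecaysExponentially y → y 0 ∈ Q '' V

end Unstable

end PseudospectralDDE

end

/-! The vector `blowupVec n z` solves the second block of the eigenvalue equation of 𝒜_n, so that
𝒜_n v_β = ⟨λ,β⟩ v_β - (Δ_n(⟨λ,β⟩), 0). Hence F_n(p) = 0 says that the coefficients p_β v_β satisfy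
the homological equation at every order (`homological`): the invariance equation DP_n(σ)Λσ =
f(P_n(σ)) with Λ = diag(λ) holds to all orders at σ = 0. Its defect is analytic along the segment
from 0 to σ and flat at 0, so it vanishes (`invariant`). Thus P_n carries the linear flow e^{tΛ},
which maps polydisks into themselves for t ≤ 0, to backward solutions of the ODE.

The remaining claims hold for any such conjugacy Q (`IsUnstableConjugacy`). Since DQ(0) is
injective, Q is bi-Lipschitz near 0, and the backward flow brings the whole ball there in one fixed
time. Lipschitz dependence on initial values then gives Q a locally Lipschitz inverse at every point
of the ball, which yields both the embedding (`isEmbedding`) and the immersion (`injective_fderiv`).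

For the maximality of Q(V), write a decaying backward solution near 0 as y = Q(σ) + w with w in a
complement of the tangent space. Because the unstable eigenvalues are simple and exhaust the right
half plane, 𝒜_n has spectrum in Re ≤ 0 on the quotient by their eigenvectors. So for every η > 0
there is a linear map B that vanishes exactly on the unstable eigenspace and satisfies Re⟨By, B𝒜_n
y⟩ ≤ η‖By‖² (`exists_transverse_form`). If y = O(e^{γt}) and η = γ/4, then e^{-γt}‖Bw‖² is
nonincreasing near t = -∞ and also tends to 0 there, so it is zero and y lies on the manifold at
some early time (`exists_time_mem`). From then on y follows the manifold, and it cannot leave the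
parameter ball while y stays small. Eigenvalues on the imaginary axis do no harm.

For the real ODE, complex conjugation induces an antilinear involution of the parameter space whose
fixed space is R. The coefficients of order at least 2 are determined recursively, since Δ_n does
not vanish at the resonance sums, so p inherits the symmetry (`conjCoeff_eq`) and P_n is real on R.
The same abstract result then applies to the restriction of P_n to R. -/

noncomputable section

namespace PseudospectralDDE

/-! ### Conjugacies to a linear flow: backward orbits, embedding and immersion -/

section Dynamics

variable {E : Type*} [NormedAddCommGroup E] [NormedSpace ℝ E]

/-- A `C¹` vector field is uniformly Lipschitz near a compact arc of smooth points. -/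
lemma exists_lipschitz_tube {f : E → E} {z : ℝ → E} {a b : ℝ} (hz : ContinuousOn z (Set.Icc a b))
    (hf : ∀ t ∈ Set.Icc a b, ContDiffAt ℝ 1 f (z t)) :
    ∃ K ≥ 0, ∃ δ > 0, ∀ t ∈ Set.Icc a b, ∀ x, ‖x - z t‖ < δ →
      ‖f x - f (z t)‖ ≤ K * ‖x - z t‖ := by
  refine isCompact_Icc.induction_on (p := fun s => ∃ K ≥ 0, ∃ δ > 0, ∀ t ∈ s, ∀ x,
    ‖x - z t‖ < δ → ‖f x - f (z t)‖ ≤ K * ‖x - z t‖) ?_ ?_ ?_ ?_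
  · exact ⟨0, le_rfl, 1, one_pos, by simp⟩
  · rintro s t hst ⟨K, hK, δ, hδ, h⟩
    exact ⟨K, hK, δ, hδ, fun u hu => h u (hst hu)⟩
  · rintro s t ⟨K, hK, δ, hδ, h⟩ ⟨K', hK', δ', hδ', h'⟩
    refine ⟨max K K', le_max_of_le_left hK, min δ δ', lt_min hδ hδ', ?_⟩
    rintro u (hu | hu) x hx
    · exact (h u hu x (hx.trans_le (min_le_left _ _))).trans (by gcongr; exact le_max_left _ _)
    · exact (h' u hu x (hx.trans_le (min_le_right _ _))).trans (by gcongr; exact le_max_right _ _)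
  · intro t ht
    obtain ⟨K, s, hs, hK⟩ := (hf t ht).exists_lipschitzOnWith
    obtain ⟨δ, hδ, hball⟩ := Metric.mem_nhds_iff.1 hs
    -- Half of the radius is spent on moving `t`, half on the distance from `x` to the arc.
    refine ⟨{u | ‖z u - z t‖ < δ / 2}, ?_, K, K.2, δ / 2, half_pos hδ, ?_⟩
    · have := (hz t ht).eventually (Metric.ball_mem_nhds (z t) (half_pos hδ))
      filter_upwards [this] with u hu
      rwa [dist_eq_norm] at hu
    · intro u hu x hx
      have hu' : ‖z u - z t‖ < δ / 2 := hu
      refine hK.norm_sub_le (hball ?_) (hball ?_)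
      · rw [Metric.mem_ball, dist_eq_norm]
        calc ‖x - z t‖ = ‖(x - z u) + (z u - z t)‖ := by congr 1; abel
          _ ≤ _ := norm_add_le _ _
          _ < δ := by linarith
      · rw [Metric.mem_ball, dist_eq_norm]; linarith

/-- Lipschitz dependence on initial values near a given solution; the other solution
is not assumed to stay near it. -/
lemma exists_norm_sub_le_of_solution {f : E → E} {z : ℝ → E} {a b : ℝ}
    (hz : ∀ t ∈ Set.Icc a b, HasDerivWithinAt z (f (z t)) (Set.Icc a b) t)
    (hf : ∀ t ∈ Set.Icc a b, ContDiffAt ℝ 1 f (z t)) :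
    ∃ K ≥ 0, ∃ δ > 0, ∀ y : ℝ → E,
      (∀ t ∈ Set.Icc a b, HasDerivWithinAt y (f (y t)) (Set.Icc a b) t) → ‖y a - z a‖ < δ →
      ∀ t ∈ Set.Icc a b, ‖y t - z t‖ ≤ K * ‖y a - z a‖ := by
  have hzc : ContinuousOn z (Set.Icc a b) := fun t ht => (hz t ht).continuousWithinAt
  obtain ⟨K, hK, δ, hδ, h⟩ := exists_lipschitz_tube hzc hf
  -- The initial distance is small enough that the full Grönwall factor cannot push the solution out
  -- of the tube.
  refine ⟨Real.exp (K * (b - a)), (Real.exp_pos _).le, δ * Real.exp (-(K * (b - a))),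
    by positivity, fun y hy hya => ?_⟩
  have hyc : ContinuousOn y (Set.Icc a b) := fun t ht => (hy t ht).continuousWithinAt
  have hgc : ContinuousOn (fun t => ‖y t - z t‖) (Set.Icc a b) := (hyc.sub hzc).norm
  have gron : ∀ c ∈ Set.Icc a b, (∀ t ∈ Set.Ico a c, ‖y t - z t‖ < δ) →
      ‖y c - z c‖ ≤ Real.exp (K * (b - a)) * ‖y a - z a‖ := by
    intro c hc hlt
    have hsub : Set.Icc a c ⊆ Set.Icc a b := Set.Icc_subset_Icc_right hc.2
    have := norm_le_gronwallBound_of_norm_deriv_right_le (f := fun t => y t - z t)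
      (f' := fun t => f (y t) - f (z t)) (δ := ‖y a - z a‖) (K := K) (ε := 0) (a := a) (b := c)
      ((hyc.sub hzc).mono hsub)
      (fun t ht => ?_) le_rfl (fun t ht => ?_) c ⟨hc.1, le_rfl⟩
    · rw [gronwallBound_ε0] at this
      refine this.trans ?_
      rw [mul_comm]
      gcongr
      exact hc.2
    · have htb : t ∈ Set.Ico a b := ⟨ht.1, ht.2.trans_le hc.2⟩
      have hmem := Icc_mem_nhdsGE_of_mem htb
      exact ((hy t (Set.Ico_subset_Icc_self htb)).mono_of_mem_nhdsWithin hmem).sub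
        ((hz t (Set.Ico_subset_Icc_self htb)).mono_of_mem_nhdsWithin hmem)
    · simpa using h t (hsub (Set.Ico_subset_Icc_self ht)) (y t) (hlt t ht)
  -- Continuation argument: up to the first exit time from the tube the Grönwall bound applies, and
  -- at that time it still gives a distance below `δ`.
  have hlt : ∀ t ∈ Set.Icc a b, ‖y t - z t‖ < δ := by
    by_contra! hcon
    obtain ⟨t₁, ht₁, hδt⟩ := hcon
    have hcl : IsCompact {t ∈ Set.Icc a b | δ ≤ ‖y t - z t‖} :=
      isCompact_Icc.of_isClosed_subset
        (hgc.preimage_isClosed_of_isClosed isClosed_Icc isClosed_Ici) fun t ht => ht.1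
    obtain ⟨c, ⟨hc, hcδ⟩, hmin⟩ := hcl.exists_isLeast ⟨t₁, ht₁, hδt⟩
    have := gron c hc fun t ht => by
      by_contra! h'
      exact (hmin ⟨⟨ht.1, ht.2.le.trans hc.2⟩, h'⟩).not_gt ht.2
    have h2 : Real.exp (K * (b - a)) * ‖y a - z a‖ <
        Real.exp (K * (b - a)) * (δ * Real.exp (-(K * (b - a)))) := by gcongr
    rw [mul_left_comm, ← Real.exp_add, add_neg_cancel, Real.exp_zero, mul_one] at h2
    linarith
  exact fun t ht => gron t ht fun u hu => hlt u ⟨hu.1, hu.2.le.trans ht.2⟩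

variable {X : Type*} [NormedAddCommGroup X] [NormedSpace ℝ X]

/-- `Q` conjugates the backward contracting linear flow `S t = exp (t Λ)` on the ball of radius `r`
to the flow of `y' = f(y)`. -/
structure IsUnstableConjugacy (f : E → E) (r a : ℝ) (Λ : X →L[ℝ] X) (S : ℝ → X →L[ℝ] X)
    (Q : X → E) : Prop where
  r_pos : 0 < r
  a_pos : 0 < a
  flow_zero : ∀ σ, S 0 σ = σ
  flow_add : ∀ s t σ, S (s + t) σ = S s (S t σ)
  flow_deriv : ∀ σ t, HasDerivAt (fun s => S s σ) (Λ (S t σ)) t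
  flow_norm : ∀ t ≤ 0, ∀ σ, ‖S t σ‖ ≤ Real.exp (a * t) * ‖σ‖
  analytic : AnalyticOnNhd ℝ Q (Metric.ball 0 r)
  map_zero : Q 0 = 0
  injective : Function.Injective (fderiv ℝ Q 0)
  -- Smoothness is required only on the image, because the complexified field is known to be
  -- analytic only where the interpolant lies in Ω.
  smooth : ∀ σ ∈ Metric.ball (0 : X) r, ContDiffAt ℝ 1 f (Q σ)
  invariant : ∀ σ ∈ Metric.ball (0 : X) r, fderiv ℝ Q σ (Λ σ) = f (Q σ)

namespace IsUnstableConjugacy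

variable {f : E → E} {r a : ℝ} {Λ : X →L[ℝ] X} {S : ℝ → X →L[ℝ] X} {Q : X → E}

lemma zero_mem (h : IsUnstableConjugacy f r a Λ S Q) : (0 : X) ∈ Metric.ball (0 : X) r :=
  Metric.mem_ball_self h.r_pos

lemma flow_norm_le (h : IsUnstableConjugacy f r a Λ S Q) {t : ℝ} (ht : t ≤ 0) (σ : X) :
    ‖S t σ‖ ≤ ‖σ‖ := by
  refine (h.flow_norm t ht σ).trans (mul_le_of_le_one_left (norm_nonneg _) ?_)
  exact Real.exp_le_one_iff.2 (mul_nonpos_of_nonneg_of_nonpos h.a_pos.le ht)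

lemma flow_mem (h : IsUnstableConjugacy f r a Λ S Q) {t : ℝ} (ht : t ≤ 0) {σ : X}
    (hσ : σ ∈ Metric.ball (0 : X) r) : S t σ ∈ Metric.ball (0 : X) r := by
  rw [mem_ball_zero_iff] at hσ ⊢
  exact (h.flow_norm_le ht σ).trans_lt hσ

lemma hasFDerivAt (h : IsUnstableConjugacy f r a Λ S Q) {σ : X}
    (hσ : σ ∈ Metric.ball (0 : X) r) : HasFDerivAt Q (fderiv ℝ Q σ) σ :=
  (h.analytic σ hσ).differentiableAt.hasFDerivAt

lemma hasDerivAt_orbit (h : IsUnstableConjugacy f r a Λ S Q) {σ : X} {t : ℝ}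
    (ht : S t σ ∈ Metric.ball (0 : X) r) :
    HasDerivAt (fun s => Q (S s σ)) (f (Q (S t σ))) t := by
  rw [← h.invariant _ ht]
  exact (h.hasFDerivAt ht).comp_hasDerivAt t (h.flow_deriv σ t)

lemma isBackwardSolution (h : IsUnstableConjugacy f r a Λ S Q) {σ : X}
    (hσ : σ ∈ Metric.ball (0 : X) r) : IsBackwardSolution f fun t => Q (S t σ) :=
  fun _ ht => (h.hasDerivAt_orbit (h.flow_mem ht hσ)).hasDerivWithinAt

/-- For very negative times the linear flow is close to 0, where Q(σ) = O(σ), so the rate `a`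
carries over. The remaining compact time interval only enlarges the constant. -/
lemma decaysExponentially (h : IsUnstableConjugacy f r a Λ S Q) {σ : X}
    (hσ : σ ∈ Metric.ball (0 : X) r) : DecaysExponentially fun t => Q (S t σ) := by
  have hO : Q =O[𝓝 0] fun τ => τ := by
    have := (h.hasFDerivAt h.zero_mem).isBigO_sub
    simpa [h.map_zero] using this
  obtain ⟨c, hc, hO⟩ := hO.exists_pos
  obtain ⟨ρ, hρ, hball⟩ := Metric.eventually_nhds_iff.1 hO.bound
  obtain ⟨T, hT0, hT⟩ : ∃ T ≤ 0, ∀ t ≤ T, Real.exp (a * t) * r < ρ := by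
    have h1 : Tendsto (fun T : ℝ => Real.exp (a * T) * r) atBot (𝓝 (0 * r)) :=
      (Real.tendsto_exp_atBot.comp (tendsto_id.const_mul_atBot h.a_pos)).mul_const r
    rw [zero_mul] at h1
    obtain ⟨T, h2⟩ := eventually_atBot.1 (h1.eventually (gt_mem_nhds hρ))
    exact ⟨min T 0, min_le_right _ _, fun t ht => h2 t (ht.trans (min_le_left _ _))⟩
  rw [mem_ball_zero_iff] at hσ
  have hcont : ContinuousOn (fun t => ‖Q (S t σ)‖) (Set.Icc T 0) := fun t ht =>
    (h.hasDerivAt_orbit (h.flow_mem ht.2 (mem_ball_zero_iff.2 hσ))).continuousAt.norm.continuousWithinAt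
  obtain ⟨M, hM⟩ := isCompact_Icc.bddAbove_image hcont
  have hM' : ∀ t ∈ Set.Icc T 0, ‖Q (S t σ)‖ ≤ M := fun t ht => hM ⟨t, ht, rfl⟩
  have hM0 : 0 ≤ M := (norm_nonneg _).trans (hM' T ⟨le_rfl, hT0⟩)
  have hr := h.r_pos
  -- The first summand serves t ≤ T. The second serves [T, 0], where e^{a(t-T)} ≥ 1.
  refine ⟨c * r + M * Real.exp (-(a * T)), a, h.a_pos, fun t ht => ?_⟩
  rw [add_mul]
  rcases le_total t T with htT | htT
  · have h1 := h.flow_norm t ht σ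
    have h2 : ‖S t σ‖ ≤ Real.exp (a * t) * r := h1.trans (by gcongr)
    have h3 := hball (y := S t σ) (by rw [dist_zero_right]; exact h2.trans_lt (hT t htT))
    have h4 : c * ‖S t σ‖ ≤ c * (Real.exp (a * t) * r) := by gcongr
    have : 0 ≤ M * Real.exp (-(a * T)) * Real.exp (a * t) := by positivity
    nlinarith
  · have h1 := hM' t ⟨htT, ht⟩
    have h2 : 1 ≤ Real.exp (-(a * T)) * Real.exp (a * t) := by
      rw [← Real.exp_add, Real.one_le_exp_iff]
      nlinarith [h.a_pos]
    have h3 : M * 1 ≤ M * (Real.exp (-(a * T)) * Real.exp (a * t)) := by gcongr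
    have : 0 ≤ c * r * Real.exp (a * t) := by positivity
    linarith

variable [FiniteDimensional ℝ X]

/-- `Q` is bi-Lipschitz near `0`. -/
lemma exists_antilipschitz (h : IsUnstableConjugacy f r a Λ S Q) :
    ∃ ρ > 0, ρ < r ∧ ∃ c > 0, ∀ σ τ : X, ‖σ‖ ≤ ρ → ‖τ‖ ≤ ρ → ‖σ - τ‖ ≤ c * ‖Q σ - Q τ‖ := by
  obtain ⟨K, hK, hanti⟩ := (fderiv ℝ Q 0).exists_antilipschitzWith
    (LinearMap.ker_eq_bot.2 h.injective)
  have hs : HasStrictFDerivAt Q (fderiv ℝ Q 0) 0 :=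
    (h.analytic 0 h.zero_mem).hasStrictFDerivAt
  -- With this accuracy of the strict derivative, the linearization error is at most half of ‖σ - τ‖
  -- and can be absorbed on the left.
  have hε : (0 : ℝ) < 1 / (2 * K) := by
    have : (0 : ℝ) < K := hK
    positivity
  have := hs.isLittleO.def hε
  obtain ⟨δ, hδ, hball⟩ := Metric.eventually_nhds_iff.1 this
  refine ⟨min (δ / 2) (r / 2), lt_min (half_pos hδ) (half_pos h.r_pos),
    (min_le_right _ _).trans_lt (half_lt_self h.r_pos), 2 * K, by positivity, ?_⟩
  intro σ τ hσ hτ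
  have hK' : (0 : ℝ) < K := hK
  have h1 : ‖Q σ - Q τ - fderiv ℝ Q 0 (σ - τ)‖ ≤ 1 / (2 * K) * ‖σ - τ‖ := by
    refine @hball (σ, τ) ?_
    rw [Prod.dist_eq, max_lt_iff, dist_zero_right, dist_zero_right]
    have := min_le_left (δ / 2) (r / 2)
    constructor <;> linarith
  have h2 : ‖σ - τ‖ ≤ K * ‖fderiv ℝ Q 0 (σ - τ)‖ := by
    simpa [dist_eq_norm, map_sub] using hanti.le_mul_dist σ τ
  have h3 : ‖fderiv ℝ Q 0 (σ - τ)‖ ≤ ‖Q σ - Q τ‖ + 1 / (2 * K) * ‖σ - τ‖ := by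
    calc _ = ‖(Q σ - Q τ) - (Q σ - Q τ - fderiv ℝ Q 0 (σ - τ))‖ := by congr 1; abel
      _ ≤ _ := (norm_sub_le _ _).trans (by gcongr)
  have h4 : ‖σ - τ‖ ≤ K * (‖Q σ - Q τ‖ + 1 / (2 * K) * ‖σ - τ‖) := h2.trans (by gcongr)
  have h5 : (K : ℝ) * (1 / (2 * K) * ‖σ - τ‖) = ‖σ - τ‖ / 2 := by field_simp
  rw [mul_add, h5] at h4
  linarith

/-- The inverse of `Q` is locally Lipschitz: flow back to a neighbourhood of `0`. -/
lemma exists_local_antilipschitz (h : IsUnstableConjugacy f r a Λ S Q) {σ : X}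
    (hσ : σ ∈ Metric.ball (0 : X) r) :
    ∃ c > 0, ∃ δ > 0, ∀ τ ∈ Metric.ball (0 : X) r, ‖Q τ - Q σ‖ < δ →
      ‖τ - σ‖ ≤ c * ‖Q τ - Q σ‖ := by
  obtain ⟨ρ, hρ, -, c, hc, hanti⟩ := h.exists_antilipschitz
  -- A single time `T` brings the whole ball into the region where `Q` is bi-Lipschitz.
  obtain ⟨T, hT0, hT⟩ : ∃ T ≥ 0, Real.exp (a * -T) * r ≤ ρ := by
    have h1 : Tendsto (fun T : ℝ => Real.exp (a * -T) * r) atTop (𝓝 (0 * r)) := by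
      refine (Real.tendsto_exp_atBot.comp ?_).mul_const r
      exact tendsto_neg_atTop_atBot.const_mul_atBot h.a_pos
    rw [zero_mul] at h1
    obtain ⟨T, h2, h3⟩ := ((h1.eventually (ge_mem_nhds hρ)).and (eventually_ge_atTop 0)).exists
    exact ⟨T, h3, h2⟩
  have hsmall : ∀ τ ∈ Metric.ball (0 : X) r, ‖S (-T) τ‖ ≤ ρ := fun τ hτ => by
    rw [mem_ball_zero_iff] at hτ
    refine (h.flow_norm _ (neg_nonpos.2 hT0) τ).trans (le_trans ?_ hT)
    gcongr
  have hsol : ∀ τ ∈ Metric.ball (0 : X) r, ∀ t ∈ Set.Icc 0 T,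
      HasDerivWithinAt (fun s => Q (S (-s) τ)) (-f (Q (S (-t) τ))) (Set.Icc 0 T) t := by
    intro τ hτ t ht
    have := (h.hasDerivAt_orbit (h.flow_mem (neg_nonpos.2 ht.1) hτ)).scomp t (hasDerivAt_neg t)
    simpa [Function.comp_def] using this.hasDerivWithinAt
  -- In reversed time the orbits solve the field `-f`. The point `τ` need not be near `σ`: closeness
  -- of the images alone is transported back, which is why injectivity on the whole ball will
  -- follow.
  obtain ⟨K, hK, δ, hδ, hdep⟩ := exists_norm_sub_le_of_solution (f := fun y => -f y) (hsol σ hσ)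
    fun t ht => (h.smooth _ (h.flow_mem (neg_nonpos.2 ht.1) hσ)).neg
  refine ⟨‖S T‖ * (c * K) + 1, by positivity, δ, hδ, fun τ hτ hd => ?_⟩
  have h1 := hdep _ (hsol τ hτ) (by simpa [h.flow_zero] using hd) T ⟨hT0, le_rfl⟩
  simp only [neg_zero, h.flow_zero] at h1
  have h2 := hanti _ _ (hsmall τ hτ) (hsmall σ hσ)
  have h3 : ∀ τ, S T (S (-T) τ) = τ := fun τ => by
    rw [← h.flow_add, add_neg_cancel, h.flow_zero]
  calc ‖τ - σ‖ = ‖S T (S (-T) τ - S (-T) σ)‖ := by rw [map_sub, h3, h3]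
    _ ≤ ‖S T‖ * ‖S (-T) τ - S (-T) σ‖ := (S T).le_opNorm _
    _ ≤ ‖S T‖ * (c * (K * ‖Q τ - Q σ‖)) := by
      gcongr
      exact h2.trans (by gcongr)
    _ ≤ (‖S T‖ * (c * K) + 1) * ‖Q τ - Q σ‖ := by
      have := norm_nonneg (Q τ - Q σ)
      linarith

/-- The local Lipschitz bound for the inverse compares `σ` with every `τ` of the ball, so it gives
continuity of the inverse and, when the two images coincide, injectivity. -/
lemma isEmbedding (h : IsUnstableConjugacy f r a Λ S Q) :
    IsEmbedding ((Metric.ball (0 : X) r).domRestrict Q) := by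
  refine ⟨isInducing_iff_nhds.2 fun σ => le_antisymm ?_ ?_, fun τ σ hτσ => ?_⟩
  · exact map_le_iff_le_comap.1
      (continuousOn_iff_continuous_domRestrict.1 h.analytic.continuousOn).continuousAt
  · obtain ⟨c, hc, δ, hδ, hl⟩ := h.exists_local_antilipschitz σ.2
    refine fun s hs => ?_
    obtain ⟨ε, hε, hs⟩ := Metric.mem_nhds_iff.1 hs
    refine ⟨Metric.ball (Q σ) (min δ (ε / c)), Metric.ball_mem_nhds _ (by positivity), ?_⟩
    intro τ hτ
    refine hs ?_
    have hτ' : ‖Q τ - Q σ‖ < min δ (ε / c) := by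
      rw [← dist_eq_norm]; exact hτ
    rw [Metric.mem_ball, Subtype.dist_eq, dist_eq_norm]
    have h1 := hl τ τ.2 (hτ'.trans_le (min_le_left _ _))
    have h2 := hτ'.trans_le (min_le_right _ _)
    rw [lt_div_iff₀ hc] at h2
    linarith
  · obtain ⟨c, hc, δ, hδ, hl⟩ := h.exists_local_antilipschitz σ.2
    have heq : Q τ = Q σ := hτσ
    have := hl τ τ.2 (by simpa [heq] using hδ)
    rw [heq, sub_self, norm_zero, mul_zero, norm_le_zero_iff, sub_eq_zero] at this
    exact Subtype.ext this

/-- Along a kernel direction v of DQ(σ) the map moves by o(t), whereas the Lipschitz inverse forces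
it to move by at least a fixed multiple of |t|‖v‖. -/
lemma injective_fderiv (h : IsUnstableConjugacy f r a Λ S Q) {σ : X}
    (hσ : σ ∈ Metric.ball (0 : X) r) : Function.Injective (fderiv ℝ Q σ) := by
  rw [injective_iff_map_eq_zero]
  intro v hv
  obtain ⟨c, hc, δ, hδ, hl⟩ := h.exists_local_antilipschitz hσ
  have h1 := (h.hasFDerivAt hσ).isLittleO.def (show 0 < 1 / (2 * c) by positivity)
  have h2 : ∀ᶠ τ in 𝓝 σ, ‖Q τ - Q σ‖ < δ := by
    have := (h.hasFDerivAt hσ).continuousAt.eventually (Metric.ball_mem_nhds _ hδ)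
    simpa only [dist_eq_norm] using this
  have h3 := Metric.isOpen_ball.mem_nhds hσ
  have h4 : Tendsto (fun t : ℝ => σ + t • v) (𝓝[≠] 0) (𝓝 σ) := by
    have : Continuous fun t : ℝ => σ + t • v := by fun_prop
    simpa using (this.tendsto 0).mono_left nhdsWithin_le_nhds
  obtain ⟨t, ⟨⟨h5, h6⟩, h7⟩, ht⟩ :=
    ((h4.eventually ((h1.and h2).and h3)).and self_mem_nhdsWithin).exists
  have h8 := hl _ h7 h6
  simp only [add_sub_cancel_left, map_smul, hv, smul_zero, sub_zero] at h5 h8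
  have h9 : c * (1 / (2 * c) * ‖t • v‖) = ‖t • v‖ / 2 := by field_simp
  have h10 : ‖t • v‖ ≤ 0 := by nlinarith [mul_le_mul_of_nonneg_left h5 hc.le]
  rw [norm_le_zero_iff, smul_eq_zero] at h10
  exact h10.resolve_left ht

end IsUnstableConjugacy

end Dynamics

/-! ### Maximality: small decaying backward solutions lie on the manifold -/

namespace IsUnstableConjugacy

variable {E : Type*} [NormedAddCommGroup E] [NormedSpace ℝ E]
  {X : Type*} [NormedAddCommGroup X] [NormedSpace ℝ X]
  {f : E → E} {r a : ℝ} {Λ : X →L[ℝ] X} {S : ℝ → X →L[ℝ] X} {Q : X → E}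

variable [FiniteDimensional ℝ X] [FiniteDimensional ℝ E]

/-- Near `0`, in coordinates `y = Q σ + w` with `w` in a complement `W` of the tangent space, the
transverse component grows at most with a rate close to that of the linear part. -/
lemma transverse_estimate (h : IsUnstableConjugacy f r a Λ S Q) {W : Submodule ℝ E}
    (hW : IsCompl (LinearMap.range (fderiv ℝ Q 0 : X →ₗ[ℝ] E)) W)
    {H : Type*} [NormedAddCommGroup H] [InnerProductSpace ℝ H] (B : E →L[ℝ] H)
    (hker : ∀ y, B y = 0 ↔ y ∈ LinearMap.range (fderiv ℝ Q 0 : X →ₗ[ℝ] E))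
    {η : ℝ} (hη : 0 < η) (hB : ∀ y, inner ℝ (B y) (B (fderiv ℝ f 0 y)) ≤ η * ‖B y‖ ^ 2) :
    ∃ δ > 0, ∀ σ : X, ∀ w ∈ W, ∀ s : X, ∀ w' ∈ W, ‖σ‖ < δ → ‖w‖ < δ →
      fderiv ℝ Q σ s + w' = f (Q σ + w) - f (Q σ) → inner ℝ (B w) (B w') ≤ 2 * η * ‖B w‖ ^ 2 := by
  set A := fderiv ℝ f 0 with hA
  set D := fderiv ℝ Q 0 with hD
  -- `B` is bounded below on `W`
  obtain ⟨c, hc, hBW⟩ : ∃ c > 0, ∀ w ∈ W, ‖w‖ ≤ c * ‖B w‖ := by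
    obtain ⟨K, hK, hanti⟩ := (B.comp W.subtypeL).exists_antilipschitzWith
      (LinearMap.ker_eq_bot'.2 fun w hw => by
        have h1 : (w : E) ∈ LinearMap.range (D : X →ₗ[ℝ] E) := (hker _).1 hw
        have h2 := Submodule.disjoint_def.1 hW.disjoint _ h1 w.2
        exact Subtype.ext h2)
    exact ⟨K, hK, fun w hw => by simpa using hanti.le_mul_dist ⟨w, hw⟩ 0⟩
  obtain ⟨κ, hκ, hDW⟩ : ∃ κ > 0, ∀ s, ∀ w ∈ W, ‖s‖ ≤ κ * ‖D s + w‖ := by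
    obtain ⟨K, hK, hanti⟩ := (D.coprod W.subtypeL).exists_antilipschitzWith
      (LinearMap.ker_eq_bot'.2 fun p hp => by
        have h0 : D p.1 + (p.2 : E) = 0 := hp
        have h1 : (p.2 : E) ∈ LinearMap.range (D : X →ₗ[ℝ] E) :=
          ⟨-p.1, by rw [eq_neg_of_add_eq_zero_right h0]; simp⟩
        have h2 := Submodule.disjoint_def.1 hW.disjoint _ h1 p.2.2
        rw [h2, add_zero] at h0
        exact Prod.ext ((injective_iff_map_eq_zero D).1 h.injective _ h0) (Subtype.ext h2))
    refine ⟨K, hK, fun s w hw => ?_⟩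
    have := hanti.le_mul_dist (s, ⟨w, hw⟩) 0
    simp only [dist_zero_right, ContinuousLinearMap.coe_coe] at this
    rw [ContinuousLinearMap.map_zero, dist_zero_right] at this
    exact (le_max_left _ _).trans this
  -- The first condition absorbs `s` in the bound of ‖s‖ by ‖w‖, the second bounds the Lipschitz
  -- constant of the remainder by 1, and the third makes the total error under `B` at most η‖Bw‖.
  have hε : ∃ ε > 0, κ * ε ≤ 1 / 2 ∧ ε ≤ 1 ∧
      ‖B‖ * (ε + ε * (2 * κ * (‖A‖ + 1))) * c ≤ η := by
    have h1 : Tendsto (fun ε : ℝ => κ * ε) (𝓝[>] 0) (𝓝 0) := by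
      have : Continuous fun ε : ℝ => κ * ε := by fun_prop
      simpa using (this.tendsto 0).mono_left nhdsWithin_le_nhds
    have h2 : Tendsto (fun ε : ℝ => ‖B‖ * (ε + ε * (2 * κ * (‖A‖ + 1))) * c) (𝓝[>] 0) (𝓝 0) := by
      have : Continuous fun ε : ℝ => ‖B‖ * (ε + ε * (2 * κ * (‖A‖ + 1))) * c := by fun_prop
      simpa using (this.tendsto 0).mono_left nhdsWithin_le_nhds
    have h3 : Tendsto (fun ε : ℝ => ε) (𝓝[>] 0) (𝓝 0) := nhdsWithin_le_nhds
    obtain ⟨ε, ⟨⟨h4, h5⟩, h6⟩, h7⟩ := (((h1.eventually (ge_mem_nhds one_half_pos)).and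
      (h3.eventually (ge_mem_nhds one_pos))).and (h2.eventually (ge_mem_nhds hη))).and
      self_mem_nhdsWithin |>.exists
    exact ⟨ε, h7, h4, h5, h6⟩
  obtain ⟨ε, hε, hκε, hε1, hBε⟩ := hε
  have hf0 : ContDiffAt ℝ 1 f 0 := h.map_zero ▸ h.smooth 0 h.zero_mem
  have hstrict : HasStrictFDerivAt f A 0 := hf0.hasStrictFDerivAt one_ne_zero
  have e1 := hstrict.isLittleO.def hε
  have hQc : ContinuousAt Q 0 := (h.analytic 0 h.zero_mem).continuousAt
  have hDc : ContinuousAt (fderiv ℝ Q) 0 := (h.analytic 0 h.zero_mem).fderiv.continuousAt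
  have t1 : Tendsto (fun p : X × E => (Q p.1 + p.2, Q p.1)) (𝓝 0) (𝓝 (0, 0)) := by
    have hc1 : ContinuousAt (fun p : X × E => Q p.1) 0 :=
      ContinuousAt.comp (g := Q) (f := Prod.fst) hQc continuousAt_fst
    have : ContinuousAt (fun p : X × E => (Q p.1 + p.2, Q p.1)) 0 :=
      (hc1.add continuousAt_snd).prodMk hc1
    have h2 := this.tendsto
    simpa [h.map_zero] using h2
  have e2 := t1.eventually e1
  have e3 : ∀ᶠ p : X × E in 𝓝 0, ‖fderiv ℝ Q p.1 - D‖ ≤ ε := by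
    have := (continuousAt_fst (p := (0 : X × E))).eventually
      (hDc.eventually (Metric.closedBall_mem_nhds _ hε))
    simpa only [dist_eq_norm] using this
  obtain ⟨δ, hδ, hball⟩ := Metric.eventually_nhds_iff.1 (e2.and e3)
  refine ⟨δ, hδ, fun σ w hw s w' hw' hσ hwδ heq => ?_⟩
  obtain ⟨h1, h2⟩ := hball (y := (σ, w)) (by
    rw [dist_zero_right, Prod.norm_def]; exact max_lt hσ hwδ)
  simp only [add_sub_cancel_left] at h1 h2
  set N := f (Q σ + w) - f (Q σ) - A w with hN
  have h3 : ‖(fderiv ℝ Q σ - D) s‖ ≤ ε * ‖s‖ := (ContinuousLinearMap.le_opNorm _ _).trans (by gcongr)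
  have h4 : D s + w' = A w + N - (fderiv ℝ Q σ - D) s := by
    have : f (Q σ + w) - f (Q σ) = A w + N := by rw [hN]; abel
    rw [this] at heq
    rw [← heq, _root_.sub_apply]; abel
  have h5 : ‖s‖ ≤ 2 * κ * (‖A‖ + 1) * ‖w‖ := by
    have h6 := hDW s w' hw'
    rw [h4] at h6
    have h7 : ‖A w + N - (fderiv ℝ Q σ - D) s‖ ≤ ‖A‖ * ‖w‖ + 1 * ‖w‖ + ε * ‖s‖ := by
      refine (norm_sub_le _ _).trans (add_le_add ((norm_add_le _ _).trans ?_) h3)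
      exact add_le_add (A.le_opNorm w) (h1.trans (by gcongr))
    have h8 : ‖s‖ ≤ κ * (‖A‖ * ‖w‖ + 1 * ‖w‖ + ε * ‖s‖) := h6.trans (by gcongr)
    have h9 : κ * ε * ‖s‖ ≤ 1 / 2 * ‖s‖ := by gcongr
    linarith
  -- The tangential term `D s` disappears because `B` kills the range of `D`; only the linear part
  -- and small errors survive.
  have h6 : B w' = B (A w) + B (N - (fderiv ℝ Q σ - D) s) := by
    have : w' = A w + (N - (fderiv ℝ Q σ - D) s) - D s := by
      rw [eq_sub_iff_add_eq, add_comm, h4]; abel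
    have hBD : B (D s) = 0 := (hker _).2 ⟨s, rfl⟩
    rw [this, map_sub, map_add, hBD, sub_zero]
  have h7 : ‖B (N - (fderiv ℝ Q σ - D) s)‖ ≤ η * ‖B w‖ := by
    calc _ ≤ ‖B‖ * ‖N - (fderiv ℝ Q σ - D) s‖ := B.le_opNorm _
      _ ≤ ‖B‖ * (ε * ‖w‖ + ε * (2 * κ * (‖A‖ + 1) * ‖w‖)) := by
        gcongr
        exact (norm_sub_le _ _).trans (add_le_add h1 (h3.trans (by gcongr)))
      _ = ‖B‖ * (ε + ε * (2 * κ * (‖A‖ + 1))) * ‖w‖ := by ring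
      _ ≤ ‖B‖ * (ε + ε * (2 * κ * (‖A‖ + 1))) * (c * ‖B w‖) := by
        gcongr
        exact hBW w hw
      _ = ‖B‖ * (ε + ε * (2 * κ * (‖A‖ + 1))) * c * ‖B w‖ := by ring
      _ ≤ η * ‖B w‖ := by gcongr
  rw [h6, inner_add_right]
  have h8 := real_inner_le_norm (B w) (B (N - (fderiv ℝ Q σ - D) s))
  have h9 : ‖B w‖ * ‖B (N - (fderiv ℝ Q σ - D) s)‖ ≤ ‖B w‖ * (η * ‖B w‖) := by gcongr
  have := hB w
  nlinarith

/-- Near `0` there are coordinates `y = Q σ + w` with `w` in a complement of the tangent space. -/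
lemma exists_coordinates (h : IsUnstableConjugacy f r a Λ S Q) {W : Submodule ℝ E}
    (hW : IsCompl (LinearMap.range (fderiv ℝ Q 0 : X →ₗ[ℝ] E)) W) :
    ∃ φ : E → X × W, φ 0 = 0 ∧ (∀ᶠ y in 𝓝 0, DifferentiableAt ℝ φ y) ∧
      ∀ᶠ y in 𝓝 0, Q (φ y).1 + (φ y).2 = y := by
  set D := fderiv ℝ Q 0 with hD
  -- The coordinates are the local inverse of this map: its derivative at 0 is bijective because `W`
  -- complements the tangent space and DQ(0) is injective.
  let Ψ : X × W → E := fun p => Q p.1 + p.2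
  have hbij : Function.Bijective (D.coprod W.subtypeL) := by
    constructor
    · rw [injective_iff_map_eq_zero]
      intro p hp
      have h0 : D p.1 + (p.2 : E) = 0 := hp
      have h1 : (p.2 : E) ∈ LinearMap.range (D : X →ₗ[ℝ] E) :=
        ⟨-p.1, by rw [eq_neg_of_add_eq_zero_right h0]; simp⟩
      have h2 := Submodule.disjoint_def.1 hW.disjoint _ h1 p.2.2
      rw [h2, add_zero] at h0
      exact Prod.ext ((injective_iff_map_eq_zero D).1 h.injective _ h0) (Subtype.ext h2)
    · intro y
      obtain ⟨u, ⟨s, rfl⟩, w, hw, rfl⟩ := Submodule.mem_sup.1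
        (hW.sup_eq_top ▸ Submodule.mem_top : y ∈ _ ⊔ W)
      exact ⟨(s, ⟨w, hw⟩), rfl⟩
  let e : (X × W) ≃L[ℝ] E :=
    (LinearEquiv.ofBijective (D.coprod W.subtypeL : X × W →ₗ[ℝ] E) hbij).toContinuousLinearEquiv
  have hQ : ContDiffAt ℝ 1 Q 0 := (h.analytic 0 h.zero_mem).contDiffAt
  have hΨ : ContDiffAt ℝ 1 Ψ 0 := by
    have h1 : ContDiffAt ℝ 1 (fun p : X × W => Q p.1) 0 :=
      ContDiffAt.comp (g := Q) (f := Prod.fst) (0 : X × W) hQ contDiffAt_fst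
    exact h1.add (W.subtypeL.contDiff.contDiffAt.comp _ contDiffAt_snd)
  have hΨ' : HasFDerivAt Ψ (e : X × W →L[ℝ] E) 0 := by
    have h1 : HasFDerivAt (fun p : X × W => Q p.1) (D.comp (ContinuousLinearMap.fst ℝ X W)) 0 :=
      HasFDerivAt.comp (g := Q) (f := Prod.fst) (0 : X × W) (h.hasFDerivAt h.zero_mem)
        hasFDerivAt_fst
    have h2 := h1.add (W.subtypeL.hasFDerivAt.comp (0 : X × W) hasFDerivAt_snd)
    convert! h2 using 1
  have h0 : Ψ 0 = 0 := by simp [Ψ, h.map_zero]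
  have hinv : ContDiffAt ℝ 1 (hΨ.localInverse hΨ' one_ne_zero) 0 :=
    h0 ▸ hΨ.to_localInverse hΨ' one_ne_zero
  refine ⟨hΨ.localInverse hΨ' one_ne_zero, ?_, ?_, ?_⟩
  · have := hΨ.localInverse_apply_image hΨ' one_ne_zero
    rwa [h0] at this
  · filter_upwards [hinv.eventually (by simp)] with y hy
    exact hy.differentiableAt one_ne_zero
  · have := (hΨ.hasStrictFDerivAt' hΨ' one_ne_zero).eventually_right_inverse
    rw [h0] at this
    exact this

/-- Exponentially decaying backward solutions lie on the manifold for very negative times. -/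
lemma exists_time_mem (h : IsUnstableConjugacy f r a Λ S Q)
    (hB : ∀ η > 0, ∃ (H : Type) (_ : NormedAddCommGroup H) (_ : InnerProductSpace ℝ H)
      (B : E →ₗ[ℝ] H), (∀ y, B y = 0 ↔ y ∈ LinearMap.range (fderiv ℝ Q 0 : X →ₗ[ℝ] E)) ∧
        ∀ y, inner ℝ (B y) (B (fderiv ℝ f 0 y)) ≤ η * ‖B y‖ ^ 2)
    {y : ℝ → E} (hy : IsBackwardSolution f y) (hdec : DecaysExponentially y) {ρ : ℝ} (hρ : 0 < ρ) :
    ∃ T ≤ 0, ∃ τ : X, ‖τ‖ < ρ ∧ y T = Q τ := by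
  obtain ⟨C, γ, hγ, hdec⟩ := hdec
  obtain ⟨W, hW⟩ := (LinearMap.range (fderiv ℝ Q 0 : X →ₗ[ℝ] E)).exists_isCompl
  obtain ⟨φ, hφ0, hφd, hφ⟩ := h.exists_coordinates hW
  -- With η = γ/4 the transverse estimate gives (‖Bw‖²)' ≤ 4η‖Bw‖² = γ‖Bw‖².
  obtain ⟨H, _, _, B₀, hker, hB⟩ := hB (γ / 4) (by positivity)
  set B : E →L[ℝ] H := B₀.toContinuousLinearMap with hBdef
  obtain ⟨δ, hδ, hest⟩ := h.transverse_estimate hW B hker (by positivity : 0 < γ / 4) hB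
  have hφ0d : DifferentiableAt ℝ φ 0 := hφd.self_of_nhds
  obtain ⟨M, hM, hφO⟩ : ∃ M > 0, ∀ᶠ x in 𝓝 0, ‖φ x‖ ≤ M * ‖x‖ := by
    have := hφ0d.hasFDerivAt.isBigO_sub
    simp only [hφ0, sub_zero] at this
    obtain ⟨M, hM, h1⟩ := this.exists_pos
    exact ⟨M, hM, h1.bound⟩
  have hsmall : ∀ᶠ x in 𝓝 0, ‖φ x‖ < min (min δ ρ) r := by
    have := hφ0d.continuousAt.eventually (Metric.ball_mem_nhds (φ 0)
      (lt_min (lt_min hδ hρ) h.r_pos))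
    simpa [hφ0, dist_zero_right] using this
  have hlim : Tendsto y atBot (𝓝 0) := by
    have h1 : Tendsto (fun t => C * Real.exp (γ * t)) atBot (𝓝 (C * 0)) :=
      (Real.tendsto_exp_atBot.comp (tendsto_id.const_mul_atBot hγ)).const_mul C
    rw [mul_zero] at h1
    exact squeeze_zero_norm' ((eventually_le_atBot 0).mono hdec) h1
  have hgood := (((eventually_eventually_nhds.2 hφ).and hφd).and (hφO.and hsmall))
  obtain ⟨T₀, hT₀⟩ := eventually_atBot.1 (hlim.eventually hgood)
  set T := min T₀ 0 with hT
  have hgoodt : ∀ t ≤ T, _ := fun t ht => hT₀ t (ht.trans (min_le_left _ _))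
  have hT0 : ∀ t ≤ T, t ≤ 0 := fun t ht => ht.trans (min_le_right _ _)
  -- This weight makes the function nonincreasing, while ‖Bw‖² = O(e^{2γt}) leaves it of size
  -- O(e^{γt}) as t → -∞.
  let g : ℝ → ℝ := fun t => Real.exp (-(γ * t)) * ‖B ((φ (y t)).2 : E)‖ ^ 2
  have hcoord : ∀ t < T, ∃ q : X × W, HasDerivAt (fun s => φ (y s)) q t ∧
      fderiv ℝ Q (φ (y t)).1 q.1 + q.2 = f (y t) := by
    intro t ht
    obtain ⟨⟨h1, h2⟩, -, h3⟩ := hgoodt t ht.le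
    have hyt : HasDerivAt y (f (y t)) t :=
      (hy t (hT0 t ht.le)).hasDerivAt (Iic_mem_nhds (ht.trans_le (min_le_right _ _)))
    have h4 := h2.hasFDerivAt.comp_hasDerivAt t hyt
    refine ⟨_, h4, ?_⟩
    have h5 : HasFDerivAt Q (fderiv ℝ Q (φ (y t)).1) (φ (y t)).1 := h.hasFDerivAt <| by
      rw [mem_ball_zero_iff]
      exact (norm_fst_le _).trans_lt (h3.trans_le (min_le_right _ _))
    have h6 := (h5.comp_hasDerivAt t h4.fst).add (W.subtypeL.hasFDerivAt.comp_hasDerivAt t h4.snd)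
    have h7 : (fun s => Q (φ (y s)).1 + ((φ (y s)).2 : E)) =ᶠ[𝓝 t] y :=
      hyt.continuousAt.eventually h1
    exact h6.unique (hyt.congr_of_eventuallyEq h7)
  have hderiv : ∀ t < T, ∃ g' ≤ 0, HasDerivAt g g' t := by
    intro t ht
    obtain ⟨q, hq, heq⟩ := hcoord t ht
    obtain ⟨⟨h1, -⟩, -, h3⟩ := hgoodt t ht.le
    have hσr : (φ (y t)).1 ∈ Metric.ball (0 : X) r := by
      rw [mem_ball_zero_iff]
      exact (norm_fst_le _).trans_lt (h3.trans_le (min_le_right _ _))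
    have hδ' : ‖φ (y t)‖ < δ := h3.trans_le ((min_le_left _ _).trans (min_le_left _ _))
    -- Subtracting the invariance equation DQ(σ)Λσ = f(Q(σ)) from the equation of motion leaves σ' -
    -- Λσ as the tangential velocity that enters the transverse estimate.
    have h8 := hest (φ (y t)).1 (φ (y t)).2 (φ (y t)).2.2 (q.1 - Λ (φ (y t)).1) q.2 q.2.2
      ((norm_fst_le _).trans_lt hδ') ((norm_snd_le (φ (y t))).trans_lt hδ') (by
        rw [map_sub, h.invariant _ hσr, h1.self_of_nhds, ← heq]; abel)
    have hw : HasDerivAt (fun s => B ((φ (y s)).2 : E)) (B q.2) t :=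
      (B.comp W.subtypeL).hasFDerivAt.comp_hasDerivAt t hq.snd
    have he : HasDerivAt (fun s : ℝ => Real.exp (-(γ * s))) (Real.exp (-(γ * t)) * (-(γ * 1))) t :=
      (((hasDerivAt_id t).const_mul γ).neg).exp
    refine ⟨_, ?_, he.mul hw.norm_sq⟩
    have := Real.exp_pos (-(γ * t))
    have h9 : Real.exp (-(γ * t)) * (2 * inner ℝ (B ((φ (y t)).2 : E)) (B q.2)) ≤
      Real.exp (-(γ * t)) * (2 * (2 * (γ / 4) * ‖B ((φ (y t)).2 : E)‖ ^ 2)) := by gcongr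
    linarith
  have hanti : AntitoneOn g (Set.Iio T) := by
    refine antitoneOn_of_deriv_nonpos (convex_Iio T) (fun t ht => ?_) (fun t ht => ?_)
      fun t ht => ?_
    · obtain ⟨g', -, hg⟩ := hderiv t ht
      exact hg.continuousAt.continuousWithinAt
    · rw [interior_Iio] at ht
      obtain ⟨g', -, hg⟩ := hderiv t ht
      exact hg.differentiableAt.differentiableWithinAt
    · rw [interior_Iio] at ht
      obtain ⟨g', hg', hg⟩ := hderiv t ht
      rwa [hg.deriv]
  have hgle : ∀ t ≤ T, g t ≤ (‖B‖ * (M * C)) ^ 2 * Real.exp (γ * t) := by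
    intro t ht
    obtain ⟨-, h3, -⟩ := hgoodt t ht
    have h4 : ‖B ((φ (y t)).2 : E)‖ ≤ ‖B‖ * (M * C) * Real.exp (γ * t) := by
      calc _ ≤ ‖B‖ * ‖((φ (y t)).2 : E)‖ := B.le_opNorm _
        _ ≤ ‖B‖ * (M * (C * Real.exp (γ * t))) := by
          gcongr
          exact (norm_snd_le (φ (y t))).trans (h3.trans (by gcongr; exact hdec t (hT0 t ht)))
        _ = _ := by ring
    calc g t ≤ Real.exp (-(γ * t)) * (‖B‖ * (M * C) * Real.exp (γ * t)) ^ 2 := by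
          simp only [g]; gcongr
      _ = (‖B‖ * (M * C)) ^ 2 * (Real.exp (-(γ * t)) * Real.exp (γ * t) * Real.exp (γ * t)) := by
          ring
      _ = _ := by rw [← Real.exp_add, neg_add_cancel, Real.exp_zero, one_mul]
  -- A nonincreasing function is bounded above by its limit at -∞. The time `T - 1` lies inside the
  -- open half-line on which monotonicity was shown.
  have hg0 : g (T - 1) ≤ 0 := by
    have h1 : Tendsto (fun t => (‖B‖ * (M * C)) ^ 2 * Real.exp (γ * t)) atBot (𝓝 (_ * 0)) :=
      (Real.tendsto_exp_atBot.comp (tendsto_id.const_mul_atBot hγ)).const_mul _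
    rw [mul_zero] at h1
    refine ge_of_tendsto h1 ((eventually_le_atBot (T - 1)).mono fun t ht => ?_)
    have ht' : t < T := by linarith
    exact (hanti ht' (by simp : T - 1 < T) ht).trans (hgle t ht'.le)
  obtain ⟨⟨h1, -⟩, -, h3⟩ := hgoodt (T - 1) (by linarith)
  refine ⟨T - 1, hT0 _ (by linarith), (φ (y (T - 1))).1,
    (norm_fst_le _).trans_lt (h3.trans_le ((min_le_left _ _).trans (min_le_right _ _))), ?_⟩
  have h4 : B ((φ (y (T - 1))).2 : E) = 0 := by
    have h5 : ‖B ((φ (y (T - 1))).2 : E)‖ ^ 2 ≤ 0 :=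
      nonpos_of_mul_nonpos_right hg0 (Real.exp_pos _)
    have := (sq_nonneg _).antisymm' h5
    simpa using this
  have h5 := Submodule.disjoint_def.1 hW.disjoint _ ((hker _).1 h4) (φ (y (T - 1))).2.2
  have h6 := h1.self_of_nhds
  rw [h5, add_zero] at h6
  exact h6.symm

/-- Once the solution meets the manifold, uniqueness makes it follow the linear flow in parameter
space. That flow may expand forward in time, but a parameter of norm `ρ` would force ‖y‖ ≥ ρ/c,
which the neighbourhood excludes. -/
lemma contains_local_unstable_set (h : IsUnstableConjugacy f r a Λ S Q)
    (hB : ∀ η > 0, ∃ (H : Type) (_ : NormedAddCommGroup H) (_ : InnerProductSpace ℝ H)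
      (B : E →ₗ[ℝ] H), (∀ y, B y = 0 ↔ y ∈ LinearMap.range (fderiv ℝ Q 0 : X →ₗ[ℝ] E)) ∧
        ∀ y, inner ℝ (B y) (B (fderiv ℝ f 0 y)) ≤ η * ‖B y‖ ^ 2) :
    ∃ U ∈ 𝓝 (0 : E), ∀ y : ℝ → E, IsBackwardSolution f y →
      (∀ t ≤ 0, y t ∈ U) → DecaysExponentially y → y 0 ∈ Q '' Metric.ball 0 r := by
  obtain ⟨ρ, hρ, hρr, c, hc, hanti⟩ := h.exists_antilipschitz
  refine ⟨Metric.ball 0 (ρ / c), Metric.ball_mem_nhds _ (by positivity), fun y hy hyU hdec => ?_⟩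
  obtain ⟨T, hT, τ, hτ, hyT⟩ := h.exists_time_mem hB hy hdec hρ
  have hScont : Continuous fun t => ‖S (t - T) τ‖ :=
    (continuous_iff_continuousAt.2 fun t => (h.flow_deriv τ t).continuousAt).norm.comp
      (continuous_id.sub continuous_const)
  have hfollow : ∀ b ∈ Set.Icc T 0, (∀ t ∈ Set.Icc T b, ‖S (t - T) τ‖ ≤ ρ) →
      y b = Q (S (b - T) τ) := by
    intro b hb hle
    have hmem : ∀ t ∈ Set.Icc T b, S (t - T) τ ∈ Metric.ball (0 : X) r := fun t ht =>
      mem_ball_zero_iff.2 ((hle t ht).trans_lt hρr)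
    obtain ⟨K, -, δ, hδ, hdep⟩ := exists_norm_sub_le_of_solution (f := f) (a := T) (b := b)
      (z := fun t => Q (S (t - T) τ))
      (fun t ht => ((h.hasDerivAt_orbit (hmem t ht)).comp_sub_const t T).hasDerivWithinAt)
      fun t ht => h.smooth _ (hmem t ht)
    have h1 := hdep y (fun t ht => (hy t (ht.2.trans hb.2)).mono
      fun u hu => hu.2.trans hb.2) (by simpa [hyT, h.flow_zero] using hδ) b ⟨hb.1, le_rfl⟩
    -- The initial distance is zero, so Lipschitz dependence reduces to uniqueness.
    simpa [hyT, h.flow_zero, sub_eq_zero] using h1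
  have hlt : ∀ t ∈ Set.Icc T 0, ‖S (t - T) τ‖ < ρ := by
    by_contra! hcon
    obtain ⟨t₁, ht₁, hle₁⟩ := hcon
    have hcl : IsCompact {t ∈ Set.Icc T 0 | ρ ≤ ‖S (t - T) τ‖} :=
      isCompact_Icc.inter_right (isClosed_le continuous_const hScont)
    obtain ⟨b, ⟨hb, hbρ⟩, hmin⟩ := hcl.exists_isLeast ⟨t₁, ht₁, hle₁⟩
    have hltb : ∀ t ∈ Set.Ico T b, ‖S (t - T) τ‖ < ρ := fun t ht => by
      by_contra! h'
      exact (hmin ⟨⟨ht.1, ht.2.le.trans hb.2⟩, h'⟩).not_gt ht.2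
    have hTb : T < b := by
      refine hb.1.lt_of_ne fun hTb => ?_
      rw [← hTb, sub_self, h.flow_zero] at hbρ
      exact hτ.not_ge hbρ
    -- At the first exit time the bound persists by continuity, so the two orbits still agree there
    -- and the bi-Lipschitz estimate still applies.
    have hbeq : ‖S (b - T) τ‖ ≤ ρ := by
      have : (𝓝[<] b).NeBot := inferInstance
      refine le_of_tendsto (hScont.continuousAt.tendsto.mono_left nhdsWithin_le_nhds :
        Tendsto _ (𝓝[<] b) _) ?_
      filter_upwards [Ioo_mem_nhdsLT hTb] with t ht
      exact (hltb t ⟨ht.1.le, ht.2⟩).le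
    have hyb := hfollow b hb fun t ht => by
      rcases ht.2.eq_or_lt with rfl | h'
      · exact hbeq
      · exact (hltb t ⟨ht.1, h'⟩).le
    have h1 := hanti _ 0 hbeq (by simpa using hρ.le)
    rw [h.map_zero, sub_zero, sub_zero, ← hyb] at h1
    have h2 := hyU b hb.2
    rw [mem_ball_zero_iff, lt_div_iff₀ hc] at h2
    linarith
  refine ⟨S (0 - T) τ, mem_ball_zero_iff.2 ((hlt 0 ⟨hT, le_rfl⟩).trans hρr), ?_⟩
  exact (hfollow 0 ⟨hT, le_rfl⟩ fun t ht => (hlt t ht).le).symm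

theorem parametrizes (h : IsUnstableConjugacy f r a Λ S Q)
    (hB : ∀ η > 0, ∃ (H : Type) (_ : NormedAddCommGroup H) (_ : InnerProductSpace ℝ H)
      (B : E →ₗ[ℝ] H), (∀ y, B y = 0 ↔ y ∈ LinearMap.range (fderiv ℝ Q 0 : X →ₗ[ℝ] E)) ∧
        ∀ y, inner ℝ (B y) (B (fderiv ℝ f 0 y)) ≤ η * ‖B y‖ ^ 2) :
    ParametrizesLocalUnstableManifold ℝ f (Metric.ball 0 r) Q where
  isOpen := Metric.isOpen_ball
  zero_mem := h.zero_mem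
  map_zero := h.map_zero
  analytic := h.analytic
  immersion _ hσ := h.injective_fderiv hσ
  embedding := h.isEmbedding
  backward_orbit := by
    rintro _ ⟨σ, hσ, rfl⟩
    exact ⟨fun t => Q (S t σ), by simp only [h.flow_zero], h.isBackwardSolution hσ,
      fun t ht => ⟨_, h.flow_mem ht hσ, rfl⟩, h.decaysExponentially hσ⟩
  contains_local_unstable_set := h.contains_local_unstable_set hB

end IsUnstableConjugacy

/-! ### A slowly growing form transverse to the unstable eigenspace -/

section LinearAlgebra

/-- An eigenvalue of the transposed operator gives an eigenvalue of the operator. -/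
lemma hasEigenvalue_of_dual {V : Type*} [AddCommGroup V] [Module ℂ V] [FiniteDimensional ℂ V]
    {T : Module.End ℂ V} {μ : ℂ} {ψ : Module.Dual ℂ V} (hψ : ψ ≠ 0)
    (h : ∀ v, ψ (T v) = μ * ψ v) : T.HasEigenvalue μ := by
  rw [Module.End.hasEigenvalue_iff, Module.End.eigenspace_def]
  intro hbot
  have hsurj : Function.Surjective (T - algebraMap ℂ (Module.End ℂ V) μ) :=
    LinearMap.injective_iff_surjective.1 (LinearMap.ker_eq_bot.1 hbot)
  refine hψ (LinearMap.ext fun x => ?_)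
  obtain ⟨y, rfl⟩ := hsurj x
  simp [h]

/-- An operator whose eigenvalues have nonpositive real part is almost dissipative in a suitable
inner product. -/
theorem exists_almost_dissipative_embedding (m : ℕ) :
    ∀ (V : Type) [AddCommGroup V] [Module ℂ V] [FiniteDimensional ℂ V],
      Module.finrank ℂ V = m → ∀ T : Module.End ℂ V, (∀ μ, T.HasEigenvalue μ → μ.re ≤ 0) →
      ∀ η > 0, ∃ (H : Type) (_ : NormedAddCommGroup H) (_ : InnerProductSpace ℂ H) (B : V →ₗ[ℂ] H),
        Function.Injective B ∧ ∀ v, (inner ℂ (B v) (B (T v))).re ≤ η * ‖B v‖ ^ 2 := by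
  induction m with
  | zero =>
    intro V _ _ _ hV T _ η _
    have := Module.finrank_zero_iff.1 hV
    exact ⟨ℂ, inferInstance, inferInstance, 0, Function.injective_of_subsingleton _, by simp⟩
  | succ m ih =>
    intro V _ _ _ hV T hT η hη
    have hnt : Nontrivial V := Module.nontrivial_of_finrank_pos (R := ℂ) (by omega)
    -- Induction on the dimension: the kernel of an eigenvector `ψ` of the transpose is an invariant
    -- hyperplane, and `T` is block triangular with respect to it and a complementary vector.
    obtain ⟨μ, hμ⟩ := Module.End.exists_eigenvalue (K := ℂ) T.dualMap
    obtain ⟨ψ, hψ⟩ := hμ.exists_hasEigenvector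
    have hψT : ∀ v, ψ (T v) = μ * ψ v := fun v => by
      simpa using LinearMap.congr_fun hψ.apply_eq_smul v
    have hψ0 : ψ ≠ 0 := hψ.2
    have hμre := hT μ (hasEigenvalue_of_dual hψ0 hψT)
    obtain ⟨v, hv⟩ : ∃ v, ψ v = 1 := LinearMap.surjective hψ0 1
    let K := LinearMap.ker ψ
    have hK : ∀ x ∈ K, T x ∈ K := fun x hx => by
      have hx' : ψ x = 0 := hx
      simp [K, hψT, hx']
    have hKrank : Module.finrank ℂ K = m := by
      have h1 := LinearMap.finrank_range_add_finrank_ker ψ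
      rw [LinearMap.range_eq_top.2 (LinearMap.surjective hψ0), finrank_top,
        Module.finrank_self] at h1
      change Module.finrank ℂ (LinearMap.ker ψ) = m
      omega
    obtain ⟨H, _, _, B, hBinj, hB⟩ := ih K hKrank (T.restrict hK) (fun ν hν => by
      obtain ⟨w, hw⟩ := hν.exists_hasEigenvector
      refine hT ν (Module.End.hasEigenvalue_of_hasEigenvector (x := (w : V)) ⟨?_, ?_⟩)
      · rw [Module.End.mem_eigenspace_iff]
        exact congrArg Subtype.val hw.apply_eq_smul
      · exact fun h => hw.2 (Subtype.ext h)) (η / 2) (half_pos hη)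
    let π : V →ₗ[ℂ] K := (LinearMap.id - ψ.smulRight v).codRestrict K fun w => by
      simp [K, hv]
    have hπ : ∀ w, (π w : V) = w - ψ w • v := fun w => rfl
    have hπT : ∀ w, π (T w) = T.restrict hK (π w) + ψ w • π (T v) := fun w => by
      refine Subtype.ext ?_
      rw [Submodule.coe_add, Submodule.coe_smul, LinearMap.coe_restrict_apply, hπ, hπ, hπ, map_sub,
        map_smul, hψT, hψT, hv, smul_sub, smul_smul]
      rw [mul_one, mul_comm μ]
      abel
    set κ := ‖B (π (T v))‖ with hκ
    -- The coupling of size `κ` from the complementary vector into the hyperplane is made harmless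
    -- by giving the `ψ`-coordinate a large weight `c`.
    obtain ⟨c, hc, hcκ⟩ : ∃ c : ℝ, 0 < c ∧ κ ^ 2 ≤ 2 * η ^ 2 * c ^ 2 := by
      refine ⟨Real.sqrt (κ ^ 2 / (2 * η ^ 2) + 1), by positivity, ?_⟩
      rw [Real.sq_sqrt (by positivity), mul_add, mul_div_cancel₀ _ (by positivity)]
      nlinarith
    let B' : V →ₗ[ℂ] WithLp 2 (ℂ × H) :=
      (WithLp.linearEquiv 2 ℂ (ℂ × H)).symm.toLinearMap ∘ₗ
        (((c : ℂ) • ψ).prod (B ∘ₗ π))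
    have hB1 : ∀ w, B' w = WithLp.toLp 2 ((c : ℂ) * ψ w, B (π w)) := fun w => rfl
    refine ⟨WithLp 2 (ℂ × H), inferInstance, inferInstance, B', ?_, fun w => ?_⟩
    · rw [injective_iff_map_eq_zero]
      intro w hw
      rw [hB1] at hw
      have h1 : (c : ℂ) * ψ w = 0 := congrArg (fun z => z.fst) hw
      have h2 : B (π w) = 0 := congrArg (fun z => z.snd) hw
      have h3 : ψ w = 0 := by simpa [hc.ne'] using h1
      have h4 := congrArg Subtype.val ((injective_iff_map_eq_zero B).1 hBinj _ h2)
      rw [hπ, h3, zero_smul, sub_zero] at h4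
      exact h4
    · have h1 : ‖B' w‖ ^ 2 = c ^ 2 * ‖ψ w‖ ^ 2 + ‖B (π w)‖ ^ 2 := by
        rw [WithLp.prod_norm_sq_eq_of_L2, hB1]
        simp [mul_pow]
      have h2 : inner ℂ (B' w) (B' (T w)) =
          (c : ℂ) * ψ (T w) * (starRingEnd ℂ) ((c : ℂ) * ψ w) + inner ℂ (B (π w)) (B (π (T w))) := by
        rw [WithLp.prod_inner_apply, hB1, hB1]
        simp
      have h3 : ((c : ℂ) * ψ (T w) * (starRingEnd ℂ) ((c : ℂ) * ψ w)).re =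
          c ^ 2 * (‖ψ w‖ ^ 2 * μ.re) := by
        have : (c : ℂ) * ψ (T w) * (starRingEnd ℂ) ((c : ℂ) * ψ w) =
            ((c ^ 2 * ‖ψ w‖ ^ 2 : ℝ) : ℂ) * μ := by
          rw [hψT, map_mul, Complex.conj_ofReal]
          push_cast
          rw [← Complex.mul_conj']
          ring
        rw [this, Complex.re_ofReal_mul]
        ring
      have h4 : (inner ℂ (B (π w)) (B (π (T w)))).re ≤
          η / 2 * ‖B (π w)‖ ^ 2 + ‖B (π w)‖ * (‖ψ w‖ * κ) := by
        rw [hπT, map_add, map_smul, inner_add_right, Complex.add_re]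
        refine add_le_add (hB _) ((Complex.re_le_norm _).trans ((norm_inner_le_norm _ _).trans ?_))
        rw [norm_smul]
      have h5 : c ^ 2 * (‖ψ w‖ ^ 2 * μ.re) ≤ 0 :=
        mul_nonpos_of_nonneg_of_nonpos (by positivity)
          (mul_nonpos_of_nonneg_of_nonpos (by positivity) hμre)
      rw [h2, Complex.add_re, h3, h1]
      -- Young's inequality; the induction hypothesis was used with η/2 in order to leave room for
      -- the first term.
      have h6 : ‖B (π w)‖ * (‖ψ w‖ * κ) ≤ η / 2 * ‖B (π w)‖ ^ 2 + η * c ^ 2 * ‖ψ w‖ ^ 2 := by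
        have h7 : κ ^ 2 * ‖ψ w‖ ^ 2 ≤ 2 * η ^ 2 * c ^ 2 * ‖ψ w‖ ^ 2 := by gcongr
        have h8 := sq_nonneg (η * ‖B (π w)‖ - κ * ‖ψ w‖)
        have h9 : 0 ≤ η * (η / 2 * ‖B (π w)‖ ^ 2 + η * c ^ 2 * ‖ψ w‖ ^ 2 -
          ‖B (π w)‖ * (‖ψ w‖ * κ)) := by nlinarith
        have := nonneg_of_mul_nonneg_right h9 hη
        linarith
      linarith

variable {V : Type} [AddCommGroup V] [Module ℂ V] [FiniteDimensional ℂ V] {d : ℕ}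

/-- Modulo the eigenvectors of the (simple) eigenvalues in the right half plane, all eigenvalues
have nonpositive real part. -/
lemma re_nonpos_of_hasEigenvalue_mapQ {A : Module.End ℂ V} {lam : Fin d → ℂ}
    (hinj : Function.Injective lam)
    (hlam : Multiset.filter (fun z : ℂ => 0 < z.re) A.charpoly.roots =
      Multiset.map lam Finset.univ.val)
    {v : Fin d → V} (hv : ∀ j, A.HasEigenvector (lam j) (v j))
    (hA : Submodule.span ℂ (Set.range v) ≤ (Submodule.span ℂ (Set.range v)).comap A) {μ : ℂ}
    (hμ : Module.End.HasEigenvalue ((Submodule.span ℂ (Set.range v)).mapQ _ A hA) μ) :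
    μ.re ≤ 0 := by
  by_contra! hre
  set W := Submodule.span ℂ (Set.range v) with hW
  set T : Module.End ℂ (V ⧸ W) := W.mapQ W A hA with hT
  -- A left eigenvector on the quotient pulls back to a left eigenvector `ψ` of `A` that vanishes on
  -- all the given eigenvectors.
  obtain ⟨ψ', hψ', hker⟩ : ∃ f : Module.Dual ℂ (V ⧸ W), f ≠ 0 ∧
      LinearMap.range (T - algebraMap ℂ (Module.End ℂ (V ⧸ W)) μ) ≤ LinearMap.ker f := by
    refine Submodule.exists_le_ker_of_lt_top _ (lt_top_iff_ne_top.2 fun htop => ?_)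
    have h1 := LinearMap.injective_iff_surjective.2 (LinearMap.range_eq_top.1 htop)
    rw [Module.End.hasEigenvalue_iff, Module.End.eigenspace_def] at hμ
    exact hμ (LinearMap.ker_eq_bot.2 h1)
  let ψ : Module.Dual ℂ V := ψ' ∘ₗ W.mkQ
  have hψ0 : ψ ≠ 0 := fun h0 => hψ' (LinearMap.ext fun x => by
    obtain ⟨y, rfl⟩ := W.mkQ_surjective x
    exact LinearMap.congr_fun h0 y)
  have hψA : ∀ x, ψ (A x) = μ * ψ x := fun x => by
    have h1 : ψ' ((T - algebraMap ℂ (Module.End ℂ (V ⧸ W)) μ) (W.mkQ x)) = 0 := hker ⟨_, rfl⟩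
    have h2 : T (W.mkQ x) = W.mkQ (A x) := rfl
    rw [LinearMap.sub_apply, h2, map_sub, Module.algebraMap_end_apply, map_smul, sub_eq_zero] at h1
    exact h1
  have hev := hasEigenvalue_of_dual hψ0 hψA
  have hroot : μ ∈ Multiset.map lam Finset.univ.val := by
    rw [← hlam, Multiset.mem_filter]
    refine ⟨?_, hre⟩
    rw [Polynomial.mem_roots A.charpoly_monic.ne_zero]
    exact (Module.End.hasEigenvalue_iff_isRoot_charpoly A μ).1 hev
  obtain ⟨j, -, rfl⟩ := Multiset.mem_map.1 hroot
  -- Filtering by the right half plane does not change the multiplicity of a root there, and `lam`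
  -- lists these roots without repetition.
  have hmult : A.charpoly.rootMultiplicity (lam j) = 1 := by
    rw [← Polynomial.count_roots, ← Multiset.count_filter_of_pos (p := fun z : ℂ => 0 < z.re) hre,
      hlam]
    exact Multiset.count_eq_one_of_mem (Finset.univ.nodup.map hinj) hroot
  have hfin := LinearMap.finrank_maxGenEigenspace_eq A (lam j)
  rw [hmult] at hfin
  have hle : Module.finrank ℂ (LinearMap.ker (A - algebraMap ℂ (Module.End ℂ V) (lam j))) ≤ 1 := by
    rw [← hfin, Algebra.algebraMap_eq_smul_one, ← Module.End.eigenspace_def]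
    exact Submodule.finrank_mono (A.genEigenspace_le_maximal (lam j) 1)
  set N := A - algebraMap ℂ (Module.End ℂ V) (lam j) with hN
  -- The eigenspace is at most a line, so the range of `N` has codimension at most one and fills the
  -- hyperplane ker ψ. Hence `v j` lies in this range and starts a Jordan chain of length two,
  -- contrary to simplicity.
  have hrange : LinearMap.range N = LinearMap.ker ψ := by
    refine Submodule.eq_of_le_of_finrank_le ?_ ?_
    · rintro _ ⟨x, rfl⟩
      simp [hN, hψA]
    · have h1 := LinearMap.finrank_range_add_finrank_ker N
      have h2 := LinearMap.finrank_range_add_finrank_ker ψ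
      rw [LinearMap.range_eq_top.2 (LinearMap.surjective hψ0), finrank_top,
        Module.finrank_self] at h2
      omega
  have hvψ : v j ∈ LinearMap.ker ψ := by
    have : W.mkQ (v j) = 0 := by
      simpa using Submodule.subset_span (Set.mem_range_self j)
    simp [ψ, this]
  rw [← hrange] at hvψ
  obtain ⟨u, hu⟩ := hvψ
  have hNv : N (v j) = 0 := by
    simp [hN, (hv j).apply_eq_smul]
  have huG : u ∈ A.maxGenEigenspace (lam j) := by
    rw [Module.End.mem_maxGenEigenspace]
    refine ⟨2, ?_⟩
    have : (A - lam j • (1 : Module.End ℂ V)) = N := by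
      rw [hN, Algebra.algebraMap_eq_smul_one]
    rw [this, pow_two, Module.End.mul_apply, hu, hNv]
  have hvG : v j ∈ A.maxGenEigenspace (lam j) := A.genEigenspace_le_maximal (lam j) 1 (hv j).1
  obtain ⟨c, hc⟩ := (finrank_eq_one_iff_of_nonzero' (⟨v j, hvG⟩ : A.maxGenEigenspace (lam j))
    fun h => (hv j).2 (congrArg Subtype.val h)).1 hfin ⟨u, huG⟩
  have hc' : c • v j = u := congrArg Subtype.val hc
  rw [← hc', map_smul, hNv, smul_zero] at hu
  exact (hv j).2 hu.symm

/-- A form that vanishes exactly on the unstable eigenspace and grows arbitrarily slowly. -/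
theorem exists_transverse_form {A : Module.End ℂ V} {lam : Fin d → ℂ}
    (hinj : Function.Injective lam)
    (hlam : Multiset.filter (fun z : ℂ => 0 < z.re) A.charpoly.roots =
      Multiset.map lam Finset.univ.val)
    {v : Fin d → V} (hv : ∀ j, A.HasEigenvector (lam j) (v j)) {η : ℝ} (hη : 0 < η) :
    ∃ (H : Type) (_ : NormedAddCommGroup H) (_ : InnerProductSpace ℂ H) (B : V →ₗ[ℂ] H),
      (∀ y, B y = 0 ↔ y ∈ Submodule.span ℂ (Set.range v)) ∧
        ∀ y, (inner ℂ (B y) (B (A y))).re ≤ η * ‖B y‖ ^ 2 := by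
  set W := Submodule.span ℂ (Set.range v) with hW
  have hA : W ≤ W.comap A := by
    rw [hW, Submodule.span_le]
    rintro _ ⟨j, rfl⟩
    change A (v j) ∈ Submodule.span ℂ (Set.range v)
    rw [(hv j).apply_eq_smul]
    exact Submodule.smul_mem _ _ (Submodule.subset_span (Set.mem_range_self j))
  obtain ⟨H, _, _, B, hBinj, hB⟩ := exists_almost_dissipative_embedding _ (V ⧸ W) rfl
    (W.mapQ W A hA) (fun μ hμ => re_nonpos_of_hasEigenvalue_mapQ hinj hlam hv hA hμ) η hη
  refine ⟨H, inferInstance, inferInstance, B ∘ₗ W.mkQ, fun y => ?_, fun y => hB (W.mkQ y)⟩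
  rw [LinearMap.comp_apply, map_eq_zero_iff B hBinj]
  simp

end LinearAlgebra

/-! ### Taylor expansions in several complex variables and their coefficients -/

section Taylor

open Asymptotics

variable {d : ℕ}

lemma le_order (β : MultiIndex d) (j : Fin d) : β j ≤ β.order :=
  Finset.single_le_sum (f := β) (fun _ _ => Nat.zero_le _) (Finset.mem_univ j)

lemma eq_zero_of_order_eq_zero {β : MultiIndex d} (h : β.order = 0) : β = 0 := by
  funext j
  exact Nat.eq_zero_of_le_zero (h ▸ le_order β j)

lemma mem_indicesUpTo {k : ℕ} {β : MultiIndex d} : β ∈ indicesUpTo d k ↔ β.order ≤ k := by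
  simp only [indicesUpTo, Finset.mem_filter, Fintype.mem_piFinset, Finset.mem_range,
    and_iff_right_iff_imp]
  intro h j
  have := le_order β j
  omega

lemma order_add (β γ : MultiIndex d) : MultiIndex.order (β + γ) = β.order + γ.order :=
  Finset.sum_add_distrib

@[simp] lemma order_zero : MultiIndex.order (0 : MultiIndex d) = 0 := by simp [MultiIndex.order]

@[simp] lemma order_single (j : Fin d) (m : ℕ) :
    MultiIndex.order (Pi.single j m : MultiIndex d) = m := by
  simp [MultiIndex.order]

lemma exists_eq_single_of_order_eq_one {β : MultiIndex d} (h : β.order = 1) :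
    ∃ j, β = Pi.single j 1 := by
  obtain ⟨j, hj⟩ : ∃ j, β j ≠ 0 := by
    by_contra! h0
    rw [show β = 0 from funext h0, order_zero] at h
    exact zero_ne_one h
  have h1 : β = β - Pi.single j 1 + Pi.single j 1 := by
    funext i
    rcases eq_or_ne i j with rfl | hi
    · simp; omega
    · simp [hi]
  have h2 := congrArg MultiIndex.order h1
  rw [order_add, order_single, h] at h2
  rw [eq_zero_of_order_eq_zero (show MultiIndex.order (β - Pi.single j 1) = 0 by omega),
    zero_add] at h1
  exact ⟨j, h1⟩

lemma sum_indicesUpTo_one {M : Type*} [AddCommMonoid M] (g : MultiIndex d → M) :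
    ∑ β ∈ indicesUpTo d 1, g β = g 0 + ∑ j, g (Pi.single j 1) := by
  have h1 : indicesUpTo d 1 =
      insert 0 (Finset.univ.image fun j => (Pi.single j 1 : MultiIndex d)) := by
    ext β
    simp only [mem_indicesUpTo, Finset.mem_insert, Finset.mem_image, Finset.mem_univ, true_and]
    constructor
    · intro h
      rcases Nat.le_one_iff_eq_zero_or_eq_one.1 h with h | h
      · exact Or.inl (eq_zero_of_order_eq_zero h)
      · obtain ⟨j, rfl⟩ := exists_eq_single_of_order_eq_one h
        exact Or.inr ⟨j, rfl⟩
    · rintro (rfl | ⟨j, rfl⟩) <;> simp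
  rw [h1, Finset.sum_insert, Finset.sum_image]
  · intro i _ j _ hij
    by_contra hne
    simpa [hne] using congrFun hij i
  · intro h
    obtain ⟨j, -, hj⟩ := Finset.mem_image.1 h
    simpa using congrFun hj j

@[simp] lemma monom_single (σ : Fin d → ℂ) (j : Fin d) : monom σ (Pi.single j 1) = σ j := by
  rw [monom, Finset.prod_eq_single j]
  · simp
  · intro i _ hi
    simp [hi]
  · simp

@[simp] lemma monom_zero_right (σ : Fin d → ℂ) : monom σ 0 = 1 := by simp [monom]

lemma norm_monom_le (σ : Fin d → ℂ) (β : MultiIndex d) : ‖monom σ β‖ ≤ ‖σ‖ ^ β.order := by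
  rw [monom, norm_prod, MultiIndex.order, ← Finset.prod_pow_eq_pow_sum]
  refine Finset.prod_le_prod (fun _ _ => norm_nonneg _) fun j _ => ?_
  rw [norm_pow]
  gcongr
  exact norm_le_pi_norm σ j

lemma isBigO_norm_pow_of_le {m k : ℕ} (h : m ≤ k) {E : Type*} [NormedAddCommGroup E] :
    (fun σ : E => ‖σ‖ ^ k) =O[𝓝 0] fun σ => ‖σ‖ ^ m := by
  refine IsBigO.of_bound 1 ?_
  filter_upwards [Metric.ball_mem_nhds (0 : E) one_pos] with σ hσ
  rw [mem_ball_zero_iff] at hσ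
  rw [one_mul, norm_pow, norm_pow, norm_norm]
  exact pow_le_pow_of_le_one (norm_nonneg _) hσ.le h

variable {F : Type*} [NormedAddCommGroup F] [NormedSpace ℂ F]

lemma isBigO_sum_monom (s : Finset (MultiIndex d)) (c : MultiIndex d → F) {m : ℕ}
    (hs : ∀ β ∈ s, m ≤ β.order ∨ c β = 0) :
    (fun σ : Fin d → ℂ => ∑ β ∈ s, monom σ β • c β) =O[𝓝 0] fun σ => ‖σ‖ ^ m := by
  refine IsBigO.fun_sum fun β hβ => ?_
  rcases hs β hβ with h | h
  · refine IsBigO.trans ?_ (isBigO_norm_pow_of_le (E := Fin d → ℂ) h)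
    refine IsBigO.of_bound ‖c β‖ (Eventually.of_forall fun σ => ?_)
    rw [norm_smul, mul_comm, norm_pow, norm_norm]
    gcongr
    exact norm_monom_le σ β
  · simp only [h, smul_zero]
    exact isBigO_zero (E' := F) _ _

/-- Cauchy estimate: the derivative of a holomorphic function that vanishes to order `k + 2`
vanishes to order `k + 1`. -/
lemma isBigO_fderiv {E : Type*} [NormedAddCommGroup E] [NormedSpace ℂ E] {R : E → F} {k : ℕ}
    (hd : ∀ᶠ σ in 𝓝 0, DifferentiableAt ℂ R σ) (hR : R =O[𝓝 0] fun σ => ‖σ‖ ^ (k + 2)) :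
    fderiv ℂ R =O[𝓝 0] fun σ => ‖σ‖ ^ (k + 1) := by
  have h0 : fderiv ℂ R 0 = 0 := by
    have : R =O[𝓝 0] fun σ => ‖σ - 0‖ ^ (k + 2) := by simpa using hR
    exact (this.hasFDerivAt (by omega)).fderiv
  obtain ⟨C, hC, hR⟩ := hR.exists_pos
  obtain ⟨ρ, hρ, hball⟩ := Metric.eventually_nhds_iff.1 (hd.and hR.bound)
  refine IsBigO.of_bound (C * 2 ^ (k + 2)) ?_
  filter_upwards [Metric.ball_mem_nhds (0 : E) (half_pos hρ)] with σ hσ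
  rw [mem_ball_zero_iff] at hσ
  rcases eq_or_ne σ 0 with rfl | hσ0
  · simp [h0]
  have hσn : 0 < ‖σ‖ := norm_pos_iff.2 hσ0
  refine ContinuousLinearMap.opNorm_le_bound _ (by positivity) fun v => ?_
  rcases eq_or_ne v 0 with rfl | hv0
  · simp
  have hvn : 0 < ‖v‖ := norm_pos_iff.2 hv0
  -- Cauchy's estimate is applied on the largest disc in direction `v` that stays within norm 2‖σ‖,
  -- whence the factor 2^{k+2}. The point σ = 0, where this disc degenerates, was treated
  -- separately.
  have hin : ∀ z ∈ Metric.closedBall (0 : ℂ) (‖σ‖ / ‖v‖), ‖σ + z • v‖ ≤ 2 * ‖σ‖ := by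
    intro z hz
    rw [mem_closedBall_zero_iff, le_div_iff₀ hvn] at hz
    refine (norm_add_le _ _).trans ?_
    rw [norm_smul]
    linarith
  have hderiv : ∀ z ∈ Metric.closedBall (0 : ℂ) (‖σ‖ / ‖v‖),
      HasDerivAt (fun z : ℂ => R (σ + z • v)) (fderiv ℂ R (σ + z • v) v) z := by
    intro z hz
    have h1 := (hball (y := σ + z • v) (by rw [dist_zero_right]; linarith [hin z hz])).1
    refine h1.hasFDerivAt.comp_hasDerivAt z ?_
    simpa using ((hasDerivAt_id z).smul_const v).const_add σ
  have hr : 0 < ‖σ‖ / ‖v‖ := by positivity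
  have key := Complex.norm_deriv_le_of_forall_mem_sphere_norm_le (c := 0) (C := C * (2 * ‖σ‖) ^ (k + 2))
    (f := fun z : ℂ => R (σ + z • v)) hr ?_ ?_
  · rw [(hderiv 0 (Metric.mem_closedBall_self hr.le)).deriv] at key
    simp only [zero_smul, add_zero] at key
    refine key.trans (le_of_eq ?_)
    rw [norm_pow, norm_norm]
    field_simp
    ring
  · refine DifferentiableOn.diffContOnCl (fun z hz => ?_)
    rw [closure_ball _ hr.ne'] at hz
    exact (hderiv z hz).differentiableAt.differentiableWithinAt
  · intro z hz
    have h1 := hin z (Metric.sphere_subset_closedBall hz)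
    have h2 := (hball (y := σ + z • v) (by rw [dist_zero_right]; linarith)).2
    rw [norm_pow, norm_norm] at h2
    exact h2.trans (by gcongr)

lemma hasFDerivAt_monom (β : MultiIndex d) (σ : Fin d → ℂ) :
    HasFDerivAt (fun σ => monom σ β) (∑ i, (∏ l ∈ Finset.univ.erase i, σ l ^ β l) •
      ((β i : ℂ) * σ i ^ (β i - 1)) • (ContinuousLinearMap.proj i : (Fin d → ℂ) →L[ℂ] ℂ)) σ := by
  refine HasFDerivAt.finsetProd fun i _ => ?_
  simpa using (ContinuousLinearMap.proj (R := ℂ) (φ := fun _ : Fin d => ℂ) i).hasFDerivAt.pow (β i)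

lemma analyticAt_monom (β : MultiIndex d) (σ : Fin d → ℂ) :
    AnalyticAt ℂ (fun σ => monom σ β) σ := by
  refine Finset.analyticAt_fun_prod _ fun i _ => AnalyticAt.pow ?_ _
  exact (ContinuousLinearMap.proj (R := ℂ) (φ := fun _ : Fin d => ℂ) i).analyticAt σ

/-- `β! = β_1! ⋯ β_d!`. -/
def MultiIndex.factorial (β : MultiIndex d) : ℕ := ∏ j, (β j).factorial

lemma factorial_ne_zero (β : MultiIndex d) : (MultiIndex.factorial β : ℂ) ≠ 0 :=
  Nat.cast_ne_zero.2 (Finset.prod_ne_zero_iff.2 fun _ _ => Nat.factorial_ne_zero _)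

lemma factorial_add_single (β : MultiIndex d) (j : Fin d) :
    MultiIndex.factorial (β + Pi.single j 1) = (β j + 1) * MultiIndex.factorial β := by
  rw [MultiIndex.factorial, MultiIndex.factorial,
    ← Finset.mul_prod_erase Finset.univ _ (Finset.mem_univ j),
    ← Finset.mul_prod_erase Finset.univ (fun i => (β i).factorial) (Finset.mem_univ j), ← mul_assoc]
  congr 1
  · simp [Nat.factorial_succ]
  · refine Finset.prod_congr rfl fun i hi => ?_
    simp [Finset.ne_of_mem_erase hi]

lemma fderiv_monom_single (β : MultiIndex d) (j : Fin d) (σ : Fin d → ℂ) :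
    fderiv ℂ (fun σ => monom σ (β + Pi.single j 1)) σ (Pi.single j 1) =
      (β j + 1 : ℂ) * monom σ β := by
  rw [(hasFDerivAt_monom _ σ).fderiv]
  simp only [_root_.sum_apply, _root_.smul_apply,
    ContinuousLinearMap.proj_apply, smul_eq_mul]
  rw [Finset.sum_eq_single j]
  · rw [monom, ← Finset.mul_prod_erase Finset.univ _ (Finset.mem_univ j)]
    have : ∏ l ∈ Finset.univ.erase j, σ l ^ (β + Pi.single j 1 : MultiIndex d) l =
        ∏ l ∈ Finset.univ.erase j, σ l ^ β l :=
      Finset.prod_congr rfl fun l hl => by simp [Finset.ne_of_mem_erase hl]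
    rw [this]
    simp
    ring
  · intro i _ hi
    simp [hi]
  · simp

lemma fderiv_monom_of_eq_zero {β : MultiIndex d} {j : Fin d} (h : β j = 0) (σ : Fin d → ℂ) :
    fderiv ℂ (fun σ => monom σ β) σ (Pi.single j 1) = 0 := by
  rw [(hasFDerivAt_monom _ σ).fderiv]
  simp only [_root_.sum_apply, _root_.smul_apply,
    ContinuousLinearMap.proj_apply, smul_eq_mul]
  refine Finset.sum_eq_zero fun i _ => ?_
  rcases eq_or_ne i j with rfl | hi
  · simp [h]
  · simp [hi]

/-- Euler's identity: monomials are eigenfunctions of the derivative along Λσ, which makes the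
invariance equation decouple into one equation for each multi-index. -/
lemma fderiv_monom_diagonal (lam : Fin d → ℂ) (β : MultiIndex d) (σ : Fin d → ℂ) :
    fderiv ℂ (fun σ => monom σ β) σ (fun j => lam j * σ j) = pairing lam β * monom σ β := by
  rw [(hasFDerivAt_monom _ σ).fderiv]
  simp only [_root_.sum_apply, _root_.smul_apply,
    ContinuousLinearMap.proj_apply, smul_eq_mul, pairing, Finset.sum_mul]
  refine Finset.sum_congr rfl fun i _ => ?_
  rw [monom, ← Finset.mul_prod_erase Finset.univ _ (Finset.mem_univ i)]
  rcases Nat.eq_zero_or_pos (β i) with h | h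
  · simp [h]
  · obtain ⟨m, hm⟩ := Nat.exists_eq_succ_of_ne_zero h.ne'
    rw [hm]
    simp [pow_succ]
    ring

lemma HasTaylorUpTo.mono {f : (Fin d → ℂ) → ℂ} {a : MultiIndex d → ℂ} {m k : ℕ} (hmk : m ≤ k)
    (h : HasTaylorUpTo f a k) : HasTaylorUpTo f a m := by
  have h1 : (fun σ => f σ - ∑ β ∈ indicesUpTo d k, a β * monom σ β) =O[𝓝 0]
      fun σ : Fin d → ℂ => ‖σ‖ ^ (m + 1) := h.trans (isBigO_norm_pow_of_le (by omega))
  have hsub : indicesUpTo d m ⊆ indicesUpTo d k := fun β hβ =>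
    mem_indicesUpTo.2 ((mem_indicesUpTo.1 hβ).trans hmk)
  have h2 := isBigO_sum_monom (indicesUpTo d k \ indicesUpTo d m) a (m := m + 1) fun β hβ => by
    left
    by_contra! h3
    exact (Finset.mem_sdiff.1 hβ).2 (mem_indicesUpTo.2 (by omega))
  refine (h1.add h2).congr_left fun σ => ?_
  rw [← Finset.sum_sdiff hsub]
  simp only [smul_eq_mul, mul_comm (monom σ _)]
  ring

lemma HasTaylorUpTo.congr_isBigO {f g : (Fin d → ℂ) → ℂ} {a : MultiIndex d → ℂ} {k : ℕ}
    (h : HasTaylorUpTo f a k) (hfg : (fun σ => g σ - f σ) =O[𝓝 0] fun σ => ‖σ‖ ^ (k + 1)) :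
    HasTaylorUpTo g a k := by
  refine (hfg.add h).congr_left fun σ => ?_
  ring

lemma HasTaylorUpTo.congr_coeff {f : (Fin d → ℂ) → ℂ} {a b : MultiIndex d → ℂ} {k : ℕ}
    (h : HasTaylorUpTo f a k) (hab : ∀ β, β.order ≤ k → a β = b β) : HasTaylorUpTo f b k := by
  refine h.congr_left fun σ => ?_
  congr 1
  exact Finset.sum_congr rfl fun β hβ => by rw [hab β (mem_indicesUpTo.1 hβ)]

/-- Writing the coefficients as A_β/β! turns differentiation into a shift of A. The remainder is
differentiated by the Cauchy estimate, at the cost of one order. -/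
lemma HasTaylorUpTo.partialDeriv {f : (Fin d → ℂ) → ℂ} {A : MultiIndex d → ℂ} {k : ℕ}
    (hf : AnalyticAt ℂ f 0) (h : HasTaylorUpTo f (fun β => A β / β.factorial) (k + 1)) (j : Fin d) :
    HasTaylorUpTo (partialDeriv j f) (fun β => A (β + Pi.single j 1) / β.factorial) k := by
  set p : (Fin d → ℂ) → ℂ := fun σ => ∑ β ∈ indicesUpTo d (k + 1), A β / β.factorial * monom σ β
  have hpd : ∀ σ, DifferentiableAt ℂ p σ := fun σ =>
    DifferentiableAt.fun_sum fun β _ => (analyticAt_monom β σ).differentiableAt.const_mul _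
  have hfd : ∀ᶠ σ in 𝓝 0, DifferentiableAt ℂ f σ :=
    hf.eventually_analyticAt.mono fun σ h => h.differentiableAt
  have h1 := isBigO_fderiv (hfd.mono fun σ hσ => hσ.sub (hpd σ)) h
  have h2 : (fun σ => fderiv ℂ (fun σ => f σ - p σ) σ (Pi.single j 1)) =O[𝓝 0]
      fun σ : Fin d → ℂ => ‖σ‖ ^ (k + 1) := by
    refine IsBigO.trans (IsBigO.of_bound ‖(Pi.single j 1 : Fin d → ℂ)‖
      (Eventually.of_forall fun σ => ?_)) h1
    rw [mul_comm]
    exact ContinuousLinearMap.le_opNorm _ _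
  refine h2.congr' ?_ EventuallyEq.rfl
  filter_upwards [hfd] with σ hσ
  rw [fderiv_fun_sub hσ (hpd σ), _root_.sub_apply]
  congr 1
  have h3 : fderiv ℂ p σ (Pi.single j 1) = ∑ β ∈ indicesUpTo d (k + 1),
      A β / β.factorial * fderiv ℂ (fun σ => monom σ β) σ (Pi.single j 1) := by
    rw [fderiv_fun_sum fun β _ => (analyticAt_monom β σ).differentiableAt.const_mul _,
      _root_.sum_apply]
    refine Finset.sum_congr rfl fun β _ => ?_
    rw [fderiv_const_mul (analyticAt_monom β σ).differentiableAt, _root_.smul_apply,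
      smul_eq_mul]
  have hinj : Set.InjOn (fun β : MultiIndex d => β + Pi.single j 1) (indicesUpTo d k) :=
    fun β _ γ _ hβγ => add_right_cancel hβγ
  have hsub : (indicesUpTo d k).image (fun β => β + Pi.single j 1) ⊆ indicesUpTo d (k + 1) := by
    intro β hβ
    obtain ⟨γ, hγ, rfl⟩ := Finset.mem_image.1 hβ
    rw [mem_indicesUpTo] at hγ ⊢
    rw [order_add, order_single]
    omega
  rw [h3, ← Finset.sum_subset hsub, Finset.sum_image hinj]
  · refine Finset.sum_congr rfl fun β _ => ?_
    rw [fderiv_monom_single, factorial_add_single]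
    have := factorial_ne_zero β
    have h4 : ((β j : ℂ) + 1) ≠ 0 := by exact_mod_cast Nat.succ_ne_zero (β j)
    push_cast
    field_simp
  · intro β hβ hβ'
    rw [fderiv_monom_of_eq_zero, mul_zero]
    by_contra hj
    refine hβ' (Finset.mem_image.2 ⟨β - Pi.single j 1, ?_, ?_⟩)
    all_goals
      have h5 : β - Pi.single j 1 + Pi.single j 1 = β := by
        funext i
        rcases eq_or_ne i j with rfl | hi
        · simp; omega
        · simp [hi]
    · have h6 := congrArg MultiIndex.order h5
      rw [order_add, order_single] at h6
      rw [mem_indicesUpTo] at hβ ⊢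
      omega
    · exact h5

lemma analyticAt_partialDeriv {f : (Fin d → ℂ) → ℂ} {σ : Fin d → ℂ} (hf : AnalyticAt ℂ f σ)
    (j : Fin d) : AnalyticAt ℂ (partialDeriv j f) σ :=
  ((ContinuousLinearMap.apply ℂ ℂ (Pi.single j 1 : Fin d → ℂ)).analyticAt _).comp hf.fderiv

lemma HasTaylorUpTo.partialDeriv_iterate {f : (Fin d → ℂ) → ℂ} {A : MultiIndex d → ℂ} {k : ℕ}
    (j : Fin d) (m : ℕ) (hf : AnalyticAt ℂ f 0)
    (h : HasTaylorUpTo f (fun β => A β / β.factorial) (k + m)) :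
    AnalyticAt ℂ ((PseudospectralDDE.partialDeriv j)^[m] f) 0 ∧
      HasTaylorUpTo ((PseudospectralDDE.partialDeriv j)^[m] f)
        (fun β => A (β + Pi.single j m) / β.factorial) k := by
  induction m generalizing f A with
  | zero => simpa using ⟨hf, h⟩
  | succ m ih =>
    have h1 := HasTaylorUpTo.partialDeriv hf (k := k + m) h j
    have h2 := ih (A := fun β => A (β + Pi.single j 1)) (analyticAt_partialDeriv hf j) h1
    rw [Function.iterate_succ_apply]
    refine ⟨h2.1, ?_⟩
    have h3 : (Pi.single j (m + 1) : MultiIndex d) = Pi.single j m + Pi.single j 1 := by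
      rw [← Pi.single_add]
    simpa only [h3, ← add_assoc] using h2.2

lemma HasTaylorUpTo.foldr_partialDeriv {f : (Fin d → ℂ) → ℂ} {A : MultiIndex d → ℂ}
    (hf : AnalyticAt ℂ f 0) (α : MultiIndex d) (l : List (Fin d)) {k : ℕ}
    (h : HasTaylorUpTo f (fun β => A β / β.factorial) (k + (l.map α).sum)) :
    AnalyticAt ℂ (l.foldr (fun j g => (PseudospectralDDE.partialDeriv j)^[α j] g) f) 0 ∧
      HasTaylorUpTo (l.foldr (fun j g => (PseudospectralDDE.partialDeriv j)^[α j] g) f)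
        (fun β => A (β + (l.map fun j => (Pi.single j (α j) : MultiIndex d)).sum) / β.factorial)
        k := by
  induction l generalizing k with
  | nil => simpa using ⟨hf, h⟩
  | cons j l ih =>
    rw [List.map_cons, List.sum_cons, ← add_assoc] at h
    obtain ⟨h1, h2⟩ := ih h
    have h3 := HasTaylorUpTo.partialDeriv_iterate
      (A := fun β => A (β + (l.map fun j => (Pi.single j (α j) : MultiIndex d)).sum)) j (α j) h1 h2
    rw [List.foldr_cons]
    refine ⟨h3.1, ?_⟩
    simpa only [List.map_cons, List.sum_cons, ← add_assoc] using h3.2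

/-- The coefficients of a Taylor expansion are the Taylor coefficients. -/
theorem HasTaylorUpTo.taylorCoeff_eq {f : (Fin d → ℂ) → ℂ} {a : MultiIndex d → ℂ} {k : ℕ}
    (hf : AnalyticAt ℂ f 0) (h : HasTaylorUpTo f a k) {β : MultiIndex d} (hβ : β.order ≤ k) :
    taylorCoeff f β = a β := by
  have hsum : ((List.finRange d).map β).sum = β.order := by
    rw [MultiIndex.order, ← List.ofFn_eq_map, List.sum_ofFn]
  have hsum' : ((List.finRange d).map fun j => (Pi.single j (β j) : MultiIndex d)).sum = β := by
    rw [← List.ofFn_eq_map, List.sum_ofFn]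
    exact Finset.univ_sum_single β
  have h1 : HasTaylorUpTo f (fun γ => (a γ * γ.factorial) / γ.factorial)
      (0 + ((List.finRange d).map β).sum) := by
    rw [hsum, zero_add]
    exact (h.mono hβ).congr_coeff fun γ _ => (mul_div_cancel_right₀ _ (factorial_ne_zero γ)).symm
  have h2 := (HasTaylorUpTo.foldr_partialDeriv (A := fun γ => a γ * γ.factorial) hf β _ h1).2
  rw [hsum', HasTaylorUpTo] at h2
  have h3 : indicesUpTo d 0 = {0} := by
    ext γ
    rw [mem_indicesUpTo, Finset.mem_singleton]
    exact ⟨fun h => eq_zero_of_order_eq_zero (by omega), fun h => by simp [h]⟩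
  -- After |β| derivatives an expansion of order 0 remains, with error O(‖σ‖). At σ = 0 it is an
  -- equality and reads off the constant term.
  have h4 := h2.eq_zero_imp.self_of_nhds (by simp)
  rw [h3, Finset.sum_singleton, monom_zero_right, sub_eq_zero, mul_one, zero_add] at h4
  rw [taylorCoeff, h4]
  have h5 : (MultiIndex.factorial (0 : MultiIndex d) : ℂ) = 1 := by simp [MultiIndex.factorial]
  rw [h5, div_one]
  exact mul_div_cancel_right₀ _ (factorial_ne_zero β)

/-- Number of occurrences of each index. -/
def occurrences {m : ℕ} (r : Fin m → Fin d) : MultiIndex d := fun j => (Finset.univ.filter fun i => r i = j).card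

lemma order_occurrences {m : ℕ} (r : Fin m → Fin d) : (occurrences r).order = m := by
  rw [MultiIndex.order]
  simp only [occurrences]
  rw [← Finset.card_eq_sum_card_fiberwise (f := r) (s := Finset.univ) (t := Finset.univ)
    (fun _ _ => Finset.mem_univ _)]
  simp

lemma prod_comp_eq_monom {m : ℕ} (r : Fin m → Fin d) (σ : Fin d → ℂ) :
    ∏ i, σ (r i) = monom σ (occurrences r) := by
  rw [monom, ← Finset.prod_fiberwise_of_maps_to (g := r) (t := Finset.univ) (fun _ _ => Finset.mem_univ _)]
  refine Finset.prod_congr rfl fun j _ => ?_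
  rw [occurrences, Finset.prod_congr rfl (fun i hi => by rw [(Finset.mem_filter.1 hi).2]),
    Finset.prod_const]

/-- Expansion in the standard basis: each word in the indices contributes the monomial that counts
its letters. Grouping words by letter count later turns power series into multi-index sums. -/
lemma multilinear_diag_eq {m : ℕ} (p : ContinuousMultilinearMap ℂ (fun _ : Fin m => Fin d → ℂ) F)
    (σ : Fin d → ℂ) : p (fun _ => σ) =
      ∑ r : Fin m → Fin d, monom σ (occurrences r) • p fun i => Pi.single (r i) 1 := by
  have h1 : (fun _ : Fin m => σ) = fun _ => ∑ j, σ j • (Pi.single j 1 : Fin d → ℂ) := by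
    funext i
    conv_lhs => rw [← Finset.univ_sum_single σ]
    refine Finset.sum_congr rfl fun j _ => ?_
    rw [← Pi.single_smul, smul_eq_mul, mul_one]
  rw [h1, p.map_sum]
  refine Finset.sum_congr rfl fun r _ => ?_
  rw [p.map_smul_univ, prod_comp_eq_monom]

/-- An analytic function has Taylor expansions of all orders. -/
theorem exists_hasTaylorUpTo {f : (Fin d → ℂ) → ℂ} (hf : AnalyticAt ℂ f 0) :
    ∃ a, ∀ k, HasTaylorUpTo f a k := by
  obtain ⟨p, hp⟩ := hf
  refine ⟨fun β => ∑ r : Fin β.order → Fin d with occurrences r = β, p β.order fun i => Pi.single (r i) 1,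
    fun k => ?_⟩
  have h1 := hp.isBigO_sub_partialSum_pow (k + 1)
  refine h1.congr_left fun σ => ?_
  rw [zero_add, FormalMultilinearSeries.partialSum]
  congr 1
  rw [← Finset.sum_fiberwise_of_maps_to (g := MultiIndex.order) (t := Finset.range (k + 1))
    (fun β hβ => Finset.mem_range.2 (Nat.lt_succ_of_le (mem_indicesUpTo.1 hβ)))]
  refine Finset.sum_congr rfl fun m hm => ?_
  rw [multilinear_diag_eq, ← Finset.sum_fiberwise_of_maps_to (g := occurrences)
    (t := (indicesUpTo d k).filter fun β => β.order = m) (fun r _ => by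
      rw [Finset.mem_filter, mem_indicesUpTo, order_occurrences]
      exact ⟨Nat.le_of_lt_succ (Finset.mem_range.1 hm), rfl⟩)]
  refine Finset.sum_congr rfl fun β hβ => ?_
  obtain rfl := (Finset.mem_filter.1 hβ).2
  rw [Finset.sum_mul]
  refine Finset.sum_congr rfl fun r hr => ?_
  rw [(Finset.mem_filter.1 hr).2, smul_eq_mul, mul_comm]

end Taylor

/-! ### Flat analytic functions and absolutely summable power series -/

section PowerSeries

open Asymptotics

/-- A function that is analytic along a segment from `0` and flat at `0` vanishes on it. -/
lemma eq_zero_of_flat {X F : Type*} [NormedAddCommGroup X] [NormedSpace ℝ X]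
    [NormedAddCommGroup F] [NormedSpace ℝ F] {Φ : X → F} {σ : X}
    (h : ∀ s ∈ Set.Icc (0 : ℝ) 1, AnalyticAt ℝ Φ (s • σ))
    (hflat : ∀ k : ℕ, Φ =O[𝓝 0] fun τ => ‖τ‖ ^ k) : Φ σ = 0 := by
  set g : ℝ → F := fun s => Φ (s • σ) with hg
  have hga : AnalyticOnNhd ℝ g (Set.Icc 0 1) := fun s hs =>
    AnalyticAt.comp (g := Φ) (f := fun s : ℝ => s • σ) (h s hs)
      (((ContinuousLinearMap.id ℝ ℝ).smulRight σ).analyticAt s)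
  have hgflat : ∀ k : ℕ, g =O[𝓝 0] fun s : ℝ => |s| ^ k := by
    intro k
    have ht : Tendsto (fun s : ℝ => s • σ) (𝓝 0) (𝓝 0) := by
      have : Continuous fun s : ℝ => s • σ := by fun_prop
      simpa using this.tendsto 0
    refine ((hflat k).comp_tendsto ht).trans (IsBigO.of_bound (‖σ‖ ^ k) (Eventually.of_forall ?_))
    intro s
    simp only [Function.comp, norm_pow, norm_smul, Real.norm_eq_abs, abs_abs, mul_pow]
    rw [mul_comm, abs_of_nonneg (by positivity)]
  have h0 : (0 : ℝ) ∈ Set.Icc (0 : ℝ) 1 := ⟨le_rfl, zero_le_one⟩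
  -- Otherwise g(s) = s^m u(s) with u(0) ≠ 0, which contradicts flatness of order m + 1. The
  -- identity theorem then carries the zero along the segment.
  have hev : g =ᶠ[𝓝 0] 0 := by
    by_contra hne
    obtain ⟨m, u, hu, hu0, hgu⟩ := (hga 0 h0).exists_eventuallyEq_pow_smul_nonzero_iff.2 hne
    obtain ⟨C, hC, hb⟩ := (hgflat (m + 1)).exists_pos
    refine hu0 ?_
    have h1 : Tendsto u (𝓝[≠] 0) (𝓝 (u 0)) :=
      hu.continuousAt.tendsto.mono_left nhdsWithin_le_nhds
    have h2 : Tendsto (fun s : ℝ => C * |s|) (𝓝[≠] 0) (𝓝 0) := by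
      have : Continuous fun s : ℝ => C * |s| := by fun_prop
      simpa using (this.tendsto 0).mono_left nhdsWithin_le_nhds
    refine tendsto_nhds_unique h1 (squeeze_zero_norm' ?_ h2)
    filter_upwards [self_mem_nhdsWithin, nhdsWithin_le_nhds hgu, nhdsWithin_le_nhds hb.bound]
      with s hs hs1 hs2
    rw [hs1, sub_zero, norm_smul, norm_pow, norm_pow, Real.norm_eq_abs, Real.norm_eq_abs, abs_abs,
      pow_succ, mul_comm (|s| ^ m) |s|, ← mul_assoc, mul_comm (C * |s|)] at hs2
    exact le_of_mul_le_mul_left hs2 (pow_pos (abs_pos.2 hs) m)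
  have := hga.eqOn_zero_of_preconnected_of_eventuallyEq_zero isPreconnected_Icc h0 hev
    (⟨zero_le_one, le_rfl⟩ : (1 : ℝ) ∈ Set.Icc (0 : ℝ) 1)
  simpa [hg] using this

variable {d : ℕ} {F : Type*} [NormedAddCommGroup F] [NormedSpace ℂ F]

/-- The m slots are matched with the factors of σ^β. In the wrong degree the zero map serves, so
that a choice exists for all pairs (m, β). -/
lemma exists_multilinear_monom (m : ℕ) (β : MultiIndex d) :
    ∃ M : ContinuousMultilinearMap ℂ (fun _ : Fin m => Fin d → ℂ) ℂ,
      (β.order = m → ∀ σ, M (fun _ => σ) = monom σ β) ∧ ∀ x, ‖M x‖ ≤ ∏ i, ‖x i‖ := by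
  by_cases h : β.order = m
  · have hcard : Fintype.card (Σ j, Fin (β j)) = m := by simpa [MultiIndex.order] using h
    let e := Fintype.equivFinOfCardEq hcard
    refine ⟨(ContinuousMultilinearMap.mkPiAlgebra ℂ (Fin m) ℂ).compContinuousLinearMap
      fun i => ContinuousLinearMap.proj (e.symm i).1, fun _ σ => ?_, fun x => ?_⟩
    · simp only [ContinuousMultilinearMap.compContinuousLinearMap_apply,
        ContinuousMultilinearMap.mkPiAlgebra_apply, ContinuousLinearMap.proj_apply]
      rw [Equiv.prod_comp e.symm (fun x => σ x.1), Fintype.prod_sigma]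
      simp [monom]
    · simp only [ContinuousMultilinearMap.compContinuousLinearMap_apply,
        ContinuousMultilinearMap.mkPiAlgebra_apply, ContinuousLinearMap.proj_apply, norm_prod]
      exact Finset.prod_le_prod (fun _ _ => norm_nonneg _) fun i _ => norm_le_pi_norm _ _
  · exact ⟨0, fun h' => absurd h' h, fun x => by simp; positivity⟩

variable {c : MultiIndex d → F}

lemma summable_monom_smul (hc : Summable fun β => ‖c β‖) {σ : Fin d → ℂ} (hσ : ‖σ‖ ≤ 1) :
    Summable fun β => ‖monom σ β • c β‖ := by
  refine Summable.of_nonneg_of_le (fun _ => norm_nonneg _) (fun β => ?_) hc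
  rw [norm_smul]
  exact mul_le_of_le_one_left (norm_nonneg _)
    ((norm_monom_le σ β).trans (pow_le_one₀ (norm_nonneg _) hσ))

variable [CompleteSpace F]

/-- An absolutely summable family of coefficients defines an analytic function on the polydisk. -/
theorem analyticOnNhd_tsum_monom (hc : Summable fun β => ‖c β‖) :
    AnalyticOnNhd ℂ (fun σ : Fin d → ℂ => ∑' β, monom σ β • c β) (Metric.ball 0 1) := by
  choose M hM hMn using exists_multilinear_monom (d := d)
  let T : ℕ → Finset (MultiIndex d) := fun m => (indicesUpTo d m).filter fun β => β.order = m
  let q : FormalMultilinearSeries ℂ (Fin d → ℂ) F := fun m => ∑ β ∈ T m, (M m β).smulRight (c β)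
  have hq : ∀ m x, q m x = ∑ β ∈ T m, M m β x • c β := fun m x => by
    simp [q]
  have hball : HasFPowerSeriesOnBall (fun σ : Fin d → ℂ => ∑' β, monom σ β • c β) q 0 1 := by
    refine ⟨?_, one_pos, fun {y} hy => ?_⟩
    · refine FormalMultilinearSeries.le_radius_of_bound q (∑' β, ‖c β‖) (r := 1) fun m => ?_
      rw [NNReal.coe_one, one_pow, mul_one]
      refine ContinuousMultilinearMap.opNorm_le_bound (tsum_nonneg fun _ => norm_nonneg _)
        fun x => ?_
      rw [hq]
      calc _ ≤ ∑ β ∈ T m, ‖c β‖ * ∏ i, ‖x i‖ := by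
            refine norm_sum_le_of_le _ fun β _ => ?_
            rw [norm_smul, mul_comm]
            gcongr
            exact hMn m β x
        _ ≤ _ := by
            rw [← Finset.sum_mul]
            gcongr
            exact hc.sum_le_tsum _ fun _ _ => norm_nonneg _
    · have hy1 : ‖y‖ ≤ 1 := by
        have : edist y 0 < 1 := hy
        rw [edist_zero_right, ← ofReal_norm, ENNReal.ofReal_lt_one] at this
        exact this.le
      rw [zero_add]
      -- Absolute convergence permits regrouping by total degree, and each group is one homogeneous
      -- term of the power series.
      have h1 := (summable_monom_smul hc hy1).of_norm.hasSum.tsum_fiberwise MultiIndex.order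
      convert! h1 using 2 with m
      have hset : MultiIndex.order ⁻¹' {m} = ((T m : Finset (MultiIndex d)) : Set (MultiIndex d)) := by
        ext β
        simp only [T, Set.mem_preimage, Set.mem_singleton_iff, Finset.mem_coe, Finset.mem_filter,
          mem_indicesUpTo]
        exact ⟨fun h => ⟨h.le, h⟩, fun h => h.2⟩
      rw [hset, Finset.tsum_subtype' (T m) fun β => monom y β • c β, hq]
      exact Finset.sum_congr rfl fun β hβ => by rw [hM m β (Finset.mem_filter.1 hβ).2]
  intro σ hσ
  refine hball.analyticAt_of_mem ?_
  rw [mem_ball_zero_iff] at hσ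
  rw [← ENNReal.ofReal_one, Metric.eball_ofReal]
  exact mem_ball_zero_iff.2 hσ

/-- In the unit polydisk every monomial of order above k is at most ‖σ‖^{k+1}, so the summed norms
of the coefficients serve as the constant. -/
lemma isBigO_tsum_sub_sum (hc : Summable fun β => ‖c β‖) (k : ℕ) :
    (fun σ : Fin d → ℂ => ∑' β, monom σ β • c β - ∑ β ∈ indicesUpTo d k, monom σ β • c β)
      =O[𝓝 0] fun σ => ‖σ‖ ^ (k + 1) := by
  refine IsBigO.of_bound (∑' β, ‖c β‖) ?_
  filter_upwards [Metric.ball_mem_nhds (0 : Fin d → ℂ) one_pos] with σ hσ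
  rw [mem_ball_zero_iff] at hσ
  have hs := summable_monom_smul hc hσ.le
  rw [← hs.of_norm.sum_add_tsum_compl (s := indicesUpTo d k), add_sub_cancel_left, norm_pow,
    norm_norm]
  have hs' : Summable fun β : ↥((indicesUpTo d k : Set (MultiIndex d))ᶜ) => ‖monom σ β • c β‖ :=
    hs.subtype _
  have hc' : Summable fun β : ↥((indicesUpTo d k : Set (MultiIndex d))ᶜ) => ‖c β‖ :=
    hc.subtype _
  calc _ ≤ ∑' β : ↥((indicesUpTo d k : Set (MultiIndex d))ᶜ), ‖monom σ β • c β‖ :=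
        norm_tsum_le_tsum_norm hs'
    _ ≤ ∑' β : ↥((indicesUpTo d k : Set (MultiIndex d))ᶜ), ‖c β‖ * ‖σ‖ ^ (k + 1) := by
        refine hs'.tsum_le_tsum (fun β => ?_) (hc'.mul_right _)
        rw [norm_smul, mul_comm]
        gcongr
        refine (norm_monom_le σ β).trans (pow_le_pow_of_le_one (norm_nonneg _) hσ.le ?_)
        have := β.2
        rw [Set.mem_compl_iff, Finset.mem_coe, mem_indicesUpTo] at this
        omega
    _ = (∑' β : ↥((indicesUpTo d k : Set (MultiIndex d))ᶜ), ‖c β‖) * ‖σ‖ ^ (k + 1) := tsum_mul_right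
    _ ≤ _ := by
        gcongr
        exact hc.tsum_subtype_le _ _ (fun _ => norm_nonneg _)

/-- Truncating at order k + 1 leaves a remainder of order k + 2, and the Cauchy estimate takes one
order away. Boundedness of Λσ near 0 is enough for the direction. -/
lemma isBigO_fderiv_tsum_sub_sum (hc : Summable fun β => ‖c β‖) (lam : Fin d → ℂ) (k : ℕ) :
    (fun σ : Fin d → ℂ => fderiv ℂ (fun σ => ∑' β, monom σ β • c β) σ (fun j => lam j * σ j) -
      ∑ β ∈ indicesUpTo d (k + 1), monom σ β • pairing lam β • c β) =O[𝓝 0]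
      fun σ => ‖σ‖ ^ (k + 1) := by
  set P : (Fin d → ℂ) → F := fun σ => ∑' β, monom σ β • c β with hP
  set p : (Fin d → ℂ) → F := fun σ => ∑ β ∈ indicesUpTo d (k + 1), monom σ β • c β with hp
  have hPd : ∀ᶠ σ in 𝓝 0, DifferentiableAt ℂ P σ := by
    filter_upwards [Metric.ball_mem_nhds (0 : Fin d → ℂ) one_pos] with σ hσ
    exact (analyticOnNhd_tsum_monom hc σ hσ).differentiableAt
  have hpd : ∀ σ, DifferentiableAt ℂ p σ := fun σ =>
    DifferentiableAt.fun_sum fun β _ => (analyticAt_monom β σ).differentiableAt.smul_const _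
  have h1 := isBigO_fderiv (hPd.mono fun σ hσ => hσ.sub (hpd σ)) (isBigO_tsum_sub_sum hc (k + 1))
  have h2 : (fun σ : Fin d → ℂ => (fun j => lam j * σ j : Fin d → ℂ)) =O[𝓝 0]
      fun _ => (1 : ℝ) := by
    have : Continuous fun σ : Fin d → ℂ => (fun j => lam j * σ j : Fin d → ℂ) := by fun_prop
    exact this.continuousAt.isBigO_one ℝ
  have h3 : (fun σ : Fin d → ℂ => fderiv ℂ (fun σ => P σ - p σ) σ (fun j => lam j * σ j)) =O[𝓝 0]
      fun σ => ‖σ‖ ^ (k + 1) := by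
    refine IsBigO.trans (IsBigO.of_bound 1 (Eventually.of_forall fun σ => ?_))
      ((h1.norm_left.mul h2.norm_left).congr_right fun σ => mul_one _)
    rw [one_mul, norm_mul, norm_norm, norm_norm]
    exact ContinuousLinearMap.le_opNorm _ _
  refine h3.congr' ?_ EventuallyEq.rfl
  filter_upwards [hPd] with σ hσ
  rw [fderiv_fun_sub hσ (hpd σ), _root_.sub_apply]
  congr 1
  rw [hp, fderiv_fun_sum fun β _ => (analyticAt_monom β σ).differentiableAt.smul_const _,
    _root_.sum_apply]
  refine Finset.sum_congr rfl fun β _ => ?_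
  rw [fderiv_smul_const (analyticAt_monom β σ).differentiableAt, ContinuousLinearMap.smulRight_apply,
    fderiv_monom_diagonal, smul_smul, mul_comm]

end PowerSeries

/-! ### The vectors v_β, the characteristic function Δ_n and the coefficient map H_n -/

section Pseudospectral

open Asymptotics

variable {n d : ℕ} {L : C(HistoryInterval, ℝ) →L[ℝ] ℝ}

/-- The complexified operator `𝒜_n`. -/
abbrev complexLinear (n : ℕ) (L : C(HistoryInterval, ℝ) →L[ℝ] ℝ) : Module.End ℂ (State ℂ n) :=
  psLinear n (complexify (L : C(HistoryInterval, ℝ) →ₗ[ℝ] ℝ))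

lemma isUnit_det_of_notMem_spectrum {M : Matrix (Fin n) (Fin n) ℂ} {z : ℂ} (hz : z ∉ spectrum ℂ M) :
    IsUnit (M - z • (1 : Matrix (Fin n) (Fin n) ℂ)).det := by
  rw [spectrum.notMem_iff, Algebra.algebraMap_eq_smul_one] at hz
  rw [← Matrix.isUnit_iff_isUnit_det, ← neg_sub]
  exact hz.neg

/-- The vector is built to satisfy the second block of the eigenvalue equation, so the whole defect
sits in the scalar component. This reduces the homological equations to scalar ones. -/
lemma psLinear_blowupVec {z : ℂ} (hz : z ∉ spectrum ℂ (diffMatrixOver ℂ n)) :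
    complexLinear n L (blowupVec n z) = z • blowupVec n z - (charFun n L z, 0) := by
  have hdet := isUnit_det_of_notMem_spectrum hz
  set D := diffMatrixOver ℂ n with hD
  have h1 : (D - z • (1 : Matrix (Fin n) (Fin n) ℂ)).mulVec (blowupVec n z).2 = D.mulVec 1 := by
    rw [blowupVec, Matrix.mulVec_mulVec, Matrix.mul_nonsing_inv _ hdet, Matrix.one_mulVec]
  rw [Matrix.sub_mulVec, Matrix.smul_mulVec, Matrix.one_mulVec, sub_eq_iff_eq_add] at h1
  refine Prod.ext ?_ ?_
  · change complexify (L : C(HistoryInterval, ℝ) →ₗ[ℝ] ℝ) (interp ℂ n (blowupVec n z)) =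
      z * (blowupVec n z).1 - charFun n L z
    rw [charFun, blowupVec]
    simp
  · change -((blowupVec n z).1 • D.mulVec 1) + D.mulVec (blowupVec n z).2 = z • (blowupVec n z).2 - 0
    rw [h1]
    simp [blowupVec]

/-- As D - zI is invertible, the first component of an eigenvector determines the others. It is
therefore nonzero, and the eigenvector is a multiple of `blowupVec n z`. -/
lemma charFun_eq_zero {z : ℂ} (hz : z ∉ spectrum ℂ (diffMatrixOver ℂ n))
    (hev : (complexLinear n L).HasEigenvalue z) : charFun n L z = 0 := by
  obtain ⟨y, hy⟩ := hev.exists_hasEigenvector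
  have hdet := isUnit_det_of_notMem_spectrum hz
  have heq := hy.apply_eq_smul
  set D := diffMatrixOver ℂ n with hD
  have h2 : -(y.1 • D.mulVec 1) + D.mulVec y.2 = z • y.2 := congrArg Prod.snd heq
  have h3 : (D - z • (1 : Matrix (Fin n) (Fin n) ℂ)).mulVec y.2 = y.1 • D.mulVec 1 := by
    rw [Matrix.sub_mulVec, Matrix.smul_mulVec, Matrix.one_mulVec, ← h2]
    abel
  have h4 : y.2 = y.1 • (blowupVec n z).2 := by
    rw [blowupVec, ← Matrix.mulVec_smul, ← h3, Matrix.mulVec_mulVec,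
      Matrix.nonsing_inv_mul _ hdet, Matrix.one_mulVec]
  have h5 : y = y.1 • blowupVec n z := Prod.ext (by simp [blowupVec]) h4
  have h6 : y.1 ≠ 0 := fun h0 => hy.2 (by rw [h5, h0, zero_smul])
  rw [h5, map_smul, psLinear_blowupVec hz, smul_sub, smul_comm, sub_eq_self] at heq
  have h7 : y.1 * charFun n L z = 0 := congrArg Prod.fst heq
  exact (mul_eq_zero.1 h7).resolve_left h6

lemma hasEigenvector_blowupVec {z : ℂ} (hz : z ∉ spectrum ℂ (diffMatrixOver ℂ n))
    (h : charFun n L z = 0) : (complexLinear n L).HasEigenvector z (blowupVec n z) := by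
  refine ⟨?_, fun h0 => one_ne_zero (congrArg Prod.fst h0 : (1 : ℂ) = 0)⟩
  rw [Module.End.mem_eigenspace_iff, psLinear_blowupVec hz, h]
  exact sub_zero _

@[simp] lemma pairing_single (lam : Fin d → ℂ) (j : Fin d) :
    pairing lam (Pi.single j 1) = lam j := by
  rw [pairing, Finset.sum_eq_single j]
  · simp
  · intro i _ hi
    simp [hi]
  · simp

@[simp] lemma pairing_zero (lam : Fin d → ℂ) : pairing lam 0 = 0 := by simp [pairing]

lemma norm_le_of_apply_sub_smul {V : Type*} [NormedAddCommGroup V] [NormedSpace ℂ V]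
    (T : V →L[ℂ] V) {z : ℂ} {u w : V} (h : T u - z • u = w) (hz : ‖T‖ + ‖w‖ + 1 ≤ ‖z‖) :
    ‖u‖ ≤ 1 := by
  have h1 : ‖z • u‖ ≤ ‖T‖ * ‖u‖ + ‖w‖ := by
    have : z • u = T u - w := by rw [← h]; abel
    rw [this]
    exact (norm_sub_le _ _).trans (by gcongr; exact T.le_opNorm u)
  rw [norm_smul] at h1
  by_contra! hu
  have h2 : (‖T‖ + ‖w‖ + 1) * ‖u‖ ≤ ‖z‖ * ‖u‖ := by gcongr
  nlinarith [norm_nonneg w]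

lemma exists_re_lower_bound (lam : Fin d → ℂ) (h : ∀ j, 0 < (lam j).re) :
    ∃ a > 0, ∀ j, a ≤ (lam j).re := by
  rcases isEmpty_or_nonempty (Fin d) with he | he
  · exact ⟨1, one_pos, fun j => he.elim j⟩
  · obtain ⟨j, hj⟩ := Finite.exists_min fun j => (lam j).re
    exact ⟨_, h j, hj⟩

lemma order_mul_le_norm_pairing {lam : Fin d → ℂ} {a : ℝ} (h : ∀ j, a ≤ (lam j).re)
    (β : MultiIndex d) : a * β.order ≤ ‖pairing lam β‖ := by
  refine le_trans ?_ (Complex.re_le_norm _)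
  rw [pairing, Complex.re_sum, MultiIndex.order, Nat.cast_sum, Finset.mul_sum]
  refine Finset.sum_le_sum fun j _ => ?_
  rw [← Complex.ofReal_natCast, mul_comm (lam j), Complex.re_ofReal_mul, mul_comm a]
  gcongr
  exact h j

/-- All real parts are at least some a > 0, so |⟨λ,β⟩| ≥ a|β| and the resolvent of D makes ‖v_β‖ ≤ 1
for all but finitely many β. -/
lemma summable_smul_blowupVec {lam : Fin d → ℂ} (hre : ∀ j, 0 < (lam j).re)
    (hD : ∀ β : MultiIndex d, 1 ≤ β.order → pairing lam β ∉ spectrum ℂ (diffMatrixOver ℂ n))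
    {p : MultiIndex d → ℂ} (hp : Summable fun β => ‖p β‖) :
    Summable fun β => ‖p β • blowupVec n (pairing lam β)‖ := by
  obtain ⟨a, ha, hlow⟩ := exists_re_lower_bound lam hre
  let T : (Fin n → ℂ) →L[ℂ] (Fin n → ℂ) := (Matrix.toLin' (diffMatrixOver ℂ n)).toContinuousLinearMap
  set w := (diffMatrixOver ℂ n).mulVec 1 with hw
  obtain ⟨N, hN⟩ := exists_nat_ge ((‖T‖ + ‖w‖ + 1) / a)
  refine Summable.of_norm_bounded_eventually hp ?_
  have hfin : {β : MultiIndex d | ¬ N + 1 ≤ β.order}.Finite := by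
    refine (indicesUpTo d N).finite_toSet.subset fun β hβ => ?_
    simp only [Set.mem_ofPred_eq] at hβ
    exact mem_indicesUpTo.2 (by omega)
  filter_upwards [hfin.compl_mem_cofinite] with β hβ
  have hβ : N + 1 ≤ β.order := by simpa using hβ
  have hz := hD β (by omega)
  have hdet := isUnit_det_of_notMem_spectrum hz
  set z := pairing lam β with hzdef
  have h1 : T (blowupVec n z).2 - z • (blowupVec n z).2 = w := by
    have h2 : (diffMatrixOver ℂ n - z • (1 : Matrix (Fin n) (Fin n) ℂ)).mulVec (blowupVec n z).2 = w := by
      rw [blowupVec, Matrix.mulVec_mulVec, Matrix.mul_nonsing_inv _ hdet, Matrix.one_mulVec]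
    rwa [Matrix.sub_mulVec, Matrix.smul_mulVec, Matrix.one_mulVec] at h2
  have h2 : ‖T‖ + ‖w‖ + 1 ≤ ‖z‖ := by
    rw [div_le_iff₀ ha] at hN
    have h3 := order_mul_le_norm_pairing hlow β
    have h4 : (N : ℝ) + 1 ≤ β.order := by exact_mod_cast hβ
    nlinarith
  have h3 : ‖blowupVec n z‖ ≤ 1 := by
    rw [Prod.norm_def]
    exact max_le (by simp [blowupVec]) (norm_le_of_apply_sub_smul T h1 h2)
  rw [norm_norm, norm_smul]
  exact mul_le_of_le_one_right (norm_nonneg _) h3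

/-! The nonlinearity near `0`. -/

lemma toComplexFun_re_im (φ : C(HistoryInterval, ℂ)) :
    φ = toComplexFun (reFun φ) + Complex.I • toComplexFun (imFun φ) := by
  ext θ
  simp [toComplexFun, reFun, imFun, mul_comm Complex.I]

lemma toComplexFun_zero : toComplexFun 0 = 0 := by
  ext θ
  simp [toComplexFun]

lemma history_zero_smul (φ : C(HistoryInterval, ℂ)) : (0 : ℂ) • φ = 0 := zero_smul ℂ φ

lemma history_sub_smul (a b : ℂ) (φ : C(HistoryInterval, ℂ)) : (a - b) • φ = a • φ - b • φ :=
  sub_smul a b φ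

lemma history_smul_sub (a : ℂ) (φ ψ : C(HistoryInterval, ℂ)) : a • (φ - ψ) = a • φ - a • ψ :=
  smul_sub a φ ψ

lemma toComplexFun_smul (s : ℝ) (φ : C(HistoryInterval, ℝ)) :
    toComplexFun (s • φ) = s • toComplexFun φ := by
  ext θ
  simp [toComplexFun]

variable {G : C(HistoryInterval, ℝ) → ℝ} {Gc : C(HistoryInterval, ℂ) → ℂ}
  {Ω : Set C(HistoryInterval, ℂ)}

/-- On real directions the derivative is that of G, hence zero; complex linearity and the splitting
into real and imaginary parts do the rest. -/
lemma fderiv_extension_zero (hGc : AnalyticAt ℂ Gc 0)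
    (hGcG : ∀ φ : C(HistoryInterval, ℝ), Gc (toComplexFun φ) = (G φ : ℂ))
    (hG1 : HasFDerivAt G (0 : C(HistoryInterval, ℝ) →L[ℝ] ℝ) 0) : fderiv ℂ Gc 0 = 0 := by
  have hreal : ∀ φ, fderiv ℂ Gc 0 (toComplexFun φ) = 0 := by
    intro φ
    have h1 : HasDerivAt (fun s : ℝ => s • toComplexFun φ) (toComplexFun φ) 0 := by
      simpa using (hasDerivAt_id (0 : ℝ)).smul_const (toComplexFun φ)
    have h2 : HasFDerivAt Gc ((fderiv ℂ Gc 0).restrictScalars ℝ) ((0 : ℝ) • toComplexFun φ) := by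
      rw [show (0 : ℝ) • toComplexFun φ = 0 from zero_smul ℝ (toComplexFun φ)]
      exact hGc.differentiableAt.hasFDerivAt.restrictScalars ℝ
    have h3 := h2.comp_hasDerivAt (0 : ℝ) h1
    have h4 : HasDerivAt (fun s : ℝ => s • φ) φ 0 := by
      simpa using (hasDerivAt_id (0 : ℝ)).smul_const φ
    have h5 : HasFDerivAt G (0 : C(HistoryInterval, ℝ) →L[ℝ] ℝ) ((0 : ℝ) • φ) := by
      rwa [show (0 : ℝ) • φ = 0 from zero_smul ℝ φ]
    have h6 := (h5.comp_hasDerivAt (0 : ℝ) h4).ofReal_comp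
    have h7 : (Gc ∘ fun s : ℝ => s • toComplexFun φ) = fun s : ℝ => ((G ∘ fun s : ℝ => s • φ) s : ℂ) := by
      funext s
      simp only [Function.comp]
      rw [← toComplexFun_smul, hGcG]
    rw [h7] at h3
    simpa using h3.unique h6
  ext φ
  rw [toComplexFun_re_im φ, map_add, map_smul, hreal, hreal]
  simp

/-- An analytic function with vanishing derivative improves orders of vanishing by one. -/
lemma isBigO_comp_sub_of_fderiv_eq_zero {X V : Type*} [NormedAddCommGroup X]
    [NormedAddCommGroup V] [NormedSpace ℂ V] {g : V → ℂ} (hg : AnalyticAt ℂ g 0)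
    (h0 : fderiv ℂ g 0 = 0) {u v : X → V} {k : ℕ} (hu : u =O[𝓝 0] fun σ => ‖σ‖)
    (hv : v =O[𝓝 0] fun σ => ‖σ‖) (huv : (fun σ => u σ - v σ) =O[𝓝 0] fun σ => ‖σ‖ ^ k) :
    (fun σ => g (u σ) - g (v σ)) =O[𝓝 0] fun σ => ‖σ‖ ^ (k + 1) := by
  have h1 : fderiv ℂ g =O[𝓝 0] fun z => z := by
    have := hg.fderiv.differentiableAt.hasFDerivAt.isBigO_sub
    simpa [h0] using this
  obtain ⟨C, hC, h1⟩ := h1.exists_pos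
  obtain ⟨ρ, hρ, hball⟩ := Metric.eventually_nhds_iff.1
    (h1.bound.and (hg.eventually_analyticAt.mono fun z hz => hz.differentiableAt))
  -- Mean value inequality on a ball containing both points, with a derivative that is O(‖z‖). The
  -- factor ‖x‖ + ‖y‖ supplies the extra order.
  have hmv : ∀ x y : V, ‖x‖ < ρ → ‖y‖ < ρ → ‖g x - g y‖ ≤ C * (‖x‖ + ‖y‖) * ‖x - y‖ := by
    intro x y hx hy
    have hR : ∀ z ∈ Metric.closedBall (0 : V) (max ‖x‖ ‖y‖), ‖z‖ < ρ := fun z hz =>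
      (mem_closedBall_zero_iff.1 hz).trans_lt (max_lt hx hy)
    refine (convex_closedBall (0 : V) (max ‖x‖ ‖y‖)).norm_image_sub_le_of_norm_fderiv_le (𝕜 := ℂ)
      (fun z hz => (hball (by rw [dist_zero_right]; exact hR z hz)).2) (fun z hz => ?_)
      (by simp) (by simp)
    refine (hball (by rw [dist_zero_right]; exact hR z hz)).1.trans ?_
    gcongr
    refine (mem_closedBall_zero_iff.1 hz).trans (max_le ?_ ?_) <;> linarith [norm_nonneg x, norm_nonneg y]
  have ht : Tendsto (fun σ : X => ‖σ‖) (𝓝 0) (𝓝 0) := tendsto_norm_zero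
  have hu0 := (hu.trans_tendsto ht).eventually (Metric.ball_mem_nhds _ hρ)
  have hv0 := (hv.trans_tendsto ht).eventually (Metric.ball_mem_nhds _ hρ)
  have h2 : (fun σ => g (u σ) - g (v σ)) =O[𝓝 0] fun σ => (‖u σ‖ + ‖v σ‖) * ‖u σ - v σ‖ := by
    refine IsBigO.of_bound C ?_
    filter_upwards [hu0, hv0] with σ h3 h4
    rw [dist_zero_right] at h3 h4
    rw [norm_mul, norm_norm, Real.norm_of_nonneg (by positivity : 0 ≤ ‖u σ‖ + ‖v σ‖), ← mul_assoc]
    exact hmv _ _ h3 h4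
  refine h2.trans ?_
  refine ((hu.norm_left.add hv.norm_left).mul huv.norm_left).congr_right fun σ => ?_
  rw [pow_succ, mul_comm]

lemma isBigO_comp_sub {X V : Type*} [NormedAddCommGroup X]
    [NormedAddCommGroup V] [NormedSpace ℂ V] {g : V → ℂ} {z : V} (hg : AnalyticAt ℂ g z)
    {u v : X → V} {r : X → ℝ} (hu : Tendsto u (𝓝 0) (𝓝 z))
    (hv : Tendsto v (𝓝 0) (𝓝 z)) (huv : (fun σ => u σ - v σ) =O[𝓝 0] r) :
    (fun σ => g (u σ) - g (v σ)) =O[𝓝 0] r :=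
  (hg.hasStrictFDerivAt.isBigO_sub.comp_tendsto (hu.prodMk_nhds hv)).trans huv

/-! The Taylor coefficients of the composition. -/

/-- The argument of the nonlinearity in `truncatedComp`. -/
def truncatedArg (n : ℕ) (lam : Fin d → ℂ) (x : MultiIndex d → ℂ) (k : ℕ) (σ : Fin d → ℂ) :
    C(HistoryInterval, ℂ) :=
  ∑ β ∈ indicesUpTo d k, monom σ β • x β • interp ℂ n (blowupVec n (pairing lam β))

lemma truncatedComp_eq (lam : Fin d → ℂ) (x : MultiIndex d → ℂ) (k : ℕ) (σ : Fin d → ℂ) :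
    truncatedComp n Gc lam x k σ = Gc (truncatedArg n lam x k σ) := by
  simp only [truncatedComp, truncatedArg, smul_smul, mul_comm]

lemma analyticAt_truncatedArg (lam : Fin d → ℂ) (x : MultiIndex d → ℂ) (k : ℕ) (σ : Fin d → ℂ) :
    AnalyticAt ℂ (truncatedArg n lam x k) σ :=
  Finset.analyticAt_fun_sum _ fun β _ => (analyticAt_monom β σ).smul analyticAt_const

lemma monom_zero_left {β : MultiIndex d} (h : β ≠ 0) : monom (0 : Fin d → ℂ) β = 0 := by
  obtain ⟨j, hj⟩ := Function.ne_iff.1 h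
  exact Finset.prod_eq_zero (Finset.mem_univ j) (by simpa using hj)

lemma truncatedArg_zero (lam : Fin d → ℂ) (x : MultiIndex d → ℂ) (k : ℕ) :
    truncatedArg n lam x k 0 = x 0 • interp ℂ n (blowupVec n 0) := by
  rw [truncatedArg, Finset.sum_eq_single 0]
  · simp
  · intro β _ hβ
    rw [monom_zero_left hβ, history_zero_smul]
  · intro h
    exact absurd (mem_indicesUpTo.2 (by simp)) h

lemma tendsto_truncatedArg (lam : Fin d → ℂ) (x : MultiIndex d → ℂ) (k : ℕ) :
    Tendsto (truncatedArg n lam x k) (𝓝 0) (𝓝 (x 0 • interp ℂ n (blowupVec n 0))) := by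
  rw [← truncatedArg_zero]
  exact (analyticAt_truncatedArg lam x k 0).continuousAt

lemma analyticAt_truncatedComp {lam : Fin d → ℂ} {x : MultiIndex d → ℂ}
    (hx : AnalyticAt ℂ Gc (x 0 • interp ℂ n (blowupVec n 0))) (k : ℕ) :
    AnalyticAt ℂ (truncatedComp n Gc lam x k) 0 := by
  have h1 : truncatedComp n Gc lam x k = fun σ => Gc (truncatedArg n lam x k σ) :=
    funext fun σ => truncatedComp_eq lam x k σ
  rw [h1]
  rw [← truncatedArg_zero lam x k] at hx
  exact hx.comp (analyticAt_truncatedArg lam x k 0)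

lemma isBigO_truncatedArg_sub (lam : Fin d → ℂ) (x : MultiIndex d → ℂ) {m k : ℕ} (h : m ≤ k) :
    (fun σ => truncatedArg n lam x k σ - truncatedArg n lam x m σ) =O[𝓝 0]
      fun σ => ‖σ‖ ^ (m + 1) := by
  have hsub : indicesUpTo d m ⊆ indicesUpTo d k := fun β hβ =>
    mem_indicesUpTo.2 ((mem_indicesUpTo.1 hβ).trans h)
  refine (isBigO_sum_monom (indicesUpTo d k \ indicesUpTo d m)
    (fun β => x β • interp ℂ n (blowupVec n (pairing lam β))) (m := m + 1) fun β hβ => ?_).congr_left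
      fun σ => ?_
  · left
    by_contra! h3
    exact (Finset.mem_sdiff.1 hβ).2 (mem_indicesUpTo.2 (by omega))
  · rw [truncatedArg, truncatedArg, ← Finset.sum_sdiff hsub, add_sub_cancel_right]

/-- Terms of order above m only affect the composition at order above m. This is what makes the
coefficient of σ^β independent of the truncation once k ≥ |β|. -/
lemma isBigO_truncatedComp_sub {lam : Fin d → ℂ} {x : MultiIndex d → ℂ}
    (hx : AnalyticAt ℂ Gc (x 0 • interp ℂ n (blowupVec n 0))) {m k : ℕ} (h : m ≤ k) :
    (fun σ => truncatedComp n Gc lam x k σ - truncatedComp n Gc lam x m σ) =O[𝓝 0]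
      fun σ => ‖σ‖ ^ (m + 1) := by
  simp only [truncatedComp_eq]
  exact isBigO_comp_sub hx (tendsto_truncatedArg lam x k) (tendsto_truncatedArg lam x m)
    (isBigO_truncatedArg_sub lam x h)

/-- `H_n(x)` is the only family of Taylor coefficients of the composition. -/
theorem hasTaylorUpTo_truncatedComp_iff {lam : Fin d → ℂ} {x : MultiIndex d → ℂ}
    (hx : AnalyticAt ℂ Gc (x 0 • interp ℂ n (blowupVec n 0))) (a : MultiIndex d → ℂ) :
    (∀ k, HasTaylorUpTo (truncatedComp n Gc lam x k) a k) ↔ a = Hn n Gc lam x := by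
  constructor
  · intro h
    funext β
    exact ((h β.order).taylorCoeff_eq (analyticAt_truncatedComp hx _) le_rfl).symm
  · rintro rfl k
    obtain ⟨b, hb⟩ := exists_hasTaylorUpTo (analyticAt_truncatedComp (lam := lam) hx k)
    refine (hb k).congr_coeff fun β hβ => ?_
    refine (HasTaylorUpTo.taylorCoeff_eq (k := β.order) (analyticAt_truncatedComp hx _) ?_ le_rfl).symm
    refine (hb β.order).congr_isBigO ?_
    refine (isBigO_truncatedComp_sub (lam := lam) hx hβ).neg_left.congr_left fun σ => ?_
    ring

lemma hasTaylorUpTo_Hn {lam : Fin d → ℂ} {x : MultiIndex d → ℂ}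
    (hx : AnalyticAt ℂ Gc (x 0 • interp ℂ n (blowupVec n 0))) (k : ℕ) :
    HasTaylorUpTo (truncatedComp n Gc lam x k) (Hn n Gc lam x) k :=
  (hasTaylorUpTo_truncatedComp_iff hx _).2 rfl k

lemma isBigO_truncatedArg (lam : Fin d → ℂ) {x : MultiIndex d → ℂ} (hx : x 0 = 0) (k : ℕ) :
    truncatedArg n lam x k =O[𝓝 0] fun σ => ‖σ‖ := by
  have := isBigO_sum_monom (indicesUpTo d k)
    (fun β => x β • interp ℂ n (blowupVec n (pairing lam β))) (m := 1) fun β _ => by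
      rcases Nat.eq_zero_or_pos β.order with h | h
      · right
        rw [eq_zero_of_order_eq_zero h, hx, history_zero_smul]
      · exact Or.inl h
  exact this.congr_right fun σ => pow_one _

/-- Since `G` is flat at `0`, `H_n(x)_β` only depends on the coefficients of order below `|β|`. -/
lemma Hn_congr (hGc : AnalyticAt ℂ Gc 0) (hG1 : fderiv ℂ Gc 0 = 0) {lam : Fin d → ℂ}
    {x y : MultiIndex d → ℂ} (hx : x 0 = 0) (hy : y 0 = 0) {β : MultiIndex d}
    (hxy : ∀ γ : MultiIndex d, γ.order < β.order → x γ = y γ) : Hn n Gc lam x β = Hn n Gc lam y β := by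
  have hxa : AnalyticAt ℂ Gc (x 0 • interp ℂ n (blowupVec n 0)) := by rwa [hx, history_zero_smul]
  have hya : AnalyticAt ℂ Gc (y 0 • interp ℂ n (blowupVec n 0)) := by rwa [hy, history_zero_smul]
  set k := β.order with hk
  refine HasTaylorUpTo.taylorCoeff_eq (analyticAt_truncatedComp hxa k) (k := k) ?_ le_rfl
  refine (hasTaylorUpTo_Hn hya k).congr_isBigO ?_
  simp only [truncatedComp_eq]
  -- The two arguments agree below order k and so differ by O(‖σ‖^k); the vanishing derivative of
  -- the nonlinearity raises this to k + 1.
  refine isBigO_comp_sub_of_fderiv_eq_zero hGc hG1 (isBigO_truncatedArg lam hx k)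
    (isBigO_truncatedArg lam hy k) ?_
  refine (isBigO_sum_monom (indicesUpTo d k)
    (fun β => (x β - y β) • interp ℂ n (blowupVec n (pairing lam β))) (m := k) fun γ _ => ?_).congr_left
      fun σ => ?_
  · by_cases h : k ≤ γ.order
    · exact Or.inl h
    · right
      rw [hxy γ (not_le.1 h), sub_self, history_zero_smul]
  · simp only [truncatedArg, ← Finset.sum_sub_distrib, history_sub_smul, history_smul_sub]

lemma Hn_zero (hGc : AnalyticAt ℂ Gc 0) (hG0 : Gc 0 = 0) (lam : Fin d → ℂ) :
    Hn n Gc lam 0 = 0 := by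
  refine ((hasTaylorUpTo_truncatedComp_iff (by rwa [Pi.zero_apply, history_zero_smul]) 0).1 fun k => ?_).symm
  refine (isBigO_zero (E' := ℂ) _ _).congr_left fun σ => ?_
  simp [truncatedComp, hG0, history_zero_smul]

lemma Hn_eq_zero_of_order_le_one (hGc : AnalyticAt ℂ Gc 0) (hG0 : Gc 0 = 0)
    (hG1 : fderiv ℂ Gc 0 = 0) {lam : Fin d → ℂ} {x : MultiIndex d → ℂ} (hx : x 0 = 0)
    {β : MultiIndex d} (hβ : β.order ≤ 1) : Hn n Gc lam x β = 0 := by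
  rw [Hn_congr (y := 0) hGc hG1 hx rfl, Hn_zero hGc hG0]
  · rfl
  · intro γ hγ
    rw [eq_zero_of_order_eq_zero (by omega : γ.order = 0), hx]
    rfl

end Pseudospectral

/-! ### Zeros of F_n solve the invariance equation -/

section Expansion

open Asymptotics

variable {n d : ℕ} {L : C(HistoryInterval, ℝ) →L[ℝ] ℝ} {Gc : C(HistoryInterval, ℂ) → ℂ}
  {lam : Fin d → ℂ} {ξ p : MultiIndex d → ℂ}

/-- The interpolation operator as a continuous linear map. -/
def interpCLM (n : ℕ) : State ℂ n →L[ℂ] C(HistoryInterval, ℂ) :=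
  (interp ℂ n).toContinuousLinearMap

/-- `𝒜_n` as a continuous linear map. -/
def linearCLM (n : ℕ) (L : C(HistoryInterval, ℝ) →L[ℝ] ℝ) : State ℂ n →L[ℂ] State ℂ n :=
  LinearMap.toContinuousLinearMap (complexLinear n L : State ℂ n →ₗ[ℂ] State ℂ n)

/-- The vector field of the complexified ODE. -/
abbrev complexField (n : ℕ) (L : C(HistoryInterval, ℝ) →L[ℝ] ℝ) (Gc : C(HistoryInterval, ℂ) → ℂ) :
    State ℂ n → State ℂ n :=
  psField n (complexify (L : C(HistoryInterval, ℝ) →ₗ[ℝ] ℝ)) Gc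

lemma complexField_eq : complexField n L Gc = fun y => linearCLM n L y +
    ContinuousLinearMap.inl ℂ ℂ (Fin n → ℂ) (Gc (interpCLM n y)) := rfl

lemma analyticAt_complexField {y : State ℂ n} (h : AnalyticAt ℂ Gc (interp ℂ n y)) :
    AnalyticAt ℂ (complexField n L Gc) y := by
  rw [complexField_eq]
  have h1 : AnalyticAt ℂ (fun y => Gc (interpCLM n y)) y :=
    AnalyticAt.comp (g := Gc) (f := interpCLM n) h ((interpCLM n).analyticAt y)
  exact ((linearCLM n L).analyticAt y).add
    (((ContinuousLinearMap.inl ℂ ℂ (Fin n → ℂ)).analyticAt _).comp h1)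

lemma hasFDerivAt_complexField (h : AnalyticAt ℂ Gc 0) (h1 : fderiv ℂ Gc 0 = 0) :
    HasFDerivAt (complexField n L Gc) (linearCLM n L) 0 := by
  rw [complexField_eq]
  have h2 : HasFDerivAt Gc (0 : C(HistoryInterval, ℂ) →L[ℂ] ℂ) (interpCLM n 0) := by
    rw [map_zero, ← h1]
    exact h.differentiableAt.hasFDerivAt
  have h3 := (ContinuousLinearMap.inl ℂ ℂ (Fin n → ℂ)).hasFDerivAt.comp (0 : State ℂ n)
    (h2.comp (0 : State ℂ n) (interpCLM n).hasFDerivAt)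
  have h4 := (linearCLM n L).hasFDerivAt.add h3
  rw [ContinuousLinearMap.zero_comp, ContinuousLinearMap.comp_zero, add_zero] at h4
  exact h4

/-- The hypotheses under which a zero `p` of `F_n` expands an unstable manifold of the
complexified ODE. -/
structure IsUnstableExpansion (n : ℕ) {d : ℕ} (L : C(HistoryInterval, ℝ) →L[ℝ] ℝ)
    (Gc : C(HistoryInterval, ℂ) → ℂ) (lam : Fin d → ℂ) (ξ p : MultiIndex d → ℂ) : Prop where
  injective : Function.Injective lam
  roots : Multiset.filter (fun z : ℂ => 0 < z.re) (complexLinear n L).charpoly.roots =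
    Multiset.map lam Finset.univ.val
  nonresonant : ∀ β : MultiIndex d, 2 ≤ β.order →
    pairing lam β ∉ spectrum ℂ (complexLinear n L)
  notMem : ∀ β : MultiIndex d, 1 ≤ β.order → pairing lam β ∉ spectrum ℂ (diffMatrixOver ℂ n)
  scalar_ne_zero : ∀ β : MultiIndex d, β.order = 1 → ξ β ≠ 0
  analyticAt : AnalyticAt ℂ Gc 0
  map_zero : Gc 0 = 0
  fderiv_zero : fderiv ℂ Gc 0 = 0
  Fn_eq_zero : Fn n L Gc lam ξ p = 0
  summable : Summable fun β => ‖p β‖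

namespace IsUnstableExpansion

lemma mem_roots (h : IsUnstableExpansion n L Gc lam ξ p) (j : Fin d) :
    lam j ∈ (complexLinear n L).charpoly.roots ∧ 0 < (lam j).re := by
  have : lam j ∈ Multiset.map lam Finset.univ.val :=
    Multiset.mem_map_of_mem lam (Finset.mem_univ_val j)
  rw [← h.roots] at this
  exact Multiset.mem_filter.1 this

lemma exists_eq_of_hasEigenvalue (h : IsUnstableExpansion n L Gc lam ξ p) {μ : ℂ}
    (hμ : (complexLinear n L).HasEigenvalue μ) (hre : 0 < μ.re) : ∃ j, lam j = μ := by
  have : μ ∈ Multiset.map lam Finset.univ.val := by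
    rw [← h.roots, Multiset.mem_filter]
    refine ⟨?_, hre⟩
    rw [Polynomial.mem_roots (LinearMap.charpoly_monic _).ne_zero]
    exact (Module.End.hasEigenvalue_iff_isRoot_charpoly _ μ).1 hμ
  obtain ⟨j, -, hj⟩ := Multiset.mem_map.1 this
  exact ⟨j, hj⟩

lemma re_pos (h : IsUnstableExpansion n L Gc lam ξ p) (j : Fin d) : 0 < (lam j).re :=
  (h.mem_roots j).2

lemma hasEigenvalue (h : IsUnstableExpansion n L Gc lam ξ p) (j : Fin d) :
    (complexLinear n L).HasEigenvalue (lam j) :=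
  (Module.End.hasEigenvalue_iff_isRoot_charpoly _ _).2 (Polynomial.isRoot_of_mem_roots (h.mem_roots j).1)

lemma charFun_eq_zero (h : IsUnstableExpansion n L Gc lam ξ p) (j : Fin d) :
    charFun n L (lam j) = 0 := by
  refine PseudospectralDDE.charFun_eq_zero ?_ (h.hasEigenvalue j)
  simpa using h.notMem (Pi.single j 1) (by simp)

lemma hasEigenvector (h : IsUnstableExpansion n L Gc lam ξ p) (j : Fin d) :
    (complexLinear n L).HasEigenvector (lam j) (blowupVec n (lam j)) := by
  refine hasEigenvector_blowupVec ?_ (h.charFun_eq_zero j)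
  simpa using h.notMem (Pi.single j 1) (by simp)

lemma charFun_ne_zero (h : IsUnstableExpansion n L Gc lam ξ p) {β : MultiIndex d}
    (hβ : 2 ≤ β.order) : charFun n L (pairing lam β) ≠ 0 := fun h0 =>
  h.nonresonant β hβ (Module.End.hasEigenvalue_iff_mem_spectrum.1
    (Module.End.hasEigenvalue_of_hasEigenvector
      (hasEigenvector_blowupVec (h.notMem β (by omega)) h0)))

lemma coeff_zero (h : IsUnstableExpansion n L Gc lam ξ p) : p 0 = 0 := by
  simpa [Fn] using congrFun h.Fn_eq_zero 0

lemma coeff_single (h : IsUnstableExpansion n L Gc lam ξ p) (j : Fin d) :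
    p (Pi.single j 1) = ξ (Pi.single j 1) := by
  have := congrFun h.Fn_eq_zero (Pi.single j 1)
  rw [Fn, if_neg (by simp), if_pos (by simp)] at this
  exact sub_eq_zero.1 this

/-- At order one F_n only normalizes the coefficient, but the scalar equation still holds since both
sides vanish: λ_j is a root of Δ_n and G has no linear part. -/
lemma charFun_mul_coeff (h : IsUnstableExpansion n L Gc lam ξ p) {β : MultiIndex d}
    (hβ : 1 ≤ β.order) : p β * charFun n L (pairing lam β) = Hn n Gc lam p β := by
  rcases hβ.eq_or_lt with h1 | h2
  · rw [Hn_eq_zero_of_order_le_one h.analyticAt h.map_zero h.fderiv_zero h.coeff_zero h1.ge]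
    obtain ⟨j, rfl⟩ := exists_eq_single_of_order_eq_one h1.symm
    rw [pairing_single, h.charFun_eq_zero, mul_zero]
  · have := congrFun h.Fn_eq_zero β
    rw [Fn, if_neg (by omega), if_neg (by omega)] at this
    rw [mul_comm]
    exact sub_eq_zero.1 this

/-- The coefficients satisfy the homological equation. -/
lemma homological (h : IsUnstableExpansion n L Gc lam ξ p) (β : MultiIndex d) :
    pairing lam β • p β • blowupVec n (pairing lam β) -
      linearCLM n L (p β • blowupVec n (pairing lam β)) = (Hn n Gc lam p β, 0) := by
  rcases Nat.eq_zero_or_pos β.order with h0 | h1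
  -- The spectral condition on D starts at order one; at order zero the coefficient itself is zero.
  · obtain rfl := eq_zero_of_order_eq_zero h0
    rw [h.coeff_zero, zero_smul, _root_.map_zero, smul_zero, sub_zero,
      Hn_eq_zero_of_order_le_one h.analyticAt h.map_zero h.fderiv_zero h.coeff_zero (by simp)]
    rfl
  · have h2 : linearCLM n L (blowupVec n (pairing lam β)) = _ :=
      psLinear_blowupVec (L := L) (h.notMem β h1)
    rw [_root_.map_smul, h2, smul_sub, smul_comm, sub_sub_cancel, ← h.charFun_mul_coeff h1]
    simp

lemma summable_coeff (h : IsUnstableExpansion n L Gc lam ξ p) :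
    Summable fun β => ‖p β • blowupVec n (pairing lam β)‖ :=
  summable_smul_blowupVec h.re_pos h.notMem h.summable

lemma Pn_eq : Pn n lam p = fun σ => ∑' β, monom σ β • p β • blowupVec n (pairing lam β) := by
  funext σ
  simp only [Pn, smul_smul, mul_comm]

lemma summable_Pn (h : IsUnstableExpansion n L Gc lam ξ p) {σ : Fin d → ℂ} (hσ : ‖σ‖ ≤ 1) :
    Summable fun β => ‖(p β * monom σ β) • blowupVec n (pairing lam β)‖ := by
  have := summable_monom_smul h.summable_coeff hσ
  simpa only [smul_smul, mul_comm] using this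

lemma analyticOnNhd_Pn (h : IsUnstableExpansion n L Gc lam ξ p) :
    AnalyticOnNhd ℂ (Pn n lam p) (Metric.ball 0 1) := by
  rw [Pn_eq]
  exact analyticOnNhd_tsum_monom h.summable_coeff

lemma Pn_zero (h : IsUnstableExpansion n L Gc lam ξ p) : Pn n lam p 0 = 0 := by
  rw [Pn_eq]
  refine (tsum_congr fun β => ?_).trans tsum_zero
  by_cases hβ : β = 0
  · rw [hβ, h.coeff_zero, zero_smul, smul_zero]
  · rw [monom_zero_left hβ, zero_smul]

lemma tendsto_Pn (h : IsUnstableExpansion n L Gc lam ξ p) : Tendsto (Pn n lam p) (𝓝 0) (𝓝 0) := by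
  have := (h.analyticOnNhd_Pn 0 (Metric.mem_ball_self one_pos)).continuousAt.tendsto
  rwa [h.Pn_zero] at this

/-- The linear part of `P_n`. -/
def tangent (n : ℕ) {d : ℕ} (lam : Fin d → ℂ) (ξ : MultiIndex d → ℂ) :
    (Fin d → ℂ) →L[ℂ] State ℂ n :=
  ∑ j, (ContinuousLinearMap.proj j : (Fin d → ℂ) →L[ℂ] ℂ).smulRight
    (ξ (Pi.single j 1) • blowupVec n (lam j))

lemma tangent_apply (σ : Fin d → ℂ) :
    tangent n lam ξ σ = ∑ j, σ j • ξ (Pi.single j 1) • blowupVec n (lam j) := by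
  simp [tangent]

lemma hasFDerivAt_Pn_zero (h : IsUnstableExpansion n L Gc lam ξ p) :
    HasFDerivAt (Pn n lam p) (tangent n lam ξ) 0 := by
  have h1 := isBigO_tsum_sub_sum h.summable_coeff 1
  have h2 : (fun σ => Pn n lam p σ - tangent n lam ξ σ) =O[𝓝 0]
      fun σ => ‖σ - 0‖ ^ 2 := by
    refine (h1.congr_left fun σ => ?_).congr_right fun σ => by rw [sub_zero]
    rw [sum_indicesUpTo_one, h.coeff_zero, zero_smul, smul_zero, zero_add, Pn_eq, tangent_apply]
    simp only [monom_single, h.coeff_single, pairing_single]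
  have h3 := (h2.hasFDerivAt one_lt_two).add (tangent n lam ξ).hasFDerivAt
  rw [zero_add] at h3
  exact h3.congr_of_eventuallyEq (Eventually.of_forall fun σ => by simp)

lemma linearIndependent (h : IsUnstableExpansion n L Gc lam ξ p) :
    LinearIndependent ℂ fun j => blowupVec n (lam j) :=
  Module.End.eigenvectors_linearIndependent' _ lam h.injective _ h.hasEigenvector

lemma xi_single_ne_zero (h : IsUnstableExpansion n L Gc lam ξ p) (j : Fin d) :
    ξ (Pi.single j 1) ≠ 0 := h.scalar_ne_zero _ (by simp)

lemma tangent_injective (h : IsUnstableExpansion n L Gc lam ξ p) :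
    Function.Injective (tangent n lam ξ) := by
  rw [injective_iff_map_eq_zero]
  intro σ hσ
  rw [tangent_apply] at hσ
  simp only [smul_smul] at hσ
  funext j
  have := Fintype.linearIndependent_iff.1 h.linearIndependent _ hσ j
  exact (mul_eq_zero.1 this).resolve_right (h.xi_single_ne_zero j)

lemma mem_range_tangent_iff (h : IsUnstableExpansion n L Gc lam ξ p) (y : State ℂ n) :
    (∃ σ, tangent n lam ξ σ = y) ↔ y ∈ Submodule.span ℂ (Set.range fun j => blowupVec n (lam j)) := by
  rw [Submodule.mem_span_range_iff_exists_fun]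
  constructor
  · rintro ⟨σ, rfl⟩
    exact ⟨fun j => σ j * ξ (Pi.single j 1), by rw [tangent_apply]; simp only [smul_smul]⟩
  · rintro ⟨c, rfl⟩
    refine ⟨fun j => c j * (ξ (Pi.single j 1))⁻¹, ?_⟩
    rw [tangent_apply]
    refine Finset.sum_congr rfl fun j _ => ?_
    rw [smul_smul, mul_assoc, inv_mul_cancel₀ (h.xi_single_ne_zero j), mul_one]

/-- The series differs from its truncation by O(‖σ‖^{k+1}), and the analytic nonlinearity preserves
that order, so the full composition has the coefficients H_n(p). -/
lemma isBigO_comp_Pn (h : IsUnstableExpansion n L Gc lam ξ p) (k : ℕ) :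
    HasTaylorUpTo (fun σ => Gc (interp ℂ n (Pn n lam p σ))) (Hn n Gc lam p) k := by
  have h0 : (p 0 • interp ℂ n (blowupVec n 0)) = 0 := by rw [h.coeff_zero, history_zero_smul]
  refine (hasTaylorUpTo_Hn (by rw [h0]; exact h.analyticAt) k).congr_isBigO ?_
  simp only [truncatedComp_eq]
  have ht : Tendsto (fun σ => interp ℂ n (Pn n lam p σ)) (𝓝 0) (𝓝 0) := by
    have := (interpCLM n).continuous.continuousAt.tendsto.comp h.tendsto_Pn
    rwa [_root_.map_zero] at this
  refine isBigO_comp_sub h.analyticAt ht (h0 ▸ tendsto_truncatedArg lam p k) ?_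
  refine (((interpCLM n).isBigO_comp _ _).trans (isBigO_tsum_sub_sum h.summable_coeff k)).congr_left
    fun σ => ?_
  rw [map_sub, map_sum, Pn_eq, truncatedArg]
  congr 1
  refine Finset.sum_congr rfl fun β _ => ?_
  rw [map_smul, map_smul]
  rfl

/-- The invariance equation. -/
theorem invariant (h : IsUnstableExpansion n L Gc lam ξ p) {σ : Fin d → ℂ}
    (hσ : σ ∈ Metric.ball (0 : Fin d → ℂ) 1)
    (hG : ∀ s ∈ Set.Icc (0 : ℝ) 1, AnalyticAt ℂ Gc (interp ℂ n (Pn n lam p (s • σ)))) :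
    fderiv ℂ (Pn n lam p) σ (fun j => lam j * σ j) = complexField n L Gc (Pn n lam p σ) := by
  rw [← sub_eq_zero]
  refine eq_zero_of_flat (Φ := fun σ => fderiv ℂ (Pn n lam p) σ (fun j => lam j * σ j) -
    complexField n L Gc (Pn n lam p σ)) (fun s hs => ?_) fun k => ?_
  · have hsσ : s • σ ∈ Metric.ball (0 : Fin d → ℂ) 1 := by
      rw [mem_ball_zero_iff] at hσ ⊢
      rw [norm_smul, Real.norm_of_nonneg hs.1]
      exact (mul_le_of_le_one_left (norm_nonneg _) hs.2).trans_lt hσ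
    have h1 := h.analyticOnNhd_Pn _ hsσ
    have h2 : AnalyticAt ℂ (fun σ : Fin d → ℂ => (fun j => lam j * σ j : Fin d → ℂ)) (s • σ) :=
      (ContinuousLinearMap.pi fun j => lam j •
        (ContinuousLinearMap.proj j : (Fin d → ℂ) →L[ℂ] ℂ)).analyticAt _
    have h3 : AnalyticAt ℂ (fun σ : Fin d → ℂ => fderiv ℂ (Pn n lam p) σ (fun j => lam j * σ j))
        (s • σ) :=
      AnalyticAt.comp (g := fun q : ((Fin d → ℂ) →L[ℂ] State ℂ n) × (Fin d → ℂ) => q.1 q.2)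
        ((ContinuousLinearMap.id ℂ ((Fin d → ℂ) →L[ℂ] State ℂ n)).analyticAt_bilinear _)
        (h1.fderiv.prod h2)
    exact (h3.sub ((analyticAt_complexField (hG s hs)).comp h1)).restrictScalars
  · set c : MultiIndex d → State ℂ n := fun β => p β • blowupVec n (pairing lam β) with hc
    -- All three parts of the defect are compared with their polynomials of degree k + 1. These
    -- cancel by the homological equations, so only remainders are left.
    have h1 := isBigO_fderiv_tsum_sub_sum h.summable_coeff lam k
    have h2 := ((linearCLM n L).isBigO_comp _ _).trans (isBigO_tsum_sub_sum h.summable_coeff (k + 1))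
    have h3 : (fun σ : Fin d → ℂ => ContinuousLinearMap.inl ℂ ℂ (Fin n → ℂ)
        (Gc (interp ℂ n (Pn n lam p σ)) - ∑ β ∈ indicesUpTo d (k + 1), Hn n Gc lam p β * monom σ β))
        =O[𝓝 0] fun σ => ‖σ‖ ^ (k + 1 + 1) :=
      ((ContinuousLinearMap.inl ℂ ℂ (Fin n → ℂ)).isBigO_comp _ _).trans (h.isBigO_comp_Pn (k + 1))
    have h4 := (h1.trans (isBigO_norm_pow_of_le (by omega : k ≤ k + 1))).sub
      ((h2.add h3).trans (isBigO_norm_pow_of_le (by omega : k ≤ k + 1 + 1)))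
    refine h4.congr_left fun σ => ?_
    have h5 : ∑ β ∈ indicesUpTo d (k + 1), monom σ β • pairing lam β • c β =
        linearCLM n L (∑ β ∈ indicesUpTo d (k + 1), monom σ β • c β) +
        ContinuousLinearMap.inl ℂ ℂ (Fin n → ℂ)
          (∑ β ∈ indicesUpTo d (k + 1), Hn n Gc lam p β * monom σ β) := by
      rw [map_sum, map_sum, ← Finset.sum_add_distrib]
      refine Finset.sum_congr rfl fun β _ => ?_
      have h6 := h.homological β
      rw [sub_eq_iff_eq_add] at h6
      rw [hc]
      dsimp only
      rw [h6, smul_add, add_comm]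
      exact congrArg₂ (· + ·) ((linearCLM n L).map_smul _ _).symm
        (Prod.ext (mul_comm _ _) (smul_zero _))
    rw [h5, complexField_eq, map_sub, map_sub, ← Pn_eq (n := n) (lam := lam) (p := p)]
    change _ = fderiv ℂ (Pn n lam p) σ (fun j => lam j * σ j) - (linearCLM n L (Pn n lam p σ) +
      ContinuousLinearMap.inl ℂ ℂ (Fin n → ℂ) (Gc (interp ℂ n (Pn n lam p σ))))
    rw [congrFun Pn_eq σ]
    abel

end IsUnstableExpansion
end Expansion

/-! ### The unstable manifold of the complexified ODE -/

section ComplexManifold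

variable {n d : ℕ} {L : C(HistoryInterval, ℝ) →L[ℝ] ℝ} {Gc : C(HistoryInterval, ℂ) → ℂ}
  {lam : Fin d → ℂ} {ξ p : MultiIndex d → ℂ}

/-- The diagonal operator with entries `c`, as a real linear map. -/
def diagMap (c : Fin d → ℂ) : (Fin d → ℂ) →L[ℝ] (Fin d → ℂ) :=
  (ContinuousLinearMap.pi fun j => c j •
    (ContinuousLinearMap.proj j : (Fin d → ℂ) →L[ℂ] ℂ) :
      (Fin d → ℂ) →L[ℂ] (Fin d → ℂ)).restrictScalars ℝ

lemma diagMap_apply (c σ : Fin d → ℂ) : diagMap c σ = fun j => c j * σ j := rfl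

/-- The linear flow `exp (t Λ)`. -/
def diagFlow (lam : Fin d → ℂ) (t : ℝ) : (Fin d → ℂ) →L[ℝ] (Fin d → ℂ) :=
  diagMap fun j => Complex.exp (lam j * t)

lemma diagFlow_apply (lam : Fin d → ℂ) (t : ℝ) (σ : Fin d → ℂ) :
    diagFlow lam t σ = fun j => Complex.exp (lam j * t) * σ j := rfl

lemma diagFlow_zero (lam σ : Fin d → ℂ) : diagFlow lam 0 σ = σ := by
  simp [diagFlow_apply]

lemma diagFlow_add (lam : Fin d → ℂ) (s t : ℝ) (σ : Fin d → ℂ) :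
    diagFlow lam (s + t) σ = diagFlow lam s (diagFlow lam t σ) := by
  funext j
  simp only [diagFlow_apply]
  rw [← mul_assoc, ← Complex.exp_add]
  push_cast
  ring_nf

lemma hasDerivAt_diagFlow (lam σ : Fin d → ℂ) (t : ℝ) :
    HasDerivAt (fun s => diagFlow lam s σ) (diagMap lam (diagFlow lam t σ)) t := by
  rw [hasDerivAt_pi]
  intro j
  simp only [diagFlow_apply, diagMap_apply]
  have h1 : HasDerivAt (fun s : ℝ => (s : ℂ)) 1 t := Complex.ofRealCLM.hasDerivAt
  have h2 := (((h1.const_mul (lam j)).cexp).mul_const (σ j))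
  convert! h2 using 1
  ring

lemma norm_diagFlow_le {a : ℝ} (h : ∀ j, a ≤ (lam j).re) {t : ℝ} (ht : t ≤ 0) (σ : Fin d → ℂ) :
    ‖diagFlow lam t σ‖ ≤ Real.exp (a * t) * ‖σ‖ := by
  refine (pi_norm_le_iff_of_nonneg (by positivity)).2 fun j => ?_
  rw [diagFlow_apply, norm_mul, Complex.norm_exp, Complex.re_mul_ofReal]
  exact mul_le_mul (Real.exp_le_exp.2 (mul_le_mul_of_nonpos_right (h j) ht)) (norm_le_pi_norm σ j)
    (norm_nonneg _) (Real.exp_pos _).le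

namespace IsUnstableExpansion

lemma fderiv_real_Pn (h : IsUnstableExpansion n L Gc lam ξ p) {σ : Fin d → ℂ}
    (hσ : σ ∈ Metric.ball (0 : Fin d → ℂ) 1) :
    fderiv ℝ (Pn n lam p) σ = (fderiv ℂ (Pn n lam p) σ).restrictScalars ℝ :=
  (h.analyticOnNhd_Pn σ hσ).differentiableAt.fderiv_restrictScalars ℝ

lemma fderiv_real_Pn_zero (h : IsUnstableExpansion n L Gc lam ξ p) :
    fderiv ℝ (Pn n lam p) 0 = (tangent n lam ξ).restrictScalars ℝ :=
  (h.hasFDerivAt_Pn_zero.restrictScalars ℝ).fderiv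

lemma fderiv_real_complexField (h : IsUnstableExpansion n L Gc lam ξ p) :
    fderiv ℝ (complexField n L Gc) 0 = (linearCLM n L).restrictScalars ℝ :=
  ((hasFDerivAt_complexField h.analyticAt h.fderiv_zero).restrictScalars ℝ).fderiv

lemma smul_mem_ball {X : Type*} [NormedAddCommGroup X] [NormedSpace ℝ X] {σ : X} {r s : ℝ}
    (hσ : σ ∈ Metric.ball (0 : X) r) (hs : s ∈ Set.Icc (0 : ℝ) 1) :
    s • σ ∈ Metric.ball (0 : X) r := by
  rw [mem_ball_zero_iff] at hσ ⊢
  rw [norm_smul, Real.norm_of_nonneg hs.1]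
  exact (mul_le_of_le_one_left (norm_nonneg _) hs.2).trans_lt hσ

lemma isUnstableConjugacy (h : IsUnstableExpansion n L Gc lam ξ p) {r a : ℝ} (hr : 0 < r)
    (hr1 : r ≤ 1) (ha : 0 < a) (hlow : ∀ j, a ≤ (lam j).re)
    (hG : ∀ σ ∈ Metric.ball (0 : Fin d → ℂ) r, AnalyticAt ℂ Gc (interp ℂ n (Pn n lam p σ))) :
    IsUnstableConjugacy (complexField n L Gc) r a (diagMap lam) (diagFlow lam) (Pn n lam p) := by
  have hsub : Metric.ball (0 : Fin d → ℂ) r ⊆ Metric.ball 0 1 := Metric.ball_subset_ball hr1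
  refine ⟨hr, ha, diagFlow_zero lam, diagFlow_add lam, hasDerivAt_diagFlow lam,
    fun t ht => norm_diagFlow_le hlow ht, fun σ hσ => (h.analyticOnNhd_Pn σ (hsub hσ)).restrictScalars,
    h.Pn_zero, ?_, fun σ hσ => ?_, fun σ hσ => ?_⟩
  · rw [h.fderiv_real_Pn_zero]
    exact h.tangent_injective
  · exact (analyticAt_complexField (hG σ hσ)).restrictScalars.contDiffAt
  · rw [h.fderiv_real_Pn (hsub hσ)]
    exact h.invariant (hsub hσ) fun s hs => hG _ (smul_mem_ball hσ hs)

/-- The real part of the complex inner product is a real inner product, and the range of the tangent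
map is the unstable eigenspace because all ξ_j are nonzero. -/
lemma exists_transverse (h : IsUnstableExpansion n L Gc lam ξ p) {η : ℝ} (hη : 0 < η) :
    ∃ (H : Type) (_ : NormedAddCommGroup H) (_ : InnerProductSpace ℝ H)
      (B : State ℂ n →ₗ[ℝ] H), (∀ y, B y = 0 ↔ ∃ σ, tangent n lam ξ σ = y) ∧
        ∀ y, inner ℝ (B y) (B (linearCLM n L y)) ≤ η * ‖B y‖ ^ 2 := by
  obtain ⟨H, _, _, B, hker, hB⟩ := exists_transverse_form h.injective h.roots h.hasEigenvector hη
  let _ : InnerProductSpace ℝ H := InnerProductSpace.complexToReal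
  refine ⟨H, inferInstance, inferInstance,
    { toFun := B, map_add' := B.map_add, map_smul' := fun c y => B.map_smul (c : ℂ) y }, ?_, ?_⟩
  · intro y
    exact (hker y).trans (h.mem_range_tangent_iff y).symm
  · exact hB

/-- The dynamical statements come from the underlying real system. Complex analyticity is that of
the series, and the real derivative is the complex one with scalars restricted, so the immersion
property transfers. -/
theorem parametrizes_complex (h : IsUnstableExpansion n L Gc lam ξ p) {r : ℝ} (hr : 0 < r)
    (hr1 : r ≤ 1)
    (hG : ∀ σ ∈ Metric.ball (0 : Fin d → ℂ) r, AnalyticAt ℂ Gc (interp ℂ n (Pn n lam p σ))) :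
    ParametrizesLocalUnstableManifold ℂ (complexField n L Gc) (Metric.ball 0 r) (Pn n lam p) := by
  obtain ⟨a, ha, hlow⟩ := exists_re_lower_bound lam h.re_pos
  have hsub : Metric.ball (0 : Fin d → ℂ) r ⊆ Metric.ball 0 1 := Metric.ball_subset_ball hr1
  have hreal := (h.isUnstableConjugacy hr hr1 ha hlow hG).parametrizes fun η hη => by
    obtain ⟨H, i1, i2, B, hker, hB⟩ := h.exists_transverse hη
    refine ⟨H, i1, i2, B, fun y => ?_, fun y => ?_⟩
    · rw [hker, h.fderiv_real_Pn_zero]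
      rfl
    · rw [h.fderiv_real_complexField]
      exact hB y
  refine ⟨hreal.isOpen, hreal.zero_mem, hreal.map_zero, h.analyticOnNhd_Pn.mono hsub,
    fun σ hσ => ?_, hreal.embedding, hreal.backward_orbit, hreal.contains_local_unstable_set⟩
  have := hreal.immersion σ hσ
  rwa [h.fderiv_real_Pn (hsub hσ)] at this

end IsUnstableExpansion
end ComplexManifold

/-! ### Complex conjugation on states, nonlinearity and Taylor coefficients -/

section Conjugation

open Asymptotics

variable {n d : ℕ} {L : C(HistoryInterval, ℝ) →L[ℝ] ℝ}

lemma star_interp (y : State ℂ n) : interp ℂ n (star y) = star (interp ℂ n y) := by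
  ext θ
  simp [interp, lagrangeFun]

lemma complexify_star (φ : C(HistoryInterval, ℂ)) :
    complexify (L : C(HistoryInterval, ℝ) →ₗ[ℝ] ℝ) (star φ) =
      star (complexify (L : C(HistoryInterval, ℝ) →ₗ[ℝ] ℝ) φ) := by
  have h1 : reFun (star φ) = reFun φ := by ext; simp [reFun]
  have h2 : imFun (star φ) = -imFun φ := by ext; simp [imFun]
  change ((L (reFun (star φ)) : ℝ) : ℂ) + Complex.I * (L (imFun (star φ)) : ℂ) =
    star ((L (reFun φ) : ℂ) + Complex.I * (L (imFun φ) : ℂ))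
  rw [h1, h2, map_neg]
  simp

lemma conj_mulVec (M : Matrix (Fin n) (Fin n) ℂ) (v : Fin n → ℂ) :
    (M.map star).mulVec (star v) = star (M.mulVec v) := by
  funext i
  simp [Matrix.mulVec, dotProduct]

lemma conj_diffMatrixOver : (diffMatrixOver ℂ n).map star = diffMatrixOver ℂ n := by
  ext i j
  simp [diffMatrixOver]

lemma diffMatrixOver_mulVec_star (v : Fin n → ℂ) :
    (diffMatrixOver ℂ n).mulVec (star v) = star ((diffMatrixOver ℂ n).mulVec v) := by
  rw [← conj_mulVec, conj_diffMatrixOver]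

lemma complexLinear_star (y : State ℂ n) : complexLinear n L (star y) = star (complexLinear n L y) := by
  refine Prod.ext ?_ ?_
  · change complexify (L : C(HistoryInterval, ℝ) →ₗ[ℝ] ℝ) (interp ℂ n (star y)) = _
    rw [star_interp, complexify_star]
    rfl
  · change -(star y.1 • (diffMatrixOver ℂ n).mulVec 1) + (diffMatrixOver ℂ n).mulVec (star y.2) =
      star (-(y.1 • (diffMatrixOver ℂ n).mulVec 1) + (diffMatrixOver ℂ n).mulVec y.2)
    have h1 := diffMatrixOver_mulVec_star (n := n) 1
    rw [star_one] at h1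
    rw [star_add, star_neg, star_smul, ← h1, diffMatrixOver_mulVec_star]

lemma blowupVec_star (z : ℂ) : blowupVec n (star z) = star (blowupVec n z) := by
  have hone := diffMatrixOver_mulVec_star (n := n) 1
  rw [star_one] at hone
  have hinv : ∀ M : Matrix (Fin n) (Fin n) ℂ, (M.map star)⁻¹ = M⁻¹.map star := fun M => by
    change M.conjTranspose.transpose⁻¹ = M⁻¹.conjTranspose.transpose
    rw [← Matrix.transpose_nonsing_inv, ← Matrix.conjTranspose_nonsing_inv]
  refine Prod.ext ?_ ?_
  · simp [blowupVec]
  · change _ = star ((diffMatrixOver ℂ n - z • (1 : Matrix (Fin n) (Fin n) ℂ))⁻¹.mulVec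
      ((diffMatrixOver ℂ n).mulVec 1))
    rw [← conj_mulVec, ← hone, ← hinv]
    change (diffMatrixOver ℂ n - star z • (1 : Matrix (Fin n) (Fin n) ℂ))⁻¹.mulVec
      ((diffMatrixOver ℂ n).mulVec 1) = _
    congr 2
    ext i j
    by_cases hij : i = j <;> simp [diffMatrixOver, hij]

lemma charFun_star (z : ℂ) : charFun n L (star z) = star (charFun n L z) := by
  rw [charFun, charFun, blowupVec_star, star_interp, complexify_star, star_sub]

lemma hasEigenvalue_star {z : ℂ} (h : (complexLinear n L).HasEigenvalue z) :
    (complexLinear n L).HasEigenvalue (star z) := by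
  obtain ⟨y, hy⟩ := h.exists_hasEigenvector
  refine Module.End.hasEigenvalue_of_hasEigenvector (x := star y) ⟨?_, fun h0 => hy.2 (star_eq_zero.1 h0)⟩
  rw [Module.End.mem_eigenspace_iff, complexLinear_star, hy.apply_eq_smul, star_smul]

/-- The Schwarz reflection principle for the extension of a real function. -/
lemma eventually_extension_star {G : C(HistoryInterval, ℝ) → ℝ} {Gc : C(HistoryInterval, ℂ) → ℂ}
    (hGc : AnalyticAt ℂ Gc 0) (hGcG : ∀ φ, Gc (toComplexFun φ) = (G φ : ℂ)) :
    ∀ᶠ φ in 𝓝 (0 : C(HistoryInterval, ℂ)), Gc (star φ) = star (Gc φ) := by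
  obtain ⟨δ, hδ, hball⟩ := Metric.eventually_nhds_iff_ball.1 hGc.eventually_analyticAt
  filter_upwards [Metric.ball_mem_nhds (0 : C(HistoryInterval, ℂ)) (show 0 < δ / 3 by positivity)]
    with φ hφ
  rw [mem_ball_zero_iff] at hφ
  set a := toComplexFun (reFun φ) with ha
  set b := toComplexFun (imFun φ) with hb
  have hale : ‖a‖ ≤ ‖φ‖ := (ContinuousMap.norm_le _ (norm_nonneg _)).2 fun θ => by
    have := Complex.abs_re_le_norm (φ θ)
    simpa [ha, toComplexFun, reFun] using this.trans (φ.norm_coe_le_norm θ)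
  have hble : ‖b‖ ≤ ‖φ‖ := (ContinuousMap.norm_le _ (norm_nonneg _)).2 fun θ => by
    have := Complex.abs_im_le_norm (φ θ)
    simpa [hb, toComplexFun, imFun] using this.trans (φ.norm_coe_le_norm θ)
  -- Reflection is reduced to one variable: z = i gives φ and z = -i gives its conjugate. For |z| <
  -- 2 the argument has norm at most 3‖φ‖ < δ, and g agrees with its reflection on the real axis.
  set g : ℂ → ℂ := fun z => Gc (a + z • b) with hg
  have hgd : ∀ z ∈ Metric.ball (0 : ℂ) 2, DifferentiableAt ℂ g z := by
    intro z hz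
    rw [mem_ball_zero_iff] at hz
    have h1 : a + z • b ∈ Metric.ball (0 : C(HistoryInterval, ℂ)) δ := by
      rw [mem_ball_zero_iff]
      have h2 : ‖z • b‖ ≤ 2 * ‖φ‖ := by
        rw [norm_smul]
        gcongr
      linarith [norm_add_le a (z • b)]
    have h3 : DifferentiableAt ℂ (fun z : ℂ => a + z • b) z :=
      (differentiableAt_const a).add (differentiableAt_id.smul_const b)
    exact (hball _ h1).differentiableAt.comp z h3
  have hgan : AnalyticOnNhd ℂ g (Metric.ball 0 2) :=
    DifferentiableOn.analyticOnNhd (fun z hz => (hgd z hz).differentiableWithinAt) Metric.isOpen_ball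
  have hgan' : AnalyticOnNhd ℂ (star ∘ g ∘ star) (Metric.ball 0 2) := by
    refine DifferentiableOn.analyticOnNhd (fun z hz => ?_) Metric.isOpen_ball
    have hz' : star z ∈ Metric.ball (0 : ℂ) 2 := by
      rw [mem_ball_zero_iff] at hz ⊢
      rwa [norm_star]
    have := (hgd _ hz').star_star
    rw [star_star] at this
    exact this.differentiableWithinAt
  have hreal : ∀ s : ℝ, g s = (star ∘ g ∘ star) s := by
    intro s
    have h1 : a + (s : ℂ) • b = toComplexFun (reFun φ + s • imFun φ) := by
      ext θ
      simp [ha, hb, toComplexFun]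
    have h2 : star (s : ℂ) = s := Complex.conj_ofReal s
    rw [Function.comp_apply, Function.comp_apply, h2, hg]
    simp only
    rw [h1, hGcG]
    exact (Complex.conj_ofReal _).symm
  have hfreq : ∃ᶠ z in 𝓝[≠] (0 : ℂ), g z = (star ∘ g ∘ star) z := by
    have ht : Tendsto (fun s : ℝ => (s : ℂ)) (𝓝[≠] 0) (𝓝[≠] 0) := by
      refine tendsto_nhdsWithin_iff.2 ⟨?_, ?_⟩
      · have := Complex.continuous_ofReal.tendsto 0
        exact this.mono_left nhdsWithin_le_nhds
      · filter_upwards [self_mem_nhdsWithin] with s hs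
        simpa using hs
    exact ht.frequently (Eventually.of_forall hreal).frequently
  have hI : Complex.I ∈ Metric.ball (0 : ℂ) 2 := by simp
  have := hgan.eqOn_of_preconnected_of_frequently_eq hgan' (convex_ball (0 : ℂ) 2).isPreconnected
    (Metric.mem_ball_self two_pos) hfreq hI
  have h1 : a + Complex.I • b = φ := (toComplexFun_re_im φ).symm
  have h2 : a + star Complex.I • b = star φ := by
    ext θ
    apply Complex.ext <;> simp [ha, hb, toComplexFun, reFun, imFun]
  rw [Function.comp_apply, Function.comp_apply, hg] at this
  simp only at this
  rw [h1, h2] at this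
  rw [this, star_star]

/-! The antilinear symmetry of the parameter space. -/

variable (τ : Equiv.Perm (Fin d)) (κ : Fin d → ℂ)

/-- The reflection `σ ↦ conj (κ_{τ j} σ_{τ j})` of the parameter space. -/
def conjParam (σ : Fin d → ℂ) : Fin d → ℂ := fun j => star (κ (τ j) * σ (τ j))

/-- The transformation of Taylor coefficients `f ↦ conj ∘ f ∘ conjParam`. -/
def conjCoeff (x : MultiIndex d → ℂ) : MultiIndex d → ℂ :=
  fun β => monom κ β * star (x (β ∘ τ))

variable {τ κ}

lemma order_comp_perm (β : MultiIndex d) : MultiIndex.order (β ∘ τ) = β.order :=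
  Equiv.sum_comp τ β

/-- Reindexing the product by τ moves the permutation from the parameters to the exponents; this
identity dictates the form of `conjCoeff`. -/
lemma monom_conjParam (σ : Fin d → ℂ) (β : MultiIndex d) :
    monom (conjParam τ κ σ) (β ∘ τ) = star (monom κ β * monom σ β) := by
  simp only [monom, conjParam, Function.comp_apply]
  rw [← Finset.prod_mul_distrib, Equiv.prod_comp τ fun j => star (κ j * σ j) ^ β j, star_prod]
  refine Finset.prod_congr rfl fun j _ => ?_
  rw [← star_pow, mul_pow]

lemma pairing_comp_perm {lam : Fin d → ℂ} (hτ : ∀ j, τ (τ j) = j) (hlam : ∀ j, lam (τ j) = star (lam j))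
    (β : MultiIndex d) : pairing lam (β ∘ τ) = star (pairing lam β) := by
  have h1 : pairing lam (β ∘ τ) = ∑ j, lam (τ (τ j)) * (β (τ j) : ℂ) := by
    simp only [pairing, hτ, Function.comp_apply]
  rw [h1, Equiv.sum_comp τ fun j => lam (τ j) * (β j : ℂ), pairing, star_sum]
  refine Finset.sum_congr rfl fun j _ => ?_
  rw [hlam, star_mul', star_natCast]

lemma norm_conjParam_le (σ : Fin d → ℂ) : ‖conjParam τ κ σ‖ ≤ ‖κ‖ * ‖σ‖ := by
  refine (pi_norm_le_iff_of_nonneg (by positivity)).2 fun j => ?_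
  rw [conjParam, norm_star, norm_mul]
  exact mul_le_mul (norm_le_pi_norm κ _) (norm_le_pi_norm σ _) (norm_nonneg _) (norm_nonneg _)

lemma tendsto_conjParam : Tendsto (conjParam τ κ) (𝓝 0) (𝓝 0) := by
  refine squeeze_zero_norm norm_conjParam_le ?_
  have : Tendsto (fun σ : Fin d → ℂ => ‖κ‖ * ‖σ‖) (𝓝 0) (𝓝 (‖κ‖ * ‖(0 : Fin d → ℂ)‖)) :=
    (continuous_const.mul continuous_norm).tendsto 0
  simpa using this

/-- `β ↦ β ∘ τ` as a permutation of the multi-indices. -/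
def compPerm (τ : Equiv.Perm (Fin d)) : Equiv.Perm (MultiIndex d) :=
  τ.symm.arrowCongr (Equiv.refl ℕ)

lemma compPerm_apply (β : MultiIndex d) : compPerm τ β = β ∘ τ := rfl

lemma sum_indicesUpTo_comp_perm {M : Type*} [AddCommMonoid M] (g : MultiIndex d → M) (k : ℕ) :
    ∑ β ∈ indicesUpTo d k, g (β ∘ τ) = ∑ β ∈ indicesUpTo d k, g β :=
  Finset.sum_equiv (compPerm τ) (fun β => by rw [compPerm_apply, mem_indicesUpTo, mem_indicesUpTo,
    order_comp_perm]) fun β _ => rfl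

lemma HasTaylorUpTo.conj {f : (Fin d → ℂ) → ℂ} {a : MultiIndex d → ℂ} {k : ℕ}
    (h : HasTaylorUpTo f a k) :
    HasTaylorUpTo (fun σ => star (f (conjParam τ κ σ))) (conjCoeff τ κ a) k := by
  have h1 := (h.comp_tendsto (tendsto_conjParam (τ := τ) (κ := κ)))
  have h2 : (fun σ => ‖conjParam τ κ σ‖ ^ (k + 1)) =O[𝓝 0] fun σ => ‖σ‖ ^ (k + 1) := by
    refine IsBigO.pow (IsBigO.of_bound ‖κ‖ (Eventually.of_forall fun σ => ?_)) _
    rw [norm_norm, norm_norm]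
    exact norm_conjParam_le σ
  refine ((h1.trans h2).norm_left.congr_left fun σ => ?_).of_norm_left
  rw [Function.comp_apply, ← norm_star, star_sub, star_sum,
    ← sum_indicesUpTo_comp_perm (τ := τ)]
  congr 2
  refine Finset.sum_congr rfl fun β _ => ?_
  rw [monom_conjParam, star_mul', star_star, conjCoeff]
  ring

lemma truncatedArg_conjCoeff {lam : Fin d → ℂ} (hτ : ∀ j, τ (τ j) = j)
    (hlam : ∀ j, lam (τ j) = star (lam j)) (x : MultiIndex d → ℂ) (k : ℕ) (σ : Fin d → ℂ) :
    truncatedArg n lam (conjCoeff τ κ x) k σ = star (truncatedArg n lam x k (conjParam τ κ σ)) := by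
  rw [truncatedArg, truncatedArg, star_sum, ← sum_indicesUpTo_comp_perm (τ := τ) (fun β =>
    star (monom (conjParam τ κ σ) β • x β • interp ℂ n (blowupVec n (pairing lam β))))]
  refine Finset.sum_congr rfl fun β _ => ?_
  rw [monom_conjParam, pairing_comp_perm hτ hlam, blowupVec_star, star_interp, smul_smul, smul_smul,
    star_smul, star_star, star_mul', star_star, conjCoeff]
  congr 1
  ring

lemma Pn_conjCoeff {lam : Fin d → ℂ} (hτ : ∀ j, τ (τ j) = j)
    (hlam : ∀ j, lam (τ j) = star (lam j)) (x : MultiIndex d → ℂ) (σ : Fin d → ℂ) :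
    Pn n lam (conjCoeff τ κ x) σ = star (Pn n lam x (conjParam τ κ σ)) := by
  rw [Pn, Pn, tsum_star, ← (compPerm τ).tsum_eq (fun β =>
    star ((x β * monom (conjParam τ κ σ) β) • blowupVec n (pairing lam β)))]
  refine tsum_congr fun β => ?_
  rw [compPerm_apply, monom_conjParam, pairing_comp_perm hτ hlam, blowupVec_star,
    star_smul, star_star, star_mul', star_star, conjCoeff]
  congr 1
  ring

/-- By Schwarz reflection the composition for the reflected coefficients equals, near 0, the
conjugate of the composition at the reflected parameter. Uniqueness of Taylor coefficients then
yields the identity. -/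
lemma Hn_conjCoeff {G : C(HistoryInterval, ℝ) → ℝ} {Gc : C(HistoryInterval, ℂ) → ℂ}
    (hGc : AnalyticAt ℂ Gc 0) (hGcG : ∀ φ, Gc (toComplexFun φ) = (G φ : ℂ))
    {lam : Fin d → ℂ} (hτ : ∀ j, τ (τ j) = j) (hlam : ∀ j, lam (τ j) = star (lam j))
    {x : MultiIndex d → ℂ} (hx : x 0 = 0) :
    Hn n Gc lam (conjCoeff τ κ x) = conjCoeff τ κ (Hn n Gc lam x) := by
  have hx' : conjCoeff τ κ x 0 = 0 := by
    have : (0 : MultiIndex d) ∘ τ = 0 := rfl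
    rw [conjCoeff, this, hx, star_zero, mul_zero]
  refine ((hasTaylorUpTo_truncatedComp_iff (by rwa [hx', history_zero_smul]) _).1 fun k => ?_).symm
  have h1 := (hasTaylorUpTo_Hn (n := n) (lam := lam) (x := x)
    (by rwa [hx, history_zero_smul]) k).conj (τ := τ) (κ := κ)
  refine h1.congr' ?_ EventuallyEq.rfl
  have ht : Tendsto (fun σ => truncatedArg n lam x k (conjParam τ κ σ)) (𝓝 0) (𝓝 0) := by
    have := (tendsto_truncatedArg (n := n) lam x k).comp (tendsto_conjParam (τ := τ) (κ := κ))
    rwa [hx, history_zero_smul] at this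
  filter_upwards [ht.eventually (eventually_extension_star hGc hGcG)] with σ hσ
  rw [truncatedComp_eq, truncatedComp_eq, truncatedArg_conjCoeff hτ hlam, hσ]

end Conjugation

/-! ### The space R as the fixed space of a reflection, and reality of P_n -/

section RealManifold

open Asymptotics

variable {n d : ℕ} {L : C(HistoryInterval, ℝ) →L[ℝ] ℝ} {G : C(HistoryInterval, ℝ) → ℝ}
  {Gc : C(HistoryInterval, ℂ) → ℂ} {lam : Fin d → ℂ} {ξ p : MultiIndex d → ℂ}
  {τ : Equiv.Perm (Fin d)}

/-- The factors `ξ_j / conj ξ_{τ j}` of the reflection that fixes the real parameters. -/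
def reflectionFactor (τ : Equiv.Perm (Fin d)) (ξ : MultiIndex d → ℂ) (j : Fin d) : ℂ :=
  ξ (Pi.single j 1) / star (ξ (Pi.single (τ j) 1))

lemma conjParam_add (κ σ ρ : Fin d → ℂ) :
    conjParam τ κ (σ + ρ) = conjParam τ κ σ + conjParam τ κ ρ := by
  funext j
  simp only [conjParam, Pi.add_apply, mul_add, star_add]

lemma conjParam_smul (κ σ : Fin d → ℂ) (c : ℂ) :
    conjParam τ κ (c • σ) = star c • conjParam τ κ σ := by
  funext j
  simp only [conjParam, Pi.smul_apply, smul_eq_mul, star_mul']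
  ring

lemma conjParam_diagMap (κ σ : Fin d → ℂ) {c : Fin d → ℂ} (hc : ∀ j, c (τ j) = star (c j)) :
    conjParam τ κ (diagMap c σ) = diagMap c (conjParam τ κ σ) := by
  funext j
  simp only [conjParam, diagMap_apply, star_mul', hc, star_star]
  ring

/-- The real part of a state, as a continuous linear map. -/
def reStateCLM (n : ℕ) : State ℂ n →L[ℝ] State ℝ n :=
  LinearMap.toContinuousLinearMap
    { toFun := reState
      map_add' := fun y z => by ext <;> simp [reState]
      map_smul' := fun c y => by ext <;> simp [reState] }

/-- The inclusion of the real states, as a continuous linear map. -/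
def toComplexStateCLM (n : ℕ) : State ℝ n →L[ℝ] State ℂ n :=
  LinearMap.toContinuousLinearMap
    { toFun := toComplexState
      map_add' := fun y z => by ext <;> simp [toComplexState]
      map_smul' := fun c y => by ext <;> simp [toComplexState] }

lemma reStateCLM_apply (y : State ℂ n) : reStateCLM n y = reState y := rfl

lemma toComplexStateCLM_apply (y : State ℝ n) : toComplexStateCLM n y = toComplexState y := rfl

@[simp] lemma reState_toComplexState (y : State ℝ n) : reState (toComplexState y) = y := by
  ext <;> simp [reState, toComplexState]

lemma toComplexState_reState_of_star_eq {y : State ℂ n} (hy : star y = y) :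
    toComplexState (reState y) = y := by
  refine Prod.ext ?_ ?_
  · exact Complex.conj_eq_iff_re.1 (congrArg Prod.fst hy)
  · funext j
    exact Complex.conj_eq_iff_re.1 (congrFun (congrArg Prod.snd hy) j)

lemma star_toComplexState (y : State ℝ n) : star (toComplexState y) = toComplexState y := by
  refine Prod.ext ?_ ?_
  · simp [toComplexState]
  · funext j
    simp [toComplexState]

lemma interp_toComplexState (y : State ℝ n) :
    interp ℂ n (toComplexState y) = toComplexFun (interp ℝ n y) := by
  ext θ
  simp [interp, toComplexState, toComplexFun, lagrangeFun]

lemma complexify_toComplexFun (φ : C(HistoryInterval, ℝ)) :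
    complexify (L : C(HistoryInterval, ℝ) →ₗ[ℝ] ℝ) (toComplexFun φ) = (L φ : ℂ) := by
  have h1 : reFun (toComplexFun φ) = φ := by ext; simp [reFun, toComplexFun]
  have h2 : imFun (toComplexFun φ) = 0 := by ext; simp [imFun, toComplexFun]
  change ((L (reFun (toComplexFun φ)) : ℝ) : ℂ) + Complex.I * (L (imFun (toComplexFun φ)) : ℂ) = _
  rw [h1, h2, map_zero]
  simp

lemma complexLinear_toComplexState (y : State ℝ n) :
    complexLinear n L (toComplexState y) =
      toComplexState (psLinear n (L : C(HistoryInterval, ℝ) →ₗ[ℝ] ℝ) y) := by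
  refine Prod.ext ?_ ?_
  · change complexify (L : C(HistoryInterval, ℝ) →ₗ[ℝ] ℝ) (interp ℂ n (toComplexState y)) = _
    rw [interp_toComplexState, complexify_toComplexFun]
    rfl
  · funext i
    simp [psLinear, toComplexState, Matrix.mulVec, dotProduct, diffMatrixOver]

lemma complexField_toComplexState (hGcG : ∀ φ, Gc (toComplexFun φ) = (G φ : ℂ)) (y : State ℝ n) :
    complexField n L Gc (toComplexState y) =
      toComplexState (psField n (L : C(HistoryInterval, ℝ) →ₗ[ℝ] ℝ) G y) := by
  have h1 : Gc (interp ℂ n (toComplexState y)) = (G (interp ℝ n y) : ℂ) := by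
    rw [interp_toComplexState, hGcG]
  have h2 : psNonlinear n Gc (toComplexState y) = toComplexState (psNonlinear n G y) := by
    refine Prod.ext h1 ?_
    funext j
    simp [psNonlinear, toComplexState]
  change complexLinear n L (toComplexState y) + psNonlinear n Gc (toComplexState y) = _
  rw [complexLinear_toComplexState, h2]
  exact ((toComplexStateCLM n).map_add _ _).symm

lemma psField_eq_re (hGcG : ∀ φ, Gc (toComplexFun φ) = (G φ : ℂ)) :
    psField n (L : C(HistoryInterval, ℝ) →ₗ[ℝ] ℝ) G =
      fun y => reStateCLM n (complexField n L Gc (toComplexStateCLM n y)) := by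
  funext y
  rw [toComplexStateCLM_apply, complexField_toComplexState hGcG, reStateCLM_apply,
    reState_toComplexState]

namespace IsUnstableExpansion

/-- The unstable eigenvalues are closed under complex conjugation. -/
lemma exists_conj_perm (h : IsUnstableExpansion n L Gc lam ξ p) :
    ∃ τ : Equiv.Perm (Fin d), (∀ j, τ (τ j) = j) ∧ ∀ j, lam (τ j) = star (lam j) := by
  have h1 : ∀ j, ∃ i, lam i = star (lam j) := fun j =>
    h.exists_eq_of_hasEigenvalue (hasEigenvalue_star (h.hasEigenvalue j)) (by simpa using h.re_pos j)
  choose t ht using h1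
  have hinv : Function.Involutive t := fun j => h.injective (by rw [ht, ht, star_star])
  exact ⟨hinv.toPerm, hinv, ht⟩

lemma reflectionFactor_mul (h : IsUnstableExpansion n L Gc lam ξ p) (hτ : ∀ j, τ (τ j) = j)
    (j : Fin d) : reflectionFactor τ ξ j * star (reflectionFactor τ ξ (τ j)) = 1 := by
  have h1 := h.xi_single_ne_zero j
  have h2 : star (ξ (Pi.single (τ j) 1)) ≠ 0 := star_ne_zero.2 (h.xi_single_ne_zero _)
  rw [reflectionFactor, reflectionFactor, hτ, star_div₀, star_star]
  field_simp

lemma reflectionFactor_mul_star (h : IsUnstableExpansion n L Gc lam ξ p)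
    (j : Fin d) : reflectionFactor τ ξ j * star (ξ (Pi.single (τ j) 1)) = ξ (Pi.single j 1) :=
  div_mul_cancel₀ _ (star_ne_zero.2 (h.xi_single_ne_zero _))

lemma conjParam_conjParam (h : IsUnstableExpansion n L Gc lam ξ p) (hτ : ∀ j, τ (τ j) = j)
    (σ : Fin d → ℂ) :
    conjParam τ (reflectionFactor τ ξ) (conjParam τ (reflectionFactor τ ξ) σ) = σ := by
  funext j
  have h1 := h.reflectionFactor_mul hτ j
  simp only [conjParam, hτ, star_mul', star_star]
  linear_combination σ j * h1

/-- In the scaled coordinates ξ_jσ_j the reflection is plain conjugation combined with the swap τ of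
conjugate eigenvalues, which is exactly the condition defining R. -/
lemma xi_mul_conjParam (h : IsUnstableExpansion n L Gc lam ξ p) (hτ : ∀ j, τ (τ j) = j)
    (σ : Fin d → ℂ) (j : Fin d) : ξ (Pi.single j 1) * conjParam τ (reflectionFactor τ ξ) σ j =
      star (ξ (Pi.single (τ j) 1) * σ (τ j)) := by
  have h1 := h.reflectionFactor_mul hτ j
  have h2 := h.reflectionFactor_mul_star (τ := τ) j
  rw [conjParam, star_mul', star_mul']
  linear_combination star (ξ (Pi.single (τ j) 1)) * star (σ (τ j)) * h1 -
    star (reflectionFactor τ ξ (τ j)) * star (σ (τ j)) * h2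

lemma mem_realParameters_iff (h : IsUnstableExpansion n L Gc lam ξ p) (hτ : ∀ j, τ (τ j) = j)
    (hlam : ∀ j, lam (τ j) = star (lam j)) (σ : Fin d → ℂ) :
    σ ∈ realParameters lam ξ ↔ conjParam τ (reflectionFactor τ ξ) σ = σ := by
  change (∀ i j, lam i = star (lam j) →
    ξ (Pi.single i 1) * σ i = star (ξ (Pi.single j 1) * σ j)) ↔ _
  constructor
  · intro hσ
    funext j
    refine mul_left_cancel₀ (h.xi_single_ne_zero j) ?_
    rw [h.xi_mul_conjParam hτ, hσ j (τ j) (by rw [hlam, star_star])]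
  · intro hσ i j hij
    obtain rfl : j = τ i := h.injective (by rw [hlam, hij, star_star])
    rw [← h.xi_mul_conjParam hτ, hσ]

/-- The coefficients inherit the conjugation symmetry of the real equation. -/
lemma conjCoeff_eq (h : IsUnstableExpansion n L Gc lam ξ p)
    (hGcG : ∀ φ, Gc (toComplexFun φ) = (G φ : ℂ)) (hτ : ∀ j, τ (τ j) = j)
    (hlam : ∀ j, lam (τ j) = star (lam j)) : conjCoeff τ (reflectionFactor τ ξ) p = p := by
  set κ := reflectionFactor τ ξ with hκ
  have h0 : conjCoeff τ κ p 0 = 0 := by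
    have : (0 : MultiIndex d) ∘ τ = 0 := rfl
    rw [conjCoeff, this, h.coeff_zero, star_zero, mul_zero]
  suffices key : ∀ m, ∀ β : MultiIndex d, β.order = m → conjCoeff τ κ p β = p β from
    funext fun β => key _ β rfl
  intro m
  induction m using Nat.strong_induction_on with
  | _ m ih =>
    intro β hβ
    rcases Nat.lt_or_ge m 2 with hm | hm
    · rcases Nat.eq_zero_or_pos m with rfl | hm0
      · rw [eq_zero_of_order_eq_zero hβ, h0, h.coeff_zero]
      · obtain ⟨j, rfl⟩ := exists_eq_single_of_order_eq_one (by omega : β.order = 1)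
        have h1 : (Pi.single j 1 : MultiIndex d) ∘ τ = Pi.single (τ j) 1 := by
          funext i
          simp only [Function.comp_apply, Pi.single_apply]
          congr 1
          exact propext ⟨fun hi => by rw [← hi, hτ], fun hi => by rw [hi, hτ]⟩
        rw [conjCoeff, h1, monom_single, h.coeff_single, h.coeff_single, h.reflectionFactor_mul_star]
    · have h2 : 2 ≤ β.order := hβ ▸ hm
      -- H_n at β sees only lower orders, where the induction hypothesis applies. Both coefficients
      -- then solve the same scalar equation, whose factor Δ_n(⟨λ,β⟩) is nonzero.
      have h3 : Hn n Gc lam (conjCoeff τ κ p) β = Hn n Gc lam p β :=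
        Hn_congr h.analyticAt h.fderiv_zero h0 h.coeff_zero fun γ hγ => ih γ.order (hβ ▸ hγ) γ rfl
      rw [Hn_conjCoeff h.analyticAt hGcG hτ hlam h.coeff_zero, ← h.charFun_mul_coeff (by omega),
        conjCoeff, ← h.charFun_mul_coeff (by rw [order_comp_perm]; omega),
        pairing_comp_perm hτ hlam, charFun_star, star_mul', star_star, ← mul_assoc] at h3
      exact mul_right_cancel₀ (h.charFun_ne_zero h2) h3

lemma star_Pn (h : IsUnstableExpansion n L Gc lam ξ p)
    (hGcG : ∀ φ, Gc (toComplexFun φ) = (G φ : ℂ)) {σ : Fin d → ℂ}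
    (hσ : σ ∈ realParameters lam ξ) : star (Pn n lam p σ) = Pn n lam p σ := by
  obtain ⟨τ, hτ, hlam⟩ := h.exists_conj_perm
  have h1 := Pn_conjCoeff (n := n) (κ := reflectionFactor τ ξ) hτ hlam p σ
  rw [h.conjCoeff_eq hGcG hτ hlam, (h.mem_realParameters_iff hτ hlam σ).1 hσ] at h1
  exact h1.symm

lemma tangent_conjParam (h : IsUnstableExpansion n L Gc lam ξ p) (hτ : ∀ j, τ (τ j) = j)
    (hlam : ∀ j, lam (τ j) = star (lam j)) (σ : Fin d → ℂ) :
    tangent n lam ξ (conjParam τ (reflectionFactor τ ξ) σ) = star (tangent n lam ξ σ) := by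
  rw [tangent_apply, tangent_apply, star_sum,
    ← Equiv.sum_comp τ fun j => star (σ j • ξ (Pi.single j 1) • blowupVec n (lam j))]
  refine Finset.sum_congr rfl fun j _ => ?_
  rw [smul_smul, mul_comm, h.xi_mul_conjParam hτ, smul_smul, hlam, blowupVec_star, star_smul,
    star_star, mul_comm]

/-- R is the fixed space of an antilinear involution C, so ℂ^d = R ⊕ iR and 2 dim R = 2d. -/
lemma finrank_realParameters (h : IsUnstableExpansion n L Gc lam ξ p) :
    Module.finrank ℝ (realParameters lam ξ) = d := by
  obtain ⟨τ, hτ, hlam⟩ := h.exists_conj_perm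
  set C := conjParam τ (reflectionFactor τ ξ) with hC
  have hmem := h.mem_realParameters_iff hτ hlam
  have hI : star Complex.I = -Complex.I := Complex.conj_I
  have hII : Complex.I * Complex.I = -1 := Complex.I_mul_I
  let f : (realParameters lam ξ × realParameters lam ξ) →ₗ[ℝ] (Fin d → ℂ) :=
    { toFun := fun q => (q.1 : Fin d → ℂ) + Complex.I • (q.2 : Fin d → ℂ)
      map_add' := fun q q' => by
        simp only [Prod.fst_add, Prod.snd_add, Submodule.coe_add, smul_add]
        abel
      map_smul' := fun c q => by
        simp only [Prod.smul_fst, Prod.smul_snd, Submodule.coe_smul, smul_add, RingHom.id_apply]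
        rw [smul_comm] }
  have hf : Function.Bijective f := by
    constructor
    · rw [injective_iff_map_eq_zero]
      rintro ⟨a, b⟩ hab
      have h1 : (a : Fin d → ℂ) + Complex.I • (b : Fin d → ℂ) = 0 := hab
      have h2 : (a : Fin d → ℂ) - Complex.I • (b : Fin d → ℂ) = 0 := by
        have := congrArg C h1
        rw [hC, conjParam_add, conjParam_smul, (hmem a).1 a.2, (hmem b).1 b.2, hI, neg_smul] at this
        rw [sub_eq_add_neg, this]
        funext j
        simp [conjParam]
      have h3 : (2 : ℂ) • (a : Fin d → ℂ) = 0 := by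
        have : (2 : ℂ) • (a : Fin d → ℂ) = ((a : Fin d → ℂ) + Complex.I • (b : Fin d → ℂ)) +
          ((a : Fin d → ℂ) - Complex.I • (b : Fin d → ℂ)) := by rw [two_smul]; abel
        rw [this, h1, h2, add_zero]
      have h4 : (a : Fin d → ℂ) = 0 := (smul_eq_zero.1 h3).resolve_left two_ne_zero
      have h5 : (b : Fin d → ℂ) = 0 := by
        rw [h4, zero_add] at h1
        exact (smul_eq_zero.1 h1).resolve_left Complex.I_ne_zero
      exact Prod.ext (Subtype.ext h4) (Subtype.ext h5)
    · intro σ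
      have hCC : C (C σ) = σ := h.conjParam_conjParam hτ σ
      have h2 : star (1 / 2 : ℂ) = 1 / 2 := by simp
      have h3 : star (-(Complex.I / 2)) = Complex.I / 2 := by
        rw [star_neg, star_div₀, hI, star_ofNat]
        ring
      -- The real and imaginary parts of `σ` with respect to the involution `C`.
      refine ⟨(⟨(1 / 2 : ℂ) • (σ + C σ), (hmem _).2 ?_⟩,
        ⟨(-(Complex.I / 2)) • (σ + (-1 : ℂ) • C σ), (hmem _).2 ?_⟩), ?_⟩
      · rw [conjParam_smul, conjParam_add, ← hC, hCC, h2, add_comm]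
      · rw [conjParam_smul, conjParam_add, conjParam_smul, ← hC, hCC, h3]
        funext j
        simp
        ring
      · change (1 / 2 : ℂ) • (σ + C σ) +
          Complex.I • (-(Complex.I / 2)) • (σ + (-1 : ℂ) • C σ) = σ
        funext j
        simp only [Pi.add_apply, Pi.smul_apply, smul_eq_mul]
        linear_combination (-(1 / 2) * (σ j - C σ j)) * hII
  have hdim := (LinearEquiv.ofBijective f hf).finrank_eq
  rw [Module.finrank_prod, Module.finrank_pi_fintype] at hdim
  simp only [Complex.finrank_real_complex, Finset.sum_const, Finset.card_univ, Fintype.card_fin,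
    smul_eq_mul] at hdim
  omega

end IsUnstableExpansion
end RealManifold

/-! ### The unstable manifold of the real ODE -/

section RealConjugacy

open Asymptotics

variable {n d : ℕ} {L : C(HistoryInterval, ℝ) →L[ℝ] ℝ} {G : C(HistoryInterval, ℝ) → ℝ}
  {Gc : C(HistoryInterval, ℂ) → ℂ} {lam : Fin d → ℂ} {ξ p : MultiIndex d → ℂ}

namespace IsUnstableExpansion

lemma diagMap_mem (h : IsUnstableExpansion n L Gc lam ξ p) {c : Fin d → ℂ}
    (hc : ∀ i j, lam i = star (lam j) → c i = star (c j)) {σ : Fin d → ℂ}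
    (hσ : σ ∈ realParameters lam ξ) : diagMap c σ ∈ realParameters lam ξ := by
  obtain ⟨τ, hτ, hlam⟩ := h.exists_conj_perm
  have hmem := h.mem_realParameters_iff hτ hlam
  rw [hmem, conjParam_diagMap _ _ fun j => hc _ _ (hlam j), (hmem σ).1 hσ]

/-- A diagonal operator that commutes with the conjugation, on the real parameters. -/
def realDiagMap (h : IsUnstableExpansion n L Gc lam ξ p) (c : Fin d → ℂ)
    (hc : ∀ i j, lam i = star (lam j) → c i = star (c j)) :
    realParameters lam ξ →L[ℝ] realParameters lam ξ :=
  ((diagMap c).comp (realParameters lam ξ).subtypeL).codRestrict _ fun σ => h.diagMap_mem hc σ.2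

lemma exp_compatible (t : ℝ) (i j : Fin d) (hij : lam i = star (lam j)) :
    Complex.exp (lam i * t) = star (Complex.exp (lam j * t)) := by
  have : star (Complex.exp (lam j * t)) = _ := (Complex.exp_conj _).symm
  rw [this, hij, map_mul, Complex.conj_ofReal]
  rfl

/-- The linear flow on the real parameters. -/
def realFlow (h : IsUnstableExpansion n L Gc lam ξ p) (t : ℝ) :
    realParameters lam ξ →L[ℝ] realParameters lam ξ :=
  h.realDiagMap (fun j => Complex.exp (lam j * t)) (exp_compatible t)

lemma hasFDerivAt_realParam (h : IsUnstableExpansion n L Gc lam ξ p) {σ : realParameters lam ξ}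
    (hσ : σ ∈ Metric.ball (0 : realParameters lam ξ) 1) :
    HasFDerivAt (fun σ : realParameters lam ξ => reState (Pn n lam p σ))
      ((reStateCLM n).comp (((fderiv ℂ (Pn n lam p) σ).restrictScalars ℝ).comp
        (realParameters lam ξ).subtypeL)) σ := by
  have h1 : (σ : Fin d → ℂ) ∈ Metric.ball (0 : Fin d → ℂ) 1 := by
    rwa [mem_ball_zero_iff] at hσ ⊢
  have h2 := (h.analyticOnNhd_Pn _ h1).differentiableAt.hasFDerivAt.restrictScalars ℝ
  have h3 : HasFDerivAt (fun σ : realParameters lam ξ => (σ : Fin d → ℂ))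
    (realParameters lam ξ).subtypeL σ := (realParameters lam ξ).subtypeL.hasFDerivAt
  exact (reStateCLM n).hasFDerivAt.comp σ (h2.comp σ h3)

lemma toComplexState_re_Pn (h : IsUnstableExpansion n L Gc lam ξ p)
    (hGcG : ∀ φ, Gc (toComplexFun φ) = (G φ : ℂ)) {σ : Fin d → ℂ}
    (hσ : σ ∈ realParameters lam ξ) : toComplexState (reState (Pn n lam p σ)) = Pn n lam p σ :=
  toComplexState_reState_of_star_eq (h.star_Pn hGcG hσ)

lemma toComplexState_re_tangent (h : IsUnstableExpansion n L Gc lam ξ p) {σ : Fin d → ℂ}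
    (hσ : σ ∈ realParameters lam ξ) :
    toComplexState (reState (tangent n lam ξ σ)) = tangent n lam ξ σ := by
  obtain ⟨τ, hτ, hlam⟩ := h.exists_conj_perm
  refine toComplexState_reState_of_star_eq ?_
  rw [← h.tangent_conjParam hτ hlam, (h.mem_realParameters_iff hτ hlam σ).1 hσ]

lemma fderiv_realParam_zero (h : IsUnstableExpansion n L Gc lam ξ p) (σ : realParameters lam ξ) :
    fderiv ℝ (fun σ : realParameters lam ξ => reState (Pn n lam p σ)) 0 σ =
      reState (tangent n lam ξ σ) := by
  have h1 : fderiv ℂ (Pn n lam p) ((0 : realParameters lam ξ) : Fin d → ℂ) = tangent n lam ξ :=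
    h.hasFDerivAt_Pn_zero.fderiv
  rw [(h.hasFDerivAt_realParam (Metric.mem_ball_self one_pos)).fderiv, h1]
  rfl

/-- Radius 1 needs no condition on Ω: the segment from 0 to a point of R stays in R, where P_n is
real, and the extension of G is analytic at every real function. -/
lemma isUnstableConjugacy_real (h : IsUnstableExpansion n L Gc lam ξ p)
    (hGcG : ∀ φ, Gc (toComplexFun φ) = (G φ : ℂ)) (hreal : ∀ φ, AnalyticAt ℂ Gc (toComplexFun φ))
    {a : ℝ} (ha : 0 < a) (hlow : ∀ j, a ≤ (lam j).re) :
    IsUnstableConjugacy (psField n (L : C(HistoryInterval, ℝ) →ₗ[ℝ] ℝ) G) 1 a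
      (h.realDiagMap lam fun _ _ => id) h.realFlow
      (fun σ : realParameters lam ξ => reState (Pn n lam p σ)) where
  r_pos := one_pos
  a_pos := ha
  flow_zero σ := Subtype.ext (diagFlow_zero lam σ)
  flow_add s t σ := Subtype.ext (diagFlow_add lam s t σ)
  flow_deriv σ t := by
    have h1 := (hasDerivAt_diagFlow lam (σ : Fin d → ℂ) t).isLittleO
    refine .of_isLittleO (IsLittleO.of_norm_left ?_)
    exact h1.norm_left
  flow_norm t ht σ := norm_diagFlow_le hlow ht (σ : Fin d → ℂ)
  analytic σ hσ := by
    have h1 : (σ : Fin d → ℂ) ∈ Metric.ball (0 : Fin d → ℂ) 1 := by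
      rwa [mem_ball_zero_iff] at hσ ⊢
    have h2 : AnalyticAt ℝ (Pn n lam p) ((realParameters lam ξ).subtypeL σ) :=
      (h.analyticOnNhd_Pn _ h1).restrictScalars
    exact ((reStateCLM n).analyticAt _).comp
      (h2.comp ((realParameters lam ξ).subtypeL.analyticAt σ))
  map_zero := by
    have : Pn n lam p ((0 : realParameters lam ξ) : Fin d → ℂ) = 0 := h.Pn_zero
    simp only [this]
    exact (reStateCLM n).map_zero
  injective := by
    intro σ ρ hσρ
    rw [h.fderiv_realParam_zero, h.fderiv_realParam_zero] at hσρ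
    have := congrArg toComplexState hσρ
    rw [h.toComplexState_re_tangent σ.2, h.toComplexState_re_tangent ρ.2] at this
    exact Subtype.ext (h.tangent_injective this)
  smooth σ hσ := by
    rw [psField_eq_re hGcG]
    refine (reStateCLM n).contDiff.contDiffAt.comp _ (ContDiffAt.comp (g := complexField n L Gc)
      (f := toComplexStateCLM n) _ ?_ (toComplexStateCLM n).contDiff.contDiffAt)
    refine (analyticAt_complexField ?_).restrictScalars.contDiffAt
    rw [toComplexStateCLM_apply, interp_toComplexState]
    exact hreal _
  invariant σ hσ := by
    have h1 : (σ : Fin d → ℂ) ∈ Metric.ball (0 : Fin d → ℂ) 1 := by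
      rwa [mem_ball_zero_iff] at hσ ⊢
    have h2 := h.invariant h1 fun s hs => by
      rw [← h.toComplexState_re_Pn hGcG ((realParameters lam ξ).smul_mem s σ.2),
        interp_toComplexState]
      exact hreal _
    rw [(h.hasFDerivAt_realParam hσ).fderiv]
    change reState (fderiv ℂ (Pn n lam p) σ (fun j => lam j * (σ : Fin d → ℂ) j)) = _
    rw [h2, ← h.toComplexState_re_Pn hGcG σ.2, complexField_toComplexState hGcG,
      reState_toComplexState, reState_toComplexState]

theorem parametrizes_real (h : IsUnstableExpansion n L Gc lam ξ p)
    (hGcG : ∀ φ, Gc (toComplexFun φ) = (G φ : ℂ)) (hreal : ∀ φ, AnalyticAt ℂ Gc (toComplexFun φ)) :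
    ParametrizesLocalUnstableManifold ℝ (psField n (L : C(HistoryInterval, ℝ) →ₗ[ℝ] ℝ) G)
      (Metric.ball (0 : realParameters lam ξ) 1) (fun σ => reState (Pn n lam p σ)) := by
  obtain ⟨a, ha, hlow⟩ := exists_re_lower_bound lam h.re_pos
  obtain ⟨τ, hτ, hlam⟩ := h.exists_conj_perm
  refine (h.isUnstableConjugacy_real hGcG hreal ha hlow).parametrizes fun η hη => ?_
  obtain ⟨H, i1, i2, B, hker, hB⟩ := h.exists_transverse hη
  refine ⟨H, i1, i2, B ∘ₗ (toComplexStateCLM n : State ℝ n →ₗ[ℝ] State ℂ n), fun y => ?_, fun y => ?_⟩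
  · refine (hker (toComplexState y)).trans ⟨?_, ?_⟩
    · rintro ⟨σ, hσ⟩
      -- A parameter with real tangent image is fixed by the reflection, because the tangent map
      -- intertwines it with conjugation and is injective. So restricting `B` to real states has
      -- exactly the real tangent space as kernel.
      have hmem : σ ∈ realParameters lam ξ := by
        rw [h.mem_realParameters_iff hτ hlam]
        apply h.tangent_injective
        rw [h.tangent_conjParam hτ hlam, hσ, star_toComplexState]
      refine ⟨⟨σ, hmem⟩, ?_⟩
      change fderiv ℝ (fun σ : realParameters lam ξ => reState (Pn n lam p σ)) 0 ⟨σ, hmem⟩ = y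
      rw [h.fderiv_realParam_zero, hσ, reState_toComplexState]
    · rintro ⟨σ, rfl⟩
      refine ⟨σ, ?_⟩
      change _ = toComplexState
        (fderiv ℝ (fun σ : realParameters lam ξ => reState (Pn n lam p σ)) 0 σ)
      rw [h.fderiv_realParam_zero, h.toComplexState_re_tangent σ.2]
  · have h1 : HasFDerivAt (complexField n L Gc) ((linearCLM n L).restrictScalars ℝ)
        (toComplexStateCLM n 0) := by
      rw [_root_.map_zero]
      exact (hasFDerivAt_complexField h.analyticAt h.fderiv_zero).restrictScalars ℝ
    have h2 := (reStateCLM n).hasFDerivAt.comp (0 : State ℝ n)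
      (h1.comp (0 : State ℝ n) (toComplexStateCLM n).hasFDerivAt)
    have h3 : fderiv ℝ (psField n (L : C(HistoryInterval, ℝ) →ₗ[ℝ] ℝ) G) 0 y =
        reState (linearCLM n L (toComplexState y)) := by
      rw [psField_eq_re hGcG]
      exact congrArg (fun T => T y) h2.fderiv
    have h4 : linearCLM n L (toComplexState y) =
        toComplexState (psLinear n (L : C(HistoryInterval, ℝ) →ₗ[ℝ] ℝ) y) :=
      complexLinear_toComplexState y
    have h5 := hB (toComplexState y)
    rw [h3]
    change inner ℝ (B (toComplexState y))
      (B (toComplexState (reState (linearCLM n L (toComplexState y))))) ≤ _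
    rwa [h4, reState_toComplexState, ← h4]

end IsUnstableExpansion
end RealConjugacy

end PseudospectralDDE

end

/-! ### Assembly of the theorem -/

theorem mainTheorem1 {n d : ℕ} (hn : 0 < n)
    -- the DDE `x'(t) = L x_t + G(x_t)`; `Gc` is the holomorphic extension of `G`
    (L : C(PseudospectralDDE.HistoryInterval, ℝ) →L[ℝ] ℝ)
    (G : C(PseudospectralDDE.HistoryInterval, ℝ) → ℝ)
    (Ω : Set C(PseudospectralDDE.HistoryInterval, ℂ))
    (Gc : C(PseudospectralDDE.HistoryInterval, ℂ) → ℂ)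
    (hΩ : IsOpen Ω)
    (hΩreal : ∀ φ : C(PseudospectralDDE.HistoryInterval, ℝ),
      PseudospectralDDE.toComplexFun φ ∈ Ω)
    (hGc : AnalyticOnNhd ℂ Gc Ω)
    (hGcG : ∀ φ : C(PseudospectralDDE.HistoryInterval, ℝ),
      Gc (PseudospectralDDE.toComplexFun φ) = (G φ : ℂ))
    (hG0 : G 0 = 0)
    (hG1 : HasFDerivAt G (0 : C(PseudospectralDDE.HistoryInterval, ℝ) →L[ℝ] ℝ) 0)
    -- the unstable eigenvalues
    (lam : Fin d → ℂ) (hlam_inj : Function.Injective lam)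
    (hlam : Multiset.filter (fun z : ℂ => 0 < z.re)
        (PseudospectralDDE.psLinear n (PseudospectralDDE.complexify
          (L : C(PseudospectralDDE.HistoryInterval, ℝ) →ₗ[ℝ] ℝ))).charpoly.roots =
      Multiset.map lam Finset.univ.val)
    -- the non-resonance conditions
    (hres : ∀ β : PseudospectralDDE.MultiIndex d, 2 ≤ β.order →
      PseudospectralDDE.pairing lam β ∉
        spectrum ℂ (PseudospectralDDE.psLinear n (PseudospectralDDE.complexify
          (L : C(PseudospectralDDE.HistoryInterval, ℝ) →ₗ[ℝ] ℝ)) :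
            Module.End ℂ (PseudospectralDDE.State ℂ n)))
    (hD : ∀ β : PseudospectralDDE.MultiIndex d, 1 ≤ β.order →
      PseudospectralDDE.pairing lam β ∉ spectrum ℂ (PseudospectralDDE.diffMatrixOver ℂ n))
    -- the free scalars of order one
    (ξ : PseudospectralDDE.MultiIndex d → ℂ)
    (hξ : ∀ β : PseudospectralDDE.MultiIndex d, β.order = 1 → ξ β ≠ 0) :
    -- `H_n` is the map with the property that defines it
    (∀ x : PseudospectralDDE.MultiIndex d → ℂ,
      x 0 • PseudospectralDDE.interp ℂ n (PseudospectralDDE.blowupVec n 0) ∈ Ω →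
      ∀ a : PseudospectralDDE.MultiIndex d → ℂ,
        (∀ k : ℕ, PseudospectralDDE.HasTaylorUpTo
          (PseudospectralDDE.truncatedComp n Gc lam x k) a k) ↔
        a = PseudospectralDDE.Hn n Gc lam x) ∧
    -- zeros of `F_n` parametrize local unstable manifolds
    ∀ p : PseudospectralDDE.MultiIndex d → ℂ,
      PseudospectralDDE.Fn n L Gc lam ξ p = 0 → Summable (fun β => ‖p β‖) →
      -- the series `P_n` converges on the closed unit polydisk
      (∀ σ ∈ Metric.closedBall (0 : Fin d → ℂ) 1, Summable fun β =>
        ‖(p β * PseudospectralDDE.monom σ β) •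
          PseudospectralDDE.blowupVec n (PseudospectralDDE.pairing lam β)‖) ∧
      -- the complexified ODE, on every polydisk that `P_n` maps into the domain of the ODE
      (∃ r : ℝ, 0 < r ∧ r ≤ 1 ∧ ∀ σ ∈ Metric.ball (0 : Fin d → ℂ) r,
        PseudospectralDDE.interp ℂ n (PseudospectralDDE.Pn n lam p σ) ∈ Ω) ∧
      (∀ r : ℝ, 0 < r → r ≤ 1 →
        (∀ σ ∈ Metric.ball (0 : Fin d → ℂ) r,
          PseudospectralDDE.interp ℂ n (PseudospectralDDE.Pn n lam p σ) ∈ Ω) →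
        PseudospectralDDE.ParametrizesLocalUnstableManifold ℂ
          (PseudospectralDDE.psField n (PseudospectralDDE.complexify
            (L : C(PseudospectralDDE.HistoryInterval, ℝ) →ₗ[ℝ] ℝ)) Gc)
          (Metric.ball (0 : Fin d → ℂ) r) (PseudospectralDDE.Pn n lam p)) ∧
      -- the ODE on `ℝ × ℝⁿ` itself
      Module.finrank ℝ (PseudospectralDDE.realParameters lam ξ) = d ∧
      (∀ σ ∈ PseudospectralDDE.realParameters lam ξ, σ ∈ Metric.ball (0 : Fin d → ℂ) 1 →
        PseudospectralDDE.Pn n lam p σ = PseudospectralDDE.toComplexState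
          (PseudospectralDDE.reState (PseudospectralDDE.Pn n lam p σ))) ∧
      PseudospectralDDE.ParametrizesLocalUnstableManifold ℝ
        (PseudospectralDDE.psField n
          (L : C(PseudospectralDDE.HistoryInterval, ℝ) →ₗ[ℝ] ℝ) G)
        (Metric.ball (0 : PseudospectralDDE.realParameters lam ξ) 1)
        (fun σ => PseudospectralDDE.reState
          (PseudospectralDDE.Pn n lam p (σ : Fin d → ℂ))) := by
  have hreal : ∀ φ, AnalyticAt ℂ Gc (PseudospectralDDE.toComplexFun φ) := fun φ => hGc _ (hΩreal φ)
  have h0Ω : (0 : C(PseudospectralDDE.HistoryInterval, ℂ)) ∈ Ω := by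
    rw [← PseudospectralDDE.toComplexFun_zero]
    exact hΩreal 0
  have hGc0 : AnalyticAt ℂ Gc 0 := hGc 0 h0Ω
  refine ⟨fun x hx a => PseudospectralDDE.hasTaylorUpTo_truncatedComp_iff (hGc _ hx) a,
    fun p hp hsum => ?_⟩
  have h : PseudospectralDDE.IsUnstableExpansion n L Gc lam ξ p :=
    { injective := hlam_inj
      roots := hlam
      nonresonant := hres
      notMem := hD
      scalar_ne_zero := hξ
      analyticAt := hGc0
      map_zero := by rw [← PseudospectralDDE.toComplexFun_zero, hGcG, hG0, Complex.ofReal_zero]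
      fderiv_zero := PseudospectralDDE.fderiv_extension_zero hGc0 hGcG hG1
      Fn_eq_zero := hp
      summable := hsum }
  refine ⟨fun σ hσ => h.summable_Pn (mem_closedBall_zero_iff.1 hσ), ?_,
    fun r hr hr1 hr2 => h.parametrizes_complex hr hr1 fun σ hσ => hGc _ (hr2 σ hσ),
    h.finrank_realParameters, fun σ hσ _ => (h.toComplexState_re_Pn hGcG hσ).symm,
    h.parametrizes_real hGcG hreal⟩
  -- An admissible radius exists by continuity at 0, since P_n(0) = 0 and Ω is an open set
  -- containing 0.
  have ht : Tendsto (fun σ => PseudospectralDDE.interp ℂ n (PseudospectralDDE.Pn n lam p σ))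
      (𝓝 0) (𝓝 0) := by
    have := (PseudospectralDDE.interpCLM n).continuous.continuousAt.tendsto.comp h.tendsto_Pn
    rwa [map_zero] at this
  obtain ⟨r, hr, hball⟩ := Metric.eventually_nhds_iff_ball.1 (ht.eventually (hΩ.mem_nhds h0Ω))
  exact ⟨min r 1, lt_min hr one_pos, min_le_right _ _, fun σ hσ =>
    hball σ (Metric.ball_subset_ball (min_le_left _ _) hσ)⟩
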